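/- For a finite simple graph $G=(V,E)$ let $\mathcal Z(G)$ be the set of all cycles of $G$, i.e. of all $x\subseteq E$ such that every vertex is incident to an even number of edges of $x$. Place a qubit on every edge and let $|\psi_G\rangle=|\mathcal Z(G)|^{-1/2}\sum_{x\in\mathcal Z(G)}|x\rangle$ be the surface code state on $G$. An instance of the Surface Code Marginal problem is a triple $(G,M,\Phi)$ consisting of a planar graph $G=(V,E)$, a subset $M\subseteq E$, and a product state $|\Phi\rangle=\bigotimes_{j\in M}|\phi_j\rangle$ given by a (normalized) single-qubit state $|\phi_j\rangle\in\mathbb C^2$ for every $j\in M$; its value is $$\mu(G,M,\Phi)=\langle\Phi|\rho_M|\Phi\rangle,\qquad \rho_M=\mathrm{Tr}_{j\notin M}|\psi_G\rangle\langle\psi_G| .$$ **Theorem.** There is a polynomial-time algorithm that takes as input a $3$-regular graph $G'$ and outputs an instance $(G,M,\Phi)$ of the Surface Code Marginal problem and a real number $C$ such that the number $\mathsf{PerfMatch}(G')$ of perfect matchings of $G'$ satisfies $$\mathsf{PerfMatch}(G')=C\cdot\mu(G,M,\Phi).$$ The size of $G$ (its number of vertices and edges) is at most polynomial in the size of $G'$.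 Here "polynomial time" refers to deterministic (multi-stack) Turing machines; the input is given by its adjacency matrix, $G$ is output as a list of edges, and the amplitudes of the states $\phi_j$ and the constant $C$ are output exactly, as closed expressions built from $1$ by negation, addition, multiplication, inversion of nonzero numbers and principal square roots. -/

import Mathlib

open scoped Matrix ComplexConjugate

noncomputable section

namespace SurfaceCode

section Semantics

open scoped Classical

/-! ### Planar graphs -/

/-- A drawing of `G` in the plane without crossings: vertices are distinct points, edges are simple
arcs joining the two endpoints, an arc passes through no vertex other than its endpoints,
and two different arcs meet only in common endpoints. -/
structure PlaneDrawing {V : Type} (G : SimpleGraph V) where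
  point : V → ℝ × ℝ
  point_injective : Function.Injective point
  arc : G.edgeSet → unitInterval → ℝ × ℝ
  arc_continuous : ∀ e, Continuous (arc e)
  arc_injective : ∀ e, Function.Injective (arc e)
  arc_ends : ∀ e : G.edgeSet, s(arc e 0, arc e 1) = Sym2.map point e.1
  arc_avoids : ∀ (e : G.edgeSet) (t : unitInterval) (v : V), arc e t = point v → v ∈ e.1
  arc_disjoint : ∀ e f : G.edgeSet, e ≠ f → ∀ s t : unitInterval, arc e s = arc f t →
    ∃ v, v ∈ e.1 ∧ v ∈ f.1 ∧ arc e s = point v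

/-- A graph is planar if it can be drawn in the plane without crossings. -/
def IsPlanar {V : Type} (G : SimpleGraph V) : Prop := Nonempty (PlaneDrawing G)

/-! ### The surface code state and its marginals

Qubits live on the edges. A computational basis state is an assignment of bits to the edges,
that is, a subset of edges. -/

/-- `x` is a cycle: each vertex has an even number of incident edges from `x`. -/
def IsCycle {V : Type} (G : SimpleGraph V) (x : G.edgeSet → Bool) : Prop :=
  ∀ v : V, Even (Nat.card {e : G.edgeSet // v ∈ e.1 ∧ x e = true})

/-- The set `Z(G)` of all cycles. -/
def cycles {V : Type} (G : SimpleGraph V) : Set (G.edgeSet → Bool) := {x | IsCycle G x}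

/-- The surface code state `ψ_G`, the uniform superposition of all cycles of `G`,
given by its amplitudes. -/
def surfaceCodeState {V : Type} (G : SimpleGraph V) (x : G.edgeSet → Bool) : ℂ :=
  if x ∈ cycles G then (((Real.sqrt (cycles G).ncard)⁻¹ : ℝ) : ℂ) else 0

/-- The bit assignment on `E` which is `a` on `M` and `c` on the complement of `M`. -/
def combine {E : Type} (M : Finset E) (a : {e // e ∈ M} → Bool) (c : {e // e ∉ M} → Bool) :
    E → Bool :=
  fun e => if h : e ∈ M then a ⟨e, h⟩ else c ⟨e, h⟩

/-- The reduced density matrix `ρ_M = Tr_{j ∉ M} |ψ⟩⟨ψ|` of a state `ψ` of qubits indexed by `E`. -/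
def reducedDensity {E : Type} [Fintype E] (ψ : (E → Bool) → ℂ) (M : Finset E) :
    Matrix ({e // e ∈ M} → Bool) ({e // e ∈ M} → Bool) ℂ :=
  Matrix.of fun a b => ∑ c : {e // e ∉ M} → Bool, ψ (combine M a c) * conj (ψ (combine M b c))

/-- The tensor product `⨂_{j ∈ M} |φ_j⟩`, where `|φ_j⟩ = φ j false |0⟩ + φ j true |1⟩`. -/
def productState {E : Type} (M : Finset E) (φ : {e // e ∈ M} → Bool → ℂ)
    (a : {e // e ∈ M} → Bool) : ℂ :=
  ∏ j, φ j (a j)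

/-- The quantity `μ(G, M, Φ) = ⟨Φ| ρ_M |Φ⟩` for the surface code state on `G`
and the product state `Φ = ⨂_{j ∈ M} |φ_j⟩`. -/
def marginal {V : Type} [Fintype V] (G : SimpleGraph V) (M : Finset G.edgeSet)
    (φ : {e // e ∈ M} → Bool → ℂ) : ℂ :=
  star (productState M φ) ⬝ᵥ (reducedDensity (surfaceCodeState G) M *ᵥ productState M φ)

end Semantics

/-! ### Exact descriptions of complex numbers -/

/-- Closed arithmetic expressions. -/
inductive Expr : Type
  | one : Expr
  | neg : Expr → Expr
  | add : Expr → Expr → Expr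
  | mul : Expr → Expr → Expr
  | inv : Expr → Expr
  | sqrt : Expr → Expr

namespace Expr

/-- The value of an expression; `sqrt` is the principal complex square root. -/
def value : Expr → ℂ
  | one => 1
  | neg a => -a.value
  | add a b => a.value + b.value
  | mul a b => a.value * b.value
  | inv a => (a.value)⁻¹
  | sqrt a => a.value ^ (1 / 2 : ℂ)

/-- No division by zero occurs in the expression. -/
def Defined : Expr → Prop
  | one => True
  | neg a => a.Defined
  | add a b => a.Defined ∧ b.Defined
  | mul a b => a.Defined ∧ b.Defined
  | inv a => a.Defined ∧ a.value ≠ 0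
  | sqrt a => a.Defined

end Expr

/-! ### Inputs and outputs of the reduction -/

/-- A 3-regular graph on the vertex set `{0, …, n - 1}`. -/
structure CubicGraph where
  n : ℕ
  graph : SimpleGraph (Fin n)
  regular : ∀ v, (graph.neighborSet v).ncard = 3

/-- The number of perfect matchings. -/
def CubicGraph.perfMatch (H : CubicGraph) : ℕ :=
  {P : H.graph.Subgraph | P.IsPerfectMatching}.ncard

/-- An instance of the Surface Code Marginal problem: a planar graph whose edges are labelled by
`0, …, numE - 1`, a subset `M` of its edges, and a single-qubit (unit norm) state for every edge
in `M`, each amplitude being given by a closed expression. -/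
structure SCMInstance where
  numV : ℕ
  numE : ℕ
  graph : SimpleGraph (Fin numV)
  planar : IsPlanar graph
  edge : Fin numE ≃ graph.edgeSet
  M : Finset graph.edgeSet
  amp : {e // e ∈ M} → Bool → Expr
  amp_defined : ∀ j b, (amp j b).Defined
  amp_unit : ∀ j, ‖(amp j false).value‖ ^ 2 + ‖(amp j true).value‖ ^ 2 = 1

/-- The value `μ(G, M, Φ)` of an instance. -/
def SCMInstance.overlap (I : SCMInstance) : ℂ :=
  marginal I.graph I.M fun j b => (I.amp j b).value

/-- A real number given by a closed expression. -/
structure RealConst where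
  expr : Expr
  defined : expr.Defined
  real : expr.value.im = 0

/-- The real number that is described. -/
def RealConst.value (C : RealConst) : ℝ := C.expr.value.re

/-! ### Encodings as strings over finite alphabets -/

open scoped Classical in
/-- The adjacency matrix, row by row; `none` terminates a row. -/
def CubicGraph.encode (H : CubicGraph) : List (Option Bool) :=
  (List.finRange H.n).flatMap fun i =>
    (List.finRange H.n).map (fun j => some (decide (H.graph.Adj i j))) ++ [none]

/-- The output alphabet. -/
inductive Token : Type
  | tick | sep | done
  | one | neg | add | mul | inv | sqrt

/-- Polish notation. -/
def Expr.encode : Expr → List Token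
  | .one => [.one]
  | .neg a => .neg :: a.encode
  | .add a b => .add :: (a.encode ++ b.encode)
  | .mul a b => .mul :: (a.encode ++ b.encode)
  | .inv a => .inv :: a.encode
  | .sqrt a => .sqrt :: a.encode

/-- A natural number in unary, followed by a separator. (It is used for the number of vertices
and for their names only, so that this is polynomially equivalent to binary.) -/
def encodeNat (k : ℕ) : List Token := List.replicate k Token.tick ++ [Token.sep]

open scoped Classical in
/-- The code of one edge: its smaller and its larger endpoint and, if it is in `M`, the amplitudes
of its qubit state at `|0⟩` and `|1⟩`. -/
def SCMInstance.encodeEdge (I : SCMInstance) (e : I.graph.edgeSet) : List Token :=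
  encodeNat e.1.inf ++ encodeNat e.1.sup ++
    (if h : e ∈ I.M then (I.amp ⟨e, h⟩ false).encode ++ (I.amp ⟨e, h⟩ true).encode else []) ++
    [Token.done]

/-- The number of vertices followed by the list of edges. -/
def SCMInstance.encode (I : SCMInstance) : List Token :=
  encodeNat I.numV ++ ((List.finRange I.numE).flatMap fun j => I.encodeEdge (I.edge j)) ++
    [Token.done]

/-- The code of an instance together with a real constant. -/
def encodeOutput (o : SCMInstance × RealConst) : List Token :=
  o.1.encode ++ o.2.expr.encode

end SurfaceCode

end

/-!
The number of perfect matchings of a cubic graph `H` on `{0, …, n - 1}` becomes a marginal of the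
surface code state by a direct construction.

*Marginals as sums of squares.* Tracing out the edges outside `M` gives
`⟨Φ| ρ_M |Φ⟩ = |Z(G)|⁻¹ ∑_c |S_c|²`, where `c` runs over the bit assignments to the discarded edges
and `S_c` is the sum of `∏_{e ∈ M} φ_e (a_e)` over all `a` that complete `c` to a cycle
(`marginal_eq_sum_normSq`).

*The graph.* The graph `G` is an `n` by `n` array of 4-cycles, the cells, in which neighbouring
cells are joined by single edges; a path closes the array on the right, and the edges entering the
array from above and from the left start in vertices of degree one.
The measured edges are those of the cells and of the right side; the discarded edges are the
joining ones. For a fixed `c` the four parity conditions of a cell leave one global flip of its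
four edges, so that `S_c` is a product of sums with two terms (`sum_cycles_eq_prod`, `cellSum_eq`).
Each vertex is sent to a lattice point such that all edges are king moves and no two of them cross
in a unit square; this makes `G` planar (`isPlanar_of_kingMoves`, `isPlanar_gridGraph`). The number
of cycles is `2 ^ (n² + n (n - 1))`, since a cycle is given by one bit in each cell and by the bits
on the edges that enter the cells from above (`ncard_cycles`).

*The states.* Each `k` has a line, which runs down column `k` to the diagonal and then to the right
along row `k`. In a diagonal cell the product state makes the line turn. In a cell `(i, j)` whose
vertices are not adjacent in `H` both lines keep their bits: with the amplitudes `(1, i) / √2` two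
terms of opposite sign cancel otherwise. In a cell of two adjacent vertices the phases are powers of
a sixth root of unity, up to sign, and they leave one more possibility: both bits change from `0`
to `1`. The squared absolute values are the same for all these possibilities (`normSq_cellSum`).
At the right side every line is forced to carry the bit `1`, while all lines start with the bit `0`.

*Counting.* Therefore `|S_c|²` is either `0` or a constant that depends on `n` only, and it is not
`0` if and only if every line changes its bit exactly once, together with the line of a neighbour.
These `c` correspond to the perfect matchings (`overlap_reduction`, `ncard_consistent`). The
constant is `16 ^ n² (128 / 27) ^ n`; regularity of `H` enters here, as it fixes the number of cells
with a modified state.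

*Polynomial time.* The code of the output is produced row by row from the adjacency matrix by a
program with a fixed number of stacks, written in a small structured language (`Code`) whose
step-counting semantics (`Exec`) is simulated by Mathlib's multi-stack machines
(`Code.computable_of_exec`).
-/

noncomputable section

namespace SurfaceCode

/-! ### A structured language for stack machines -/

section Machine

open Turing Function

variable {K : Type} {Γ : K → Type}

/-- Structured programs acting on stacks indexed by `K`: pushing a fixed word, dropping the top
symbol, moving a translated top symbol to another stack, sequential composition, branching on the
top symbol of a stack, and repetition while a stack is nonempty. -/
inductive Code (Γ : K → Type) : Type
  | push (k : K) (w : List (Γ k)) : Code Γ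
  | pop (k : K) : Code Γ
  | move (k k' : K) (f : Option (Γ k) → Γ k') : Code Γ
  | seq (P Q : Code Γ) : Code Γ
  | ite (k : K) (t : Option (Γ k) → Bool) (P Q : Code Γ) : Code Γ
  | loop (k : K) (P : Code Γ) : Code Γ

/-- `Exec P S S' t`: started on the stacks `S`, the program `P` ends with the stacks `S'` after at
most `t` steps. -/
inductive Exec [DecidableEq K] : Code Γ → (∀ k, List (Γ k)) → (∀ k, List (Γ k)) → ℕ → Prop
  | push (k w S) : Exec (.push k w) S (update S k (w.reverse ++ S k)) 1
  | pop (k S) : Exec (.pop k) S (update S k (S k).tail) 1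
  | move (k k' f S) : Exec (.move k k' f) S
      (update (update S k (S k).tail) k' (f (S k).head? :: update S k (S k).tail k')) 1
  | seq {P Q S S' S'' t t'} : Exec P S S' t → Exec Q S' S'' t' → Exec (.seq P Q) S S'' (t + t')
  | ite_pos {k f P Q S S' t} : f (S k).head? = true → Exec P S S' t →
      Exec (.ite k f P Q) S S' (t + 1)
  | ite_neg {k f P Q S S' t} : f (S k).head? = false → Exec Q S S' t →
      Exec (.ite k f P Q) S S' (t + 1)
  | loop_nil {k P S} : S k = [] → Exec (.loop k P) S S 1
  | loop_cons {k P S S' S'' t t'} : S k ≠ [] → Exec P S S' t → Exec (.loop k P) S' S'' t' →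
      Exec (.loop k P) S S'' (t + t' + 1)
  | mono {P S S' t t'} : Exec P S S' t → t ≤ t' → Exec P S S' t'

lemma Exec.of_eq [DecidableEq K] {P : Code Γ} {S S' S'' : ∀ k, List (Γ k)} {t t' : ℕ}
    (h : Exec P S S' t) (hS : S' = S'') (ht : t ≤ t') : Exec P S S'' t' :=
  hS ▸ h.mono ht

namespace Code

/-- The control points of a program. -/
def Label : Code Γ → Type
  | push _ _ => Unit
  | pop _ => Unit
  | move _ _ _ => Unit
  | seq P Q => P.Label ⊕ Q.Label
  | ite _ _ P Q => Option (P.Label ⊕ Q.Label)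
  | loop _ P => Option P.Label

/-- A program has finitely many control points. -/
@[reducible]
def labelFintype : (P : Code Γ) → Fintype P.Label
  | push _ _ => inferInstanceAs (Fintype Unit)
  | pop _ => inferInstanceAs (Fintype Unit)
  | move _ _ _ => inferInstanceAs (Fintype Unit)
  | seq P Q => by
      have := P.labelFintype
      have := Q.labelFintype
      exact inferInstanceAs (Fintype (P.Label ⊕ Q.Label))
  | ite _ _ P Q => by
      have := P.labelFintype
      have := Q.labelFintype
      exact inferInstanceAs (Fintype (Option (P.Label ⊕ Q.Label)))
  | loop _ P => by
      have := P.labelFintype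
      exact inferInstanceAs (Fintype (Option P.Label))

/-- The control point at which a program starts. -/
def entry : (P : Code Γ) → P.Label
  | push _ _ => ()
  | pop _ => ()
  | move _ _ _ => ()
  | seq P _ => Sum.inl P.entry
  | ite _ _ _ _ => none
  | loop _ _ => none

/-- The registers of the compiled machine: for every stack, the symbol last read from it. -/
abbrev Reg (Γ : K → Type) : Type := ∀ k, Option (Γ k)

/-- The machine statement that pushes the letters of `w`, the first letter first. -/
def pushStmt {Λ : Type} (k : K) (w : List (Γ k)) (q : TM2.Stmt Γ Λ (Reg Γ)) :
    TM2.Stmt Γ Λ (Reg Γ) :=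
  w.foldr (fun a q => .push k (fun _ => a) q) q

variable [DecidableEq K]

/-- The machine statement at each control point of `P`, when the control points of `P` are placed
among the labels `Λ` by `emb` and control is handed to `exit` in the end. -/
def stmt {Λ : Type} : (P : Code Γ) → (emb : P.Label → Λ) → (exit : Λ) → P.Label →
    TM2.Stmt Γ Λ (Reg Γ)
  | push k w, _, exit, _ => pushStmt k w (.goto fun _ => exit)
  | pop k, _, exit, _ => .pop k (fun v _ => v) (.goto fun _ => exit)
  | move k k' f, _, exit, _ =>
      .pop k (fun v a => update v k a) (.push k' (fun v => f (v k)) (.goto fun _ => exit))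
  | seq P Q, emb, exit, l =>
      Sum.elim (P.stmt (fun l => emb (Sum.inl l)) (emb (Sum.inr Q.entry)))
        (Q.stmt (fun l => emb (Sum.inr l)) exit) l
  | ite k t P Q, emb, exit, l =>
      Option.elim l
        (.peek k (fun v a => update v k a) (.branch (fun v => t (v k))
          (.goto fun _ => emb (some (Sum.inl P.entry)))
          (.goto fun _ => emb (some (Sum.inr Q.entry)))))
        (Sum.elim (P.stmt (fun l => emb (some (Sum.inl l))) exit)
          (Q.stmt (fun l => emb (some (Sum.inr l))) exit))
  | loop k P, emb, exit, l =>
      Option.elim l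
        (.peek k (fun v a => update v k a) (.branch (fun v => (v k).isSome)
          (.goto fun _ => emb (some P.entry)) (.goto fun _ => exit)))
        (P.stmt (fun l => emb (some l)) (emb none))

lemma stepAux_pushStmt {Λ : Type} (k : K) (w : List (Γ k)) (q : TM2.Stmt Γ Λ (Reg Γ)) (v : Reg Γ)
    (S : ∀ k, List (Γ k)) :
    TM2.stepAux (pushStmt k w q) v S = TM2.stepAux q v (update S k (w.reverse ++ S k)) := by
  induction w generalizing S with
  | nil => simp [pushStmt]
  | cons a w ih =>
    have : pushStmt k (a :: w) q = .push k (fun _ => a) (pushStmt k w q) := rfl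
    rw [this, TM2.stepAux, ih]
    simp

lemma evalsTo_single {σ : Type} {f : σ → Option σ} {a b : σ} (h : f a = some b) :
    Nonempty (StateTransition.EvalsToInTime f a (some b) 1) :=
  ⟨⟨⟨1, by simpa [flip] using h⟩, le_rfl⟩⟩

lemma evalsTo_trans {σ : Type} {f : σ → Option σ} {a b c : σ} {t t' s : ℕ}
    (h : Nonempty (StateTransition.EvalsToInTime f a (some b) t))
    (h' : Nonempty (StateTransition.EvalsToInTime f b (some c) t')) (hs : t + t' ≤ s) :
    Nonempty (StateTransition.EvalsToInTime f a (some c) s) := by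
  obtain ⟨h⟩ := h
  obtain ⟨h'⟩ := h'
  have := h.trans _ _ _ _ _ _ h'
  exact ⟨⟨this.toEvalsTo, this.steps_le_m.trans (by omega)⟩⟩

/-- Compilation is correct: a machine that contains the compiled program `P` follows its
execution. -/
theorem reaches_of_exec {Λ : Type} (m : Λ → TM2.Stmt Γ Λ (Reg Γ)) {P : Code Γ}
    {S S' : ∀ k, List (Γ k)} {t : ℕ} (h : Exec P S S' t) :
    ∀ (emb : P.Label → Λ) (exit : Λ), (∀ l, m (emb l) = P.stmt emb exit l) → ∀ v : Reg Γ,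
      ∃ v' : Reg Γ, Nonempty (StateTransition.EvalsToInTime (TM2.step m)
        ⟨some (emb P.entry), v, S⟩ (some ⟨some exit, v', S'⟩) t) := by
  induction h with
  | push k w S =>
    intro emb exit hm v
    refine ⟨v, evalsTo_single ?_⟩
    rw [TM2.step, hm, stmt, stepAux_pushStmt]
    rfl
  | pop k S =>
    intro emb exit hm v
    refine ⟨v, evalsTo_single ?_⟩
    rw [TM2.step, hm, stmt]
    rfl
  | move k k' f S =>
    intro emb exit hm v
    refine ⟨update v k (S k).head?, evalsTo_single ?_⟩
    rw [TM2.step, hm, stmt]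
    simp
  | @seq P Q S S' S'' t t' _ _ ih ih' =>
    intro emb exit hm v
    obtain ⟨v', h⟩ := ih (fun l => emb (Sum.inl l)) (emb (Sum.inr Q.entry))
      (fun l => hm (Sum.inl l)) v
    obtain ⟨v'', h'⟩ := ih' (fun l => emb (Sum.inr l)) exit (fun l => hm (Sum.inr l)) v'
    exact ⟨v'', evalsTo_trans h h' le_rfl⟩
  | @ite_pos k f P Q S S' t hf _ ih =>
    intro emb exit hm v
    obtain ⟨v', h⟩ := ih (fun l => emb (some (Sum.inl l))) exit
      (fun l => hm (some (Sum.inl l))) (update v k (S k).head?)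
    refine ⟨v', evalsTo_trans (evalsTo_single ?_) h (add_comm _ _).le⟩
    rw [TM2.step, hm, stmt]
    simp [entry, hf]
  | @ite_neg k f P Q S S' t hf _ ih =>
    intro emb exit hm v
    obtain ⟨v', h⟩ := ih (fun l => emb (some (Sum.inr l))) exit
      (fun l => hm (some (Sum.inr l))) (update v k (S k).head?)
    refine ⟨v', evalsTo_trans (evalsTo_single ?_) h (add_comm _ _).le⟩
    rw [TM2.step, hm, stmt]
    simp [entry, hf]
  | @loop_nil k P S hk =>
    intro emb exit hm v
    refine ⟨update v k (S k).head?, evalsTo_single ?_⟩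
    rw [TM2.step, hm, stmt]
    simp [entry, hk]
  | @loop_cons k P S S' S'' t t' hk _ _ ih ih' =>
    intro emb exit hm v
    obtain ⟨v', h⟩ := ih (fun l => emb (some l)) (emb none)
      (fun l => hm (some l)) (update v k (S k).head?)
    obtain ⟨v'', h'⟩ := ih' emb exit hm v'
    refine ⟨v'', evalsTo_trans (evalsTo_single ?_) (evalsTo_trans h h' le_rfl) (by omega)⟩
    rw [TM2.step, hm, stmt]
    obtain ⟨a, l, hal⟩ := List.exists_cons_of_ne_nil hk
    simp [entry, hal]
  | mono _ hle ih =>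
    intro emb exit hm v
    obtain ⟨v', ⟨h⟩⟩ := ih emb exit hm v
    exact ⟨v', ⟨⟨h.toEvalsTo, h.steps_le_m.trans hle⟩⟩⟩

/-- The Turing machine that runs `P`, then clears its registers and halts. -/
def machine [Fintype K] [∀ k, Fintype (Γ k)] (P : Code Γ) (k₀ k₁ : K) : FinTM2 where
  K := K
  k₀ := k₀
  k₁ := k₁
  Γ := Γ
  Λ := Option P.Label
  main := some P.entry
  ΛFin := by
    have := P.labelFintype
    infer_instance
  σ := Reg Γ
  initialState := fun _ => none
  m l := Option.elim l (.load (fun _ _ => none) .halt) (P.stmt some none)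

/-- A function is computable in polynomial time if some program takes the stacks holding the code
of the input only to the stacks holding the code of the output only, in polynomially many steps. -/
theorem computable_of_exec [Fintype K] [∀ k, Fintype (Γ k)] (P : Code Γ) {k₀ k₁ : K}
    {α β : Type} (ea : α → List (Γ k₀)) (eb : β → List (Γ k₁)) (f : α → β) (p : Polynomial ℕ)
    (h : ∀ a, Exec P (update (fun _ => []) k₀ (ea a)) (update (fun _ => []) k₁ (eb (f a)))
      (p.eval (ea a).length)) :
    Nonempty (TM2ComputableInPolyTime ea eb f) := by
  refine ⟨{ tm := P.machine k₀ k₁, inputAlphabet := Equiv.refl _, outputAlphabet := Equiv.refl _,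
            time := p + 1, outputsFun := fun a => Classical.choice ?_ }⟩
  have h1 : initList (P.machine k₀ k₁) (List.map (Equiv.refl (Γ k₀)).invFun (ea a)) =
      ⟨some (some P.entry), fun _ => none, update (fun _ => []) k₀ (ea a)⟩ := by
    simp only [initList, machine]
    congr 1
    funext k
    by_cases hk : k = k₀
    · subst hk; simp; exact (update_self (β := fun k => List (Γ k)) k (ea a) _).symm
    · simp [hk]; exact update_of_ne (β := fun k => List (Γ k)) hk (ea a) _
  have h2 : haltList (P.machine k₀ k₁) (List.map (Equiv.refl (Γ k₁)).invFun (eb (f a))) =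
      ⟨none, fun _ => none, update (fun _ => []) k₁ (eb (f a))⟩ := by
    simp only [haltList, machine]
    congr 1
    funext k
    by_cases hk : k = k₁
    · subst hk; simp; exact (update_self (β := fun k => List (Γ k)) k (eb (f a)) _).symm
    · simp [hk]; exact update_of_ne (β := fun k => List (Γ k)) hk (eb (f a)) _
  obtain ⟨v', h3⟩ := reaches_of_exec (P.machine k₀ k₁).m (h a) some none (fun _ => rfl)
    (fun _ => none)
  have h4 : Nonempty (StateTransition.EvalsToInTime (TM2.step (P.machine k₀ k₁).m)
      ⟨some none, v', update (fun _ => []) k₁ (eb (f a))⟩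
      (some ⟨none, fun _ => none, update (fun _ => []) k₁ (eb (f a))⟩) 1) :=
    evalsTo_single rfl
  unfold TM2OutputsInTime
  erw [h1]
  simp only [Option.map_some]
  erw [h2]
  exact evalsTo_trans h3 h4 (by simp)

end Code

end Machine

/-! ### Planarity of graphs drawn by king moves -/

section Planarity

lemma floor_segment {a b : ℤ} (h : |a - b| ≤ 1) {t : ℝ} (h0 : 0 < t) (h1 : t < 1) :
    ⌊(a : ℝ) + t * (b - a)⌋ = min a b := by
  have : b = a ∨ b = a + 1 ∨ b = a - 1 := by grind
  rw [Int.floor_eq_iff]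
  rcases this with rfl | rfl | rfl
  · simp
  · rw [min_eq_left (by omega)]
    push_cast
    constructor <;> linarith
  · rw [min_eq_right (by omega)]
    push_cast
    constructor <;> linarith

lemma ceil_segment {a b : ℤ} (h : |a - b| ≤ 1) {t : ℝ} (h0 : 0 < t) (h1 : t < 1) :
    ⌈(a : ℝ) + t * (b - a)⌉ = max a b := by
  have : b = a ∨ b = a + 1 ∨ b = a - 1 := by grind
  rw [Int.ceil_eq_iff]
  rcases this with rfl | rfl | rfl
  · simp
  · rw [max_eq_right (by omega)]
    push_cast
    constructor <;> linarith
  · rw [max_eq_left (by omega)]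
    push_cast
    constructor <;> linarith

/-- A graph is planar if its vertices can be placed at distinct lattice points in such a way that
every edge is a king move and no two edges are the two diagonals of a unit square. Indeed the unit
square (or side of a square) that contains an interior point of a king move is determined by
rounding the coordinates of that point down and up. -/
theorem isPlanar_of_kingMoves {V : Type} (G : SimpleGraph V) (P : V → ℤ × ℤ)
    (hP : Function.Injective P)
    (hking : ∀ u v, G.Adj u v → |(P u).1 - (P v).1| ≤ 1 ∧ |(P u).2 - (P v).2| ≤ 1)
    (hcross : ∀ u v u' v', G.Adj u v → G.Adj u' v' → (P u).1 = (P u').1 → (P v).1 = (P v').1 →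
      (P u).2 = (P v').2 → (P v).2 = (P u').2 → (P u).1 = (P v).1 ∨ (P u).2 = (P v).2) :
    IsPlanar G := by
  classical
  let src : G.edgeSet → V := fun e => (Quot.out e.1).1
  let dst : G.edgeSet → V := fun e => (Quot.out e.1).2
  have hsd : ∀ e, e.1 = s(src e, dst e) := fun e => (Quot.out_eq e.1).symm
  have hadj : ∀ e, G.Adj (src e) (dst e) := fun e => by
    rw [← SimpleGraph.mem_edgeSet, ← hsd]; exact e.2
  let pt : V → ℝ × ℝ := fun v => ((P v).1, (P v).2)
  have hpt : Function.Injective pt := fun u v h => by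
    simp only [pt, Prod.mk.injEq, Int.cast_inj] at h
    exact hP (Prod.ext h.1 h.2)
  let arc : G.edgeSet → unitInterval → ℝ × ℝ := fun e t =>
    ((P (src e)).1 + t * ((P (dst e)).1 - (P (src e)).1),
      (P (src e)).2 + t * ((P (dst e)).2 - (P (src e)).2))
  have harc0 : ∀ e, arc e 0 = pt (src e) := fun e => by simp [arc, pt]
  have harc1 : ∀ e, arc e 1 = pt (dst e) := fun e => by simp [arc, pt]
  have hinner : ∀ t : unitInterval, t = 0 ∨ t = 1 ∨ (0 < (t : ℝ) ∧ (t : ℝ) < 1) := fun t => by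
    rcases eq_or_lt_of_le t.2.1 with h | h
    · exact Or.inl (Subtype.ext h.symm)
    · rcases eq_or_lt_of_le t.2.2 with h' | h'
      · exact Or.inr (Or.inl (Subtype.ext h'))
      · exact Or.inr (Or.inr ⟨h, h'⟩)
  have havoid : ∀ (e : G.edgeSet) (t : unitInterval) (v : V), arc e t = pt v → v ∈ e.1 := by
    intro e t v h
    rcases hinner t with rfl | rfl | ⟨h0, h1⟩
    · rw [harc0] at h
      rw [hsd e, ← hpt h]
      exact Sym2.mem_mk_left _ _
    · rw [harc1] at h
      rw [hsd e, ← hpt h]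
      exact Sym2.mem_mk_right _ _
    · exfalso
      have hk := hking _ _ (hadj e)
      simp only [arc, pt, Prod.mk.injEq] at h
      have e1 := floor_segment hk.1 h0 h1
      have e2 := ceil_segment hk.1 h0 h1
      have e3 := floor_segment hk.2 h0 h1
      have e4 := ceil_segment hk.2 h0 h1
      rw [h.1, Int.floor_intCast] at e1
      rw [h.1, Int.ceil_intCast] at e2
      rw [h.2, Int.floor_intCast] at e3
      rw [h.2, Int.ceil_intCast] at e4
      exact (hadj e).ne (hP (Prod.ext (by omega) (by omega)))
  refine ⟨⟨pt, hpt, arc, ?_, ?_, ?_, havoid, ?_⟩⟩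
  · intro e
    fun_prop
  · intro e s t h
    simp only [arc, Prod.mk.injEq, add_right_inj, mul_eq_mul_right_iff] at h
    by_contra hst
    have hst' : (s : ℝ) ≠ t := fun h => hst (Subtype.ext h)
    have h1 := h.1.resolve_left hst'
    have h2 := h.2.resolve_left hst'
    rw [sub_eq_zero, Int.cast_inj] at h1 h2
    exact (hadj e).ne (hP (Prod.ext h1.symm h2.symm))
  · intro e
    rw [harc0, harc1, hsd e, Sym2.map_mk]
  · intro e f hef s t h
    rcases hinner s with rfl | rfl | ⟨s0, s1⟩
    · rw [harc0] at h ⊢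
      exact ⟨src e, by rw [hsd e]; exact Sym2.mem_mk_left _ _, havoid f t _ h.symm, rfl⟩
    · rw [harc1] at h ⊢
      exact ⟨dst e, by rw [hsd e]; exact Sym2.mem_mk_right _ _, havoid f t _ h.symm, rfl⟩
    rcases hinner t with rfl | rfl | ⟨t0, t1⟩
    · rw [harc0] at h
      exact ⟨src f, havoid e s _ h, by rw [hsd f]; exact Sym2.mem_mk_left _ _, h⟩
    · rw [harc1] at h
      exact ⟨dst f, havoid e s _ h, by rw [hsd f]; exact Sym2.mem_mk_right _ _, h⟩
    exfalso
    have hk := hking _ _ (hadj e)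
    have hk' := hking _ _ (hadj f)
    simp only [arc, Prod.mk.injEq] at h
    have e1 := floor_segment hk.1 s0 s1
    have e2 := ceil_segment hk.1 s0 s1
    have e3 := floor_segment hk.2 s0 s1
    have e4 := ceil_segment hk.2 s0 s1
    rw [h.1, floor_segment hk'.1 t0 t1] at e1
    rw [h.1, ceil_segment hk'.1 t0 t1] at e2
    rw [h.2, floor_segment hk'.2 t0 t1] at e3
    rw [h.2, ceil_segment hk'.2 t0 t1] at e4
    have hx : ((P (src e)).1 = (P (src f)).1 ∧ (P (dst e)).1 = (P (dst f)).1) ∨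
      ((P (src e)).1 = (P (dst f)).1 ∧ (P (dst e)).1 = (P (src f)).1) := by omega
    have hy : ((P (src e)).2 = (P (src f)).2 ∧ (P (dst e)).2 = (P (dst f)).2) ∨
      ((P (src e)).2 = (P (dst f)).2 ∧ (P (dst e)).2 = (P (src f)).2) := by omega
    have hpar : ¬ ((P (src e)).1 = (P (src f)).1 ∧ (P (dst e)).1 = (P (dst f)).1 ∧
        (P (src e)).2 = (P (src f)).2 ∧ (P (dst e)).2 = (P (dst f)).2) := fun ⟨a, b, c, d⟩ =>
      hef (Subtype.ext (by rw [hsd e, hsd f, hP (Prod.ext a c), hP (Prod.ext b d)]))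
    have hanti : ¬ ((P (src e)).1 = (P (dst f)).1 ∧ (P (dst e)).1 = (P (src f)).1 ∧
        (P (src e)).2 = (P (dst f)).2 ∧ (P (dst e)).2 = (P (src f)).2) := fun ⟨a, b, c, d⟩ =>
      hef (Subtype.ext (by
        rw [hsd e, hsd f, hP (Prod.ext a c), hP (Prod.ext b d), Sym2.eq_swap]))
    rcases hx with hx | hx <;> rcases hy with hy | hy
    · exact hpar ⟨hx.1, hx.2, hy.1, hy.2⟩
    · have := hcross _ _ _ _ (hadj e) (hadj f) hx.1 hx.2 hy.1 hy.2
      omega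
    · have := hcross _ _ _ _ (hadj e) (hadj f).symm hx.1 hx.2 hy.1 hy.2
      omega
    · exact hanti ⟨hx.1, hx.2, hy.1, hy.2⟩

end Planarity

/-! ### The qubit states -/

namespace Expr

/-- The constant `0`. -/
def zero : Expr := add one (neg one)

/-- The constant `2`. -/
def two : Expr := add one one

/-- The constant `3`. -/
def three : Expr := add one two

/-- The constant `1 / √2`. -/
def invSqrtTwo : Expr := inv (sqrt two)

/-- The imaginary unit. -/
def imag : Expr := sqrt (neg one)

/-- The primitive sixth root of unity `(1 + √-3) / 2`. -/
def omega : Expr := mul (inv two) (add one (sqrt (neg three)))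

lemma value_zero : zero.value = 0 := by simp [zero, value]

lemma value_two : two.value = 2 := by simp only [two, value]; norm_num

lemma value_three : three.value = 3 := by simp only [three, value, value_two]; norm_num

lemma value_sqrt_sq (a : Expr) : (sqrt a).value ^ 2 = a.value := by
  simp [value]

lemma value_imag_sq : imag.value ^ 2 = -1 := by
  rw [imag, value_sqrt_sq, value, value]

lemma value_omega_sq : omega.value ^ 2 = omega.value - 1 := by
  have h := value_sqrt_sq (neg three)
  rw [value, value_three] at h
  have h' : omega.value = 2⁻¹ * (1 + (sqrt (neg three)).value) := by
    rw [← value_two]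
    rfl
  rw [h']
  linear_combination (1 / 4 : ℂ) * h

lemma norm_value_invSqrtTwo : ‖invSqrtTwo.value‖ ^ 2 = 1 / 2 := by
  have h := value_sqrt_sq two
  rw [value_two] at h
  have h' := congrArg norm h
  rw [norm_pow] at h'
  rw [invSqrtTwo, value, norm_inv, inv_pow, h']
  norm_num

lemma norm_value_imag : ‖imag.value‖ = 1 := by
  have h := congrArg norm value_imag_sq
  rw [norm_pow, norm_neg, norm_one] at h
  exact (pow_eq_one_iff_of_nonneg (norm_nonneg _) two_ne_zero).1 h

lemma norm_value_omega : ‖omega.value‖ = 1 := by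
  have h : omega.value ^ 6 = 1 := by
    linear_combination (omega.value ^ 4 + omega.value ^ 3 - omega.value - 1) * value_omega_sq
  have h := congrArg norm h
  rw [norm_pow, norm_one] at h
  exact (pow_eq_one_iff_of_nonneg (norm_nonneg _) (by norm_num)).1 h

lemma norm_value_omega_sub_one : ‖omega.value - 1‖ = 1 := by
  rw [← value_omega_sq, norm_pow, norm_value_omega, one_pow]

lemma zero_defined : zero.Defined := by simp [zero, Defined]

lemma imag_defined : imag.Defined := by simp [imag, Defined]

lemma invSqrtTwo_defined : invSqrtTwo.Defined := by
  refine ⟨by simp [two, Defined], fun h => ?_⟩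
  have := value_sqrt_sq two
  rw [h, value_two] at this
  norm_num at this

lemma omega_defined : omega.Defined := by
  simp only [omega, Defined, value_two, three]
  simp [two, Defined]

end Expr

open SurfaceCode.Expr in
/-- The states of the four qubits of a cell, as pairs of amplitudes at `|0⟩` and `|1⟩`. The edges
of a cell are listed in the order left-top, left-bottom, top-right, right-bottom. -/
def cellState (diag adj : Bool) (k : Fin 4) : Expr × Expr :=
  bif diag then
    ![(one, zero), (invSqrtTwo, invSqrtTwo), (invSqrtTwo, invSqrtTwo), (one, zero)] k
  else bif adj then
    ![(invSqrtTwo, mul invSqrtTwo (add omega (neg one))),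
      (invSqrtTwo, mul invSqrtTwo (add one (neg omega))),
      (invSqrtTwo, mul invSqrtTwo (add one (neg omega))),
      (invSqrtTwo, mul invSqrtTwo omega)] k
  else (invSqrtTwo, mul invSqrtTwo imag)

open SurfaceCode.Expr in
/-- The states of the three qubits at the right end of a row: the edge entering from the left is in
the state `|1⟩`, the two edges of the boundary path are in the state `|+⟩`. -/
def endState (k : Fin 3) : Expr × Expr :=
  ![(zero, one), (invSqrtTwo, invSqrtTwo), (invSqrtTwo, invSqrtTwo)] k

/-- A pair of amplitudes describes a normalized qubit state without division by zero. -/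
def GoodState (s : Expr × Expr) : Prop :=
  s.1.Defined ∧ s.2.Defined ∧ ‖s.1.value‖ ^ 2 + ‖s.2.value‖ ^ 2 = 1

lemma goodState_phase {a : Expr} (ha : a.Defined) (h : ‖a.value‖ = 1) :
    GoodState (.invSqrtTwo, .mul .invSqrtTwo a) := by
  refine ⟨Expr.invSqrtTwo_defined, ⟨Expr.invSqrtTwo_defined, ha⟩, ?_⟩
  simp only [Expr.value, norm_mul, mul_pow, h, Expr.norm_value_invSqrtTwo]
  norm_num

lemma goodState_plus : GoodState (.invSqrtTwo, .invSqrtTwo) := by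
  refine ⟨Expr.invSqrtTwo_defined, Expr.invSqrtTwo_defined, ?_⟩
  simp only [Expr.norm_value_invSqrtTwo]
  norm_num

lemma goodState_zero : GoodState (.one, .zero) :=
  ⟨trivial, Expr.zero_defined, by simp [Expr.value, Expr.value_zero]⟩

lemma goodState_one : GoodState (.zero, .one) :=
  ⟨Expr.zero_defined, trivial, by simp [Expr.value, Expr.value_zero]⟩

lemma goodState_cellState (diag adj : Bool) (k : Fin 4) : GoodState (cellState diag adj k) := by
  have h1 : GoodState (.invSqrtTwo, .mul .invSqrtTwo (.add .omega (.neg .one))) :=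
    goodState_phase ⟨Expr.omega_defined, trivial⟩
      (by simpa only [Expr.value, ← sub_eq_add_neg] using Expr.norm_value_omega_sub_one)
  have h2 : GoodState (.invSqrtTwo, .mul .invSqrtTwo (.add .one (.neg .omega))) :=
    goodState_phase ⟨trivial, Expr.omega_defined⟩
      (by rw [← Expr.norm_value_omega_sub_one, norm_sub_rev]
          simp only [Expr.value, ← sub_eq_add_neg])
  have h3 := goodState_phase Expr.omega_defined Expr.norm_value_omega
  have h4 := goodState_phase Expr.imag_defined Expr.norm_value_imag
  cases diag <;> cases adj <;> fin_cases k
  all_goals first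
    | exact h1 | exact h2 | exact h3 | exact h4 | exact goodState_plus | exact goodState_zero

lemma goodState_endState (k : Fin 3) : GoodState (endState k) := by
  fin_cases k
  exacts [goodState_one, goodState_plus, goodState_plus]

/-! ### The planar graph -/

section Layout

variable {n : ℕ}

/-- The edges carrying a measured qubit: four edges in each cell, and three at each row end. -/
abbrev MIdx (n : ℕ) : Type := (Fin n × Fin n) × Fin 4 ⊕ Fin n × Fin 3

/-- The edges carrying a discarded qubit: the edge entering each cell from the left, and the edge
entering each cell and each row end from above. -/
abbrev CIdx (n : ℕ) : Type := Fin n × Fin n ⊕ Fin n × Fin (n + 1)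

/-- All edges. -/
abbrev EIdx (n : ℕ) : Type := MIdx n ⊕ CIdx n

/-- The row of an edge. -/
def eRow : EIdx n → ℕ
  | .inl (.inl ((i, _), _)) => i
  | .inl (.inr (i, _)) => i
  | .inr (.inl (i, _)) => i
  | .inr (.inr (i, _)) => i

/-- The column of an edge; the row end is in column `n`. -/
def eCol : EIdx n → ℕ
  | .inl (.inl ((_, j), _)) => j
  | .inl (.inr _) => n
  | .inr (.inl (_, j)) => j
  | .inr (.inr (_, j)) => j

/-- The kind of an edge: entering from the left (`0`) or from above (`1`), or joining left and top
(`2`), left and bottom (`3`), top and right (`4`), right and bottom (`5`). -/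
def eKind : EIdx n → Fin 6
  | .inl (.inl (_, k)) => ⟨k + 2, by omega⟩
  | .inl (.inr (_, k)) => ![0, 2, 3] k
  | .inr (.inl _) => 0
  | .inr (.inr _) => 1

/-- The smaller endpoint of an edge of each kind starts with the offset `4 * n + 2`, except for
the edges entering from above. -/
def kindFar (k : Fin 6) : Bool := ![true, false, true, true, true, true] k

/-- The remaining offset of the smaller endpoint. -/
def kindSrc (k : Fin 6) : ℕ := ![0, 3, 2, 2, 3, 4] k

/-- The remaining offset of the larger endpoint. -/
def kindDst (k : Fin 6) : ℕ := ![2, 3, 3, 5, 4, 5] k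

/-- The smaller endpoint of an edge. The left, top, right and bottom vertex of the cell or row end
in row `i` and column `j` have the numbers `4 * ((i + 1) * (n + 1) + j) + k` with `k = 0, 1, 2, 3`,
so that an edge enters the first column from the right vertex of the row end above. -/
def eSrc (e : EIdx n) : ℕ :=
  4 * (eRow e * (n + 1) + eCol e) + ((bif kindFar (eKind e) then 4 * n + 2 else 0) +
    kindSrc (eKind e))

/-- The larger endpoint of an edge. -/
def eDst (e : EIdx n) : ℕ :=
  4 * (eRow e * (n + 1) + eCol e) + (4 * n + 2 + kindDst (eKind e))

lemma eRow_lt (e : EIdx n) : eRow e < n := by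
  rcases e with (⟨⟨i, j⟩, k⟩ | ⟨i, k⟩) | (⟨i, j⟩ | ⟨i, j⟩) <;> exact i.2

lemma eCol_le (e : EIdx n) : eCol e ≤ n := by
  rcases e with (⟨⟨i, j⟩, k⟩ | ⟨i, k⟩) | (⟨i, j⟩ | ⟨i, j⟩) <;> (simp [eCol]; try omega)

lemma eIdx_ext {e f : EIdx n} (h1 : eRow e = eRow f) (h2 : eCol e = eCol f)
    (h3 : eKind e = eKind f) : e = f := by
  rcases e with (⟨⟨i, j⟩, k⟩ | ⟨i, k⟩) | (⟨i, j⟩ | ⟨i, j⟩) <;>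
    rcases f with (⟨⟨i', j'⟩, k'⟩ | ⟨i', k'⟩) | (⟨i', j'⟩ | ⟨i', j'⟩) <;>
    simp only [eRow, eCol, eKind, Fin.ext_iff] at h1 h2 h3
  all_goals first
    | (exfalso; fin_cases k <;> simp at h3 <;> omega)
    | (exfalso; fin_cases k' <;> simp at h3 <;> omega)
    | (exfalso; simp at h3; done)
    | (simp only [Sum.inr.injEq, Sum.inl.injEq, Prod.mk.injEq, Fin.ext_iff]; omega)
    | (fin_cases k <;> fin_cases k' <;> simp_all [Fin.ext_iff])

/-- The number of vertices. -/
abbrev numVertices (n : ℕ) : ℕ := 4 * ((n + 1) * (n + 1))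

lemma eSrc_lt_eDst (e : EIdx n) : eSrc e < eDst e := by
  unfold eSrc eDst
  generalize eKind e = k
  fin_cases k <;> simp [kindFar, kindSrc, kindDst]

lemma eDst_lt (e : EIdx n) : eDst e < numVertices n := by
  have h1 := eRow_lt e
  have h2 := eCol_le e
  have h3 : eRow e * (n + 1) + (n + 1) ≤ n * (n + 1) := by nlinarith
  have h4 : kindDst (eKind e) ≤ 5 := by
    generalize eKind e = k
    fin_cases k <;> simp [kindDst]
  have h5 : (n + 1) * (n + 1) = n * (n + 1) + (n + 1) := by ring
  unfold eDst numVertices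
  omega

lemma eSrc_eDst_injective {e f : EIdx n} (h1 : eSrc e = eSrc f) (h2 : eDst e = eDst f) :
    e = f := by
  have hk : eKind e = eKind f := by
    unfold eSrc at h1
    unfold eDst at h2
    revert h1 h2
    generalize eKind e = k
    generalize eKind f = k'
    generalize eRow e * (n + 1) + eCol e = a
    generalize eRow f * (n + 1) + eCol f = b
    fin_cases k <;> fin_cases k' <;> simp [kindFar, kindSrc, kindDst] <;> omega
  unfold eDst at h2
  rw [hk] at h2
  have h3 : eRow e * (n + 1) + eCol e = eRow f * (n + 1) + eCol f := by omega
  have h4 := eCol_le e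
  have h5 := eCol_le f
  have h6 : eRow e = eRow f := by
    have := congrArg (· / (n + 1)) h3
    simpa [Nat.add_div_of_dvd_right, Nat.mul_div_cancel, Nat.div_eq_of_lt, Nat.lt_succ_of_le h4,
      Nat.lt_succ_of_le h5] using this
  exact eIdx_ext h6 (by rw [h6] at h3; omega) hk

/-- The smaller endpoint as a vertex. -/
def vSrc (e : EIdx n) : Fin (numVertices n) := ⟨eSrc e, (eSrc_lt_eDst e).trans (eDst_lt e)⟩

/-- The larger endpoint as a vertex. -/
def vDst (e : EIdx n) : Fin (numVertices n) := ⟨eDst e, eDst_lt e⟩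

/-- An edge as an unordered pair of vertices. -/
def eEnds (e : EIdx n) : Sym2 (Fin (numVertices n)) := s(vSrc e, vDst e)

lemma eEnds_injective : Function.Injective (eEnds (n := n)) := by
  intro e f h
  have he := eSrc_lt_eDst e
  have hf := eSrc_lt_eDst f
  simp only [eEnds, Sym2.eq_iff, vSrc, vDst, Fin.mk.injEq] at h
  rcases h with h | h
  · exact eSrc_eDst_injective h.1 h.2
  · omega

/-- The graph: an `n` by `n` array of 4-cycles, the cells, joined horizontally and vertically, with
a path along the right side and pendant edges on the left and at the top. -/
def gridGraph (n : ℕ) : SimpleGraph (Fin (numVertices n)) :=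
  SimpleGraph.fromEdgeSet (Set.range eEnds)

lemma gridGraph_adj {u v : Fin (numVertices n)} :
    (gridGraph n).Adj u v ↔ ∃ e : EIdx n, eEnds e = s(u, v) := by
  rw [gridGraph, SimpleGraph.fromEdgeSet_adj, Set.mem_range, and_iff_left_iff_imp]
  rintro ⟨e, he⟩ rfl
  have := eSrc_lt_eDst e
  simp only [eEnds, Sym2.eq_iff, vSrc, vDst, Fin.ext_iff] at he
  omega

lemma edgeSet_gridGraph : Set.range eEnds = (gridGraph n).edgeSet := by
  ext z
  induction z using Sym2.ind with
  | _ u v => rw [SimpleGraph.mem_edgeSet, gridGraph_adj, Set.mem_range]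

/-- The edges of the graph, indexed. -/
def edgeEquiv (n : ℕ) : EIdx n ≃ (gridGraph n).edgeSet :=
  (Equiv.ofInjective eEnds eEnds_injective).trans (Equiv.setCongr edgeSet_gridGraph)

lemma edgeEquiv_coe (e : EIdx n) : (edgeEquiv n e : Sym2 (Fin (numVertices n))) = eEnds e := rfl

/-- The place of the vertex number `4 * (i * (n + 1) + j) + k` in the drawing. The right vertex of
a row end is moved to the left of the following row. -/
def latticePoint (n i j k : ℕ) : ℤ × ℤ :=
  if k = 0 then (3 * j - 1, 3 * i) else if k = 1 then (3 * j, 3 * i - 1)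
  else if k = 2 then (if j = n then (-2, 3 * i + 3) else (3 * j + 1, 3 * i))
  else (3 * j, 3 * i + 1)

/-- The drawing of the vertices. -/
def vertexPoint (v : Fin (numVertices n)) : ℤ × ℤ :=
  latticePoint n (v / 4 / (n + 1)) (v / 4 % (n + 1)) (v % 4)

lemma vertexPoint_eq {v : Fin (numVertices n)} {i j k : ℕ} (hj : j ≤ n) (hk : k < 4)
    (hv : (v : ℕ) = 4 * (i * (n + 1) + j) + k) : vertexPoint v = latticePoint n i j k := by
  have h1 : (v : ℕ) / 4 = i * (n + 1) + j := by omega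
  have h2 : (v : ℕ) % 4 = k := by omega
  have h3 : (i * (n + 1) + j) / (n + 1) = i := by
    rw [mul_comm, Nat.mul_add_div (by omega), Nat.div_eq_of_lt (by omega), add_zero]
  have h4 : (i * (n + 1) + j) % (n + 1) = j := by
    rw [mul_comm, Nat.mul_add_mod, Nat.mod_eq_of_lt (by omega)]
  rw [vertexPoint, h1, h2, h3, h4]

lemma vertexPoint_injective : Function.Injective (vertexPoint (n := n)) := by
  intro u v h
  have hu := Nat.mod_lt ((u : ℕ) / 4) (Nat.succ_pos n)
  have hv := Nat.mod_lt ((v : ℕ) / 4) (Nat.succ_pos n)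
  have hu' := Nat.div_add_mod ((u : ℕ) / 4) (n + 1)
  have hv' := Nat.div_add_mod ((v : ℕ) / 4) (n + 1)
  unfold vertexPoint at h
  revert h hu hv hu' hv'
  generalize (u : ℕ) / 4 / (n + 1) = i
  generalize (v : ℕ) / 4 / (n + 1) = i'
  generalize (u : ℕ) / 4 % (n + 1) = j
  generalize (v : ℕ) / 4 % (n + 1) = j'
  intro h hu hv hu' hv'
  have key : i = i' ∧ j = j' ∧ (u : ℕ) % 4 = v % 4 := by
    unfold latticePoint at h
    have := Nat.mod_lt (u : ℕ) (show 0 < 4 by norm_num)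
    have := Nat.mod_lt (v : ℕ) (show 0 < 4 by norm_num)
    split_ifs at h <;> simp only [Prod.mk.injEq] at h <;> omega
  obtain ⟨rfl, rfl, h3⟩ := key
  exact Fin.ext (by omega)

/-- The positions of the two endpoints of an edge. -/
lemma vertexPoint_ends (e : EIdx n) :
    vertexPoint (vSrc e) = ![((3 * eCol e - 2 : ℤ), (3 * eRow e + 3 : ℤ)),
        (3 * eCol e, 3 * eRow e + 1), (3 * eCol e - 1, 3 * eRow e + 3),
        (3 * eCol e - 1, 3 * eRow e + 3), (3 * eCol e, 3 * eRow e + 2),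
        (3 * eCol e + 1, 3 * eRow e + 3)] (eKind e) ∧
      vertexPoint (vDst e) = ![((3 * eCol e - 1 : ℤ), (3 * eRow e + 3 : ℤ)),
        (3 * eCol e, 3 * eRow e + 2), (3 * eCol e, 3 * eRow e + 2),
        (3 * eCol e, 3 * eRow e + 4), (3 * eCol e + 1, 3 * eRow e + 3),
        (3 * eCol e, 3 * eRow e + 4)] (eKind e) := by
  have hr := eRow_lt e
  have hc := eCol_le e
  have hcell : 4 ≤ (eKind e : ℕ) → eCol e < n := by
    rcases e with (⟨⟨i, j⟩, k⟩ | ⟨i, k⟩) | (⟨i, j⟩ | ⟨i, j⟩)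
    · exact fun _ => j.2
    · fin_cases k <;> simp [eKind]
    · simp [eKind]
    · simp [eKind]
  have hnum : 4 * ((eRow e + 1) * (n + 1) + eCol e) =
      4 * (eRow e * (n + 1) + eCol e) + 4 * n + 4 := by ring
  have hs : (vSrc e : ℕ) = eSrc e := rfl
  have hd : (vDst e : ℕ) = eDst e := rfl
  unfold eSrc at hs
  unfold eDst at hd
  revert hs hd hcell
  generalize eKind e = k
  intro hcell hs hd
  fin_cases k <;> simp [kindFar, kindSrc, kindDst] at hs hd hcell ⊢
  · refine ⟨?_, by rw [vertexPoint_eq (i := eRow e + 1) (k := 0) hc (by omega) (by omega)]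
                   simp [latticePoint]; ring⟩
    rcases Nat.eq_zero_or_pos (eCol e) with h0 | h0
    · rw [vertexPoint_eq (i := eRow e) (j := n) (k := 2) le_rfl (by omega) (by omega)]
      simp [latticePoint, h0]
    · have h1 : (eRow e + 1) * (n + 1) + eCol e = (eRow e + 1) * (n + 1) + (eCol e - 1) + 1 := by
        omega
      rw [vertexPoint_eq (i := eRow e + 1) (j := eCol e - 1) (k := 2) (by omega) (by omega)
        (by omega)]
      have h2 : eCol e - 1 ≠ n := by omega
      simp [latticePoint, h2]
      constructor
      · push_cast [Nat.cast_sub h0]; ring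
      · ring
  · rw [vertexPoint_eq (i := eRow e) (k := 3) hc (by omega) (by omega),
      vertexPoint_eq (i := eRow e + 1) (k := 1) hc (by omega) (by omega)]
    simp [latticePoint]; ring
  · rw [vertexPoint_eq (i := eRow e + 1) (k := 0) hc (by omega) (by omega),
      vertexPoint_eq (i := eRow e + 1) (k := 1) hc (by omega) (by omega)]
    simp [latticePoint]; constructor <;> ring
  · rw [vertexPoint_eq (i := eRow e + 1) (k := 0) hc (by omega) (by omega),
      vertexPoint_eq (i := eRow e + 1) (k := 3) hc (by omega) (by omega)]
    simp [latticePoint]; constructor <;> ring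
  · rw [vertexPoint_eq (i := eRow e + 1) (k := 1) hc (by omega) (by omega),
      vertexPoint_eq (i := eRow e + 1) (k := 2) hc (by omega) (by omega)]
    simp [latticePoint, hcell.ne]; constructor <;> ring
  · rw [vertexPoint_eq (i := eRow e + 1) (k := 2) hc (by omega) (by omega),
      vertexPoint_eq (i := eRow e + 1) (k := 3) hc (by omega) (by omega)]
    simp [latticePoint, hcell.ne]; constructor <;> ring

/-- An edge is a king move; if it is a diagonal, its kind and place are determined by the unit
square that contains it. -/
theorem isPlanar_gridGraph (n : ℕ) : IsPlanar (gridGraph n) := by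
  refine isPlanar_of_kingMoves _ vertexPoint vertexPoint_injective ?_ ?_
  · intro u v h
    obtain ⟨e, he⟩ := gridGraph_adj.1 h
    obtain ⟨h1, h2⟩ := vertexPoint_ends e
    have key : |(vertexPoint (vSrc e)).1 - (vertexPoint (vDst e)).1| ≤ 1 ∧
        |(vertexPoint (vSrc e)).2 - (vertexPoint (vDst e)).2| ≤ 1 := by
      rw [h1, h2]
      generalize eKind e = k
      fin_cases k <;> simp
    rw [eEnds, Sym2.eq_iff] at he
    rcases he with ⟨rfl, rfl⟩ | ⟨rfl, rfl⟩
    · exact key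
    · rwa [abs_sub_comm, abs_sub_comm (vertexPoint (vDst e)).2]
  · intro u v u' v' h h' a b c d
    obtain ⟨e, he⟩ := gridGraph_adj.1 h
    obtain ⟨f, hf⟩ := gridGraph_adj.1 h'
    obtain ⟨h1, h2⟩ := vertexPoint_ends e
    obtain ⟨h3, h4⟩ := vertexPoint_ends f
    have key : ∀ p q p' q' : ℤ × ℤ, p = vertexPoint (vSrc e) → q = vertexPoint (vDst e) →
        p' = vertexPoint (vSrc f) → q' = vertexPoint (vDst f) →
        ((p.1 = p'.1 ∧ q.1 = q'.1 ∧ p.2 = q'.2 ∧ q.2 = p'.2) ∨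
          (p.1 = q'.1 ∧ q.1 = p'.1 ∧ p.2 = p'.2 ∧ q.2 = q'.2)) → p.1 = q.1 ∨ p.2 = q.2 := by
      intro p q p' q' hp hq hp' hq'
      rw [h1] at hp
      rw [h2] at hq
      rw [h3] at hp'
      rw [h4] at hq'
      revert hp hq hp' hq'
      generalize eKind e = k
      generalize eKind f = k'
      rintro rfl rfl rfl rfl
      fin_cases k <;> fin_cases k' <;> simp <;> omega
    rw [eEnds, Sym2.eq_iff] at he hf
    have key := key _ _ _ _ rfl rfl rfl rfl
    rcases he with ⟨rfl, rfl⟩ | ⟨rfl, rfl⟩ <;> rcases hf with ⟨rfl, rfl⟩ | ⟨rfl, rfl⟩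
    · exact key (Or.inl ⟨a, b, c, d⟩)
    · exact key (Or.inr ⟨a, b, c, d⟩)
    · exact (key (Or.inr ⟨b, a, d, c⟩)).imp Eq.symm Eq.symm
    · exact (key (Or.inl ⟨b, a, d, c⟩)).imp Eq.symm Eq.symm

end Layout

/-! ### The instance -/

section Instance

/-- The edges of a cell, in the order in which they are listed in the output. -/
def cellEdges {n : ℕ} (i j : Fin n) : List (EIdx n) :=
  [.inr (.inl (i, j)), .inr (.inr (i, j.castSucc)), .inl (.inl ((i, j), 0)),
    .inl (.inl ((i, j), 1)), .inl (.inl ((i, j), 2)), .inl (.inl ((i, j), 3))]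

/-- The edges of a row end, in the order in which they are listed in the output. -/
def endEdges {n : ℕ} (i : Fin n) : List (EIdx n) :=
  [.inl (.inr (i, 0)), .inr (.inr (i, Fin.last n)), .inl (.inr (i, 1)), .inl (.inr (i, 2))]

/-- All edges, in the order in which they are listed in the output. -/
def edgeList (n : ℕ) : List (EIdx n) :=
  (List.finRange n).flatMap fun i => (List.finRange n).flatMap (cellEdges i) ++ endEdges i

lemma mem_edgeList {n : ℕ} (e : EIdx n) : e ∈ edgeList n := by
  rcases e with (⟨⟨i, j⟩, k⟩ | ⟨i, k⟩) | (⟨i, j⟩ | ⟨i, j⟩)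
  · simp only [edgeList, List.mem_flatMap, List.mem_finRange, true_and, List.mem_append]
    refine ⟨i, Or.inl ⟨j, ?_⟩⟩
    fin_cases k <;> simp [cellEdges]
  · simp only [edgeList, List.mem_flatMap, List.mem_finRange, true_and, List.mem_append]
    refine ⟨i, Or.inr ?_⟩
    fin_cases k <;> simp [endEdges]
  · simp only [edgeList, List.mem_flatMap, List.mem_finRange, true_and, List.mem_append]
    exact ⟨i, Or.inl ⟨j, by simp [cellEdges]⟩⟩
  · simp only [edgeList, List.mem_flatMap, List.mem_finRange, true_and, List.mem_append]
    refine ⟨i, ?_⟩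
    induction j using Fin.lastCases with
    | last => exact Or.inr (by simp [endEdges])
    | cast j => exact Or.inl ⟨j, by simp [cellEdges]⟩

lemma length_edgeList (n : ℕ) : (edgeList n).length = n * (6 * n + 4) := by
  simp only [edgeList, List.length_flatMap, cellEdges, endEdges, List.length_append,
    List.length_cons, List.length_nil, List.map_const', List.length_finRange, List.sum_replicate,
    smul_eq_mul]
  ring

lemma nodup_edgeList (n : ℕ) : (edgeList n).Nodup := by
  classical
  have h : (edgeList n).toFinset = Finset.univ :=
    Finset.eq_univ_of_forall fun e => List.mem_toFinset.2 (mem_edgeList e)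
  have h' := Multiset.toFinset_card_eq_card_iff_nodup (m := (edgeList n : Multiset (EIdx n)))
  rw [Multiset.coe_nodup] at h'
  refine h'.1 ?_
  change (edgeList n).toFinset.card = (edgeList n).length
  rw [h, length_edgeList]
  simp only [Finset.card_univ, Fintype.card_sum, Fintype.card_prod, Fintype.card_fin]
  ring

/-- The measured edges. -/
def measured (n : ℕ) : Finset (gridGraph n).edgeSet :=
  Finset.univ.map ((Function.Embedding.inl).trans (edgeEquiv n).toEmbedding)

open scoped Classical in
/-- The states of the measured edges, for the cubic graph `H`. -/
def measuredState (H : CubicGraph) : MIdx H.n → Expr × Expr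
  | .inl ((i, j), k) => cellState (decide (i = j)) (decide (H.graph.Adj i j)) k
  | .inr (_, k) => endState k

lemma goodState_measuredState (H : CubicGraph) (m : MIdx H.n) : GoodState (measuredState H m) := by
  rcases m with ⟨⟨i, j⟩, k⟩ | ⟨i, k⟩
  · exact goodState_cellState _ _ _
  · exact goodState_endState _

/-- The states of all edges; the value at discarded edges is irrelevant. -/
def edgeState (H : CubicGraph) (e : (gridGraph H.n).edgeSet) : Expr × Expr :=
  Sum.elim (measuredState H) (fun _ => (.one, .one)) ((edgeEquiv H.n).symm e)

lemma mem_measured {n : ℕ} {e : (gridGraph n).edgeSet} :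
    e ∈ measured n ↔ ∃ m : MIdx n, edgeEquiv n (.inl m) = e := by
  simp [measured]

lemma goodState_edgeState (H : CubicGraph) {e : (gridGraph H.n).edgeSet} (he : e ∈ measured H.n) :
    GoodState (edgeState H e) := by
  obtain ⟨m, rfl⟩ := mem_measured.1 he
  simpa [edgeState] using goodState_measuredState H m

/-- The instance produced from the cubic graph `H`. -/
def reduction (H : CubicGraph) : SCMInstance where
  numV := numVertices H.n
  numE := (edgeList H.n).length
  graph := gridGraph H.n
  planar := isPlanar_gridGraph H.n
  edge := ((nodup_edgeList H.n).getEquivOfForallMemList _ mem_edgeList).trans (edgeEquiv H.n)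
  M := measured H.n
  amp e b := bif b then (edgeState H e).2 else (edgeState H e).1
  amp_defined e b := by
    cases b
    · exact (goodState_edgeState H e.2).1
    · exact (goodState_edgeState H e.2).2.1
  amp_unit e := (goodState_edgeState H e.2).2.2

/-- The code of an edge. -/
def edgeCode (H : CubicGraph) (e : EIdx H.n) : List Token :=
  encodeNat (eSrc e) ++ encodeNat (eDst e) ++
    Sum.elim (fun m => (measuredState H m).1.encode ++ (measuredState H m).2.encode)
      (fun _ => []) e ++ [Token.done]

lemma encodeEdge_reduction (H : CubicGraph) (e : EIdx H.n) :
    (reduction H).encodeEdge (edgeEquiv H.n e) = edgeCode H e := by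
  have hlt : vSrc e < vDst e := eSrc_lt_eDst e
  have h1 : (edgeEquiv H.n e).1.inf = vSrc e := by
    rw [edgeEquiv_coe, eEnds, Sym2.inf_mk, inf_eq_left.2 hlt.le]
  have h2 : (edgeEquiv H.n e).1.sup = vDst e := by
    rw [edgeEquiv_coe, eEnds, Sym2.sup_mk, sup_eq_right.2 hlt.le]
  unfold SCMInstance.encodeEdge edgeCode
  erw [h1, h2]
  congr 2
  rcases e with m | c
  · have hm : edgeEquiv H.n (.inl m) ∈ (reduction H).M := mem_measured.2 ⟨m, rfl⟩
    refine (dif_pos hm).trans ?_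
    simp [reduction, edgeState]
  · have hm : edgeEquiv H.n (.inr c) ∉ (reduction H).M := fun h => by
      obtain ⟨m, hm⟩ := mem_measured.1 h
      simpa using (edgeEquiv H.n).injective hm
    exact dif_neg hm

lemma encode_reduction (H : CubicGraph) :
    (reduction H).encode =
      encodeNat (numVertices H.n) ++ (edgeList H.n).flatMap (edgeCode H) ++ [Token.done] := by
  unfold SCMInstance.encode
  have : (List.finRange (reduction H).numE).flatMap
      (fun j => (reduction H).encodeEdge ((reduction H).edge j)) =
      (edgeList H.n).flatMap (edgeCode H) := by
    calc _ = ((List.finRange (edgeList H.n).length).map (edgeList H.n).get).flatMap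
          (edgeCode H) := by
          rw [List.flatMap_map]
          exact List.flatMap_congr fun j _ => encodeEdge_reduction H _
      _ = _ := by rw [List.map_get_finRange]
  rw [this]
  rfl

end Instance

/-! ### The program -/

section Program

open Function

/-- The stacks: the input and its reversal, the reversed and the final output, and five unary
counters. The counter `q` holds four times the number of symbols read, `w` and `n` hold `4 * n + 2`
and `n + 1` for a graph with `n` vertices, `d` counts down to the next cell on the diagonal. -/
inductive Stk : Type
  | inp | tin | rev | out | q | w | n | d | tmp
  deriving DecidableEq

instance : Fintype Stk where
  elems := ⟨([.inp, .tin, .rev, .out, .q, .w, .n, .d, .tmp] : List Stk), by simp⟩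
  complete x := by cases x <;> simp

/-- The stack alphabets. -/
def Sym : Stk → Type
  | .inp => Option Bool
  | .tin => Option Bool
  | _ => Token

instance : Fintype Token where
  elems := ⟨([.tick, .sep, .done, .one, .neg, .add, .mul, .inv, .sqrt] : List Token), by simp⟩
  complete x := by cases x <;> simp

instance (k : Stk) : Fintype (Sym k) := by
  cases k <;> unfold Sym <;> infer_instance

/-- The word of `m` ticks. -/
def ticks (m : ℕ) : List Token := List.replicate m Token.tick

lemma encodeNat_eq (m : ℕ) : encodeNat m = ticks m ++ [Token.sep] := rfl

lemma ticks_add (a b : ℕ) : ticks (a + b) = ticks a ++ ticks b :=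
  List.replicate_add a b _

lemma reverse_ticks (a : ℕ) : (ticks a).reverse = ticks a := List.reverse_replicate

lemma ticks_push (m q : ℕ) : ticks (q + m) = (ticks m).reverse ++ ticks q := by
  rw [reverse_ticks, ← ticks_add, add_comm]

/-- The contents of the stacks. -/
def store (inp tin : List (Option Bool)) (rev out : List Token) (q w n d tmp : ℕ) :
    ∀ k, List (Sym k)
  | .inp => inp
  | .tin => tin
  | .rev => rev
  | .out => out
  | .q => ticks q
  | .w => ticks w
  | .n => ticks n
  | .d => ticks d
  | .tmp => ticks tmp

/-- The program that pushes a copy of the unary counter `k` onto `dst`. -/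
def copyCode {K : Type} {Γ : K → Type} (k tmp dst : K) (a : Γ k) (b : Γ tmp) (c : Γ dst) :
    Code Γ :=
  .seq (.loop k (.seq (.pop k) (.seq (.push tmp [b]) (.push dst [c]))))
    (.loop tmp (.seq (.pop tmp) (.push k [a])))

lemma exec_copyCode {K : Type} [DecidableEq K] {Γ : K → Type} {k tmp dst : K} (h1 : tmp ≠ k)
    (h2 : dst ≠ k) (h3 : dst ≠ tmp) (a : Γ k) (b : Γ tmp) (c : Γ dst) (m : ℕ)
    (S : ∀ k, List (Γ k)) (hk : S k = List.replicate m a) (ht : S tmp = []) :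
    Exec (copyCode k tmp dst a b c) S (update S dst (List.replicate m c ++ S dst))
      (8 * m + 2) := by
  have loop1 : ∀ (m : ℕ) (S : ∀ k, List (Γ k)), S k = List.replicate m a →
      Exec (.loop k (.seq (.pop k) (.seq (.push tmp [b]) (.push dst [c])))) S
        (update (update (update S k []) tmp (List.replicate m b ++ S tmp)) dst
          (List.replicate m c ++ S dst)) (4 * m + 1) := by
    intro m
    induction m with
    | zero =>
      intro S hS
      have : update (update (update S k []) tmp (List.replicate 0 b ++ S tmp)) dst
          (List.replicate 0 c ++ S dst) = S := by
        funext j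
        by_cases hd : j = dst
        · subst hd; simp
        by_cases ht : j = tmp
        · subst ht; simp [hd]
        by_cases hk : j = k
        · subst hk; simp [hd, ht, hS]
        simp [hd, ht, hk]
      rw [this]
      exact (Exec.loop_nil (by simpa using hS))
    | succ m ih =>
      intro S hS
      refine (Exec.loop_cons (by simp [hS, List.replicate_succ])
        ((Exec.pop _ _).seq ((Exec.push _ _ _).seq (Exec.push _ _ _))) (?_ : Exec _ _ _ (4 * m + 1))
        ).mono (by omega)
      convert ih _ _ using 1
      · funext j
        by_cases hd : j = dst
        · subst hd
          simp [h2, h3, List.replicate_succ']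
        by_cases ht : j = tmp
        · subst ht
          simp [h1, hd, List.replicate_succ']
        by_cases hk : j = k
        · subst hk
          simp [hd, ht]
        simp [hd, ht, hk]
      · simp [h1.symm, h2.symm, hS, List.replicate_succ]
  have loop2 : ∀ (m : ℕ) (S : ∀ k, List (Γ k)), S tmp = List.replicate m b →
      Exec (.loop tmp (.seq (.pop tmp) (.push k [a]))) S
        (update (update S tmp []) k (List.replicate m a ++ S k)) (3 * m + 1) := by
    intro m
    induction m with
    | zero =>
      intro S hS
      have : update (update S tmp []) k (List.replicate 0 a ++ S k) = S := by
        funext j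
        by_cases hk : j = k
        · subst hk; simp
        by_cases ht : j = tmp
        · subst ht; simp [hk, hS]
        simp [ht, hk]
      rw [this]
      exact (Exec.loop_nil (by simpa using hS))
    | succ m ih =>
      intro S hS
      refine (Exec.loop_cons (by simp [hS, List.replicate_succ])
        ((Exec.pop _ _).seq (Exec.push _ _ _)) (?_ : Exec _ _ _ (3 * m + 1))
        ).mono (by omega)
      convert ih _ _ using 1
      · funext j
        by_cases hk : j = k
        · subst hk
          simp [h1.symm, List.replicate_succ']
        by_cases ht : j = tmp
        · subst ht
          simp [hk]
        simp [ht, hk]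
      · simp [h1, hS, List.replicate_succ]
  unfold copyCode
  refine Exec.mono (t := 4 * m + 1 + (3 * m + 1)) ?_ (by omega)
  convert (loop1 m S hk).seq (loop2 m _ ?_) using 1
  · funext j
    by_cases hd : j = dst
    · subst hd
      simp [h2, h3]
    by_cases hk' : j = k
    · subst hk'
      simp [hd, h1.symm, hk]
    by_cases ht' : j = tmp
    · subst ht'
      simp [hk', hd, ht]
    simp [hd, ht', hk']
  · simp [h3.symm, ht]

section Steps

variable (inp tin : List (Option Bool)) (rev out : List Token) (q w n d : ℕ)

lemma exec_push_rev (u : List Token) :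
    Exec (.push Stk.rev u) (store inp tin rev out q w n d 0)
      (store inp tin (u.reverse ++ rev) out q w n d 0) 1 := by
  convert Exec.push (Γ := Sym) Stk.rev u _ using 1
  funext k
  cases k <;> rfl

lemma exec_push_q (m : ℕ) :
    Exec (.push Stk.q (ticks m)) (store inp tin rev out q w n d 0)
      (store inp tin rev out (q + m) w n d 0) 1 := by
  convert Exec.push (Γ := Sym) Stk.q (ticks m) _ using 1
  funext k
  cases k <;> first | rfl | exact ticks_push _ _

lemma exec_push_w (m : ℕ) :
    Exec (.push Stk.w (ticks m)) (store inp tin rev out q w n d 0)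
      (store inp tin rev out q (w + m) n d 0) 1 := by
  convert Exec.push (Γ := Sym) Stk.w (ticks m) _ using 1
  funext k
  cases k <;> first | rfl | exact ticks_push _ _

lemma exec_push_n (m : ℕ) :
    Exec (.push Stk.n (ticks m)) (store inp tin rev out q w n d 0)
      (store inp tin rev out q w (n + m) d 0) 1 := by
  convert Exec.push (Γ := Sym) Stk.n (ticks m) _ using 1
  funext k
  cases k <;> first | rfl | exact ticks_push _ _

lemma tail_ticks (m : ℕ) : (ticks m).tail = ticks (m - 1) := List.tail_replicate

lemma exec_pop_q : Exec (.pop Stk.q) (store inp tin rev out q w n d 0)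
    (store inp tin rev out (q - 1) w n d 0) 1 := by
  convert Exec.pop (Γ := Sym) Stk.q _ using 1
  funext k
  cases k <;> first | rfl | exact (tail_ticks _).symm

lemma exec_pop_w : Exec (.pop Stk.w) (store inp tin rev out q w n d 0)
    (store inp tin rev out q (w - 1) n d 0) 1 := by
  convert Exec.pop (Γ := Sym) Stk.w _ using 1
  funext k
  cases k <;> first | rfl | exact (tail_ticks _).symm

lemma exec_pop_n : Exec (.pop Stk.n) (store inp tin rev out q w n d 0)
    (store inp tin rev out q w (n - 1) d 0) 1 := by
  convert Exec.pop (Γ := Sym) Stk.n _ using 1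
  funext k
  cases k <;> first | rfl | exact (tail_ticks _).symm

lemma exec_pop_d : Exec (.pop Stk.d) (store inp tin rev out q w n d 0)
    (store inp tin rev out q w n (d - 1) 0) 1 := by
  convert Exec.pop (Γ := Sym) Stk.d _ using 1
  funext k
  cases k <;> first | rfl | exact (tail_ticks _).symm

lemma exec_pop_inp (a : Option Bool) :
    Exec (.pop Stk.inp) (store (a :: inp) tin rev out q w n d 0)
      (store inp tin rev out q w n d 0) 1 := by
  convert Exec.pop (Γ := Sym) Stk.inp _ using 1
  funext k
  cases k <;> rfl

/-- The program that appends the counter `q` to the output. -/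
def copyQ : Code Sym := copyCode Stk.q Stk.tmp Stk.rev Token.tick Token.tick Token.tick

/-- The program that appends the counter `w` to the output. -/
def copyW : Code Sym := copyCode Stk.w Stk.tmp Stk.rev Token.tick Token.tick Token.tick

/-- The program that adds the counter `n` to the counter `d`. -/
def copyN : Code Sym := copyCode Stk.n Stk.tmp Stk.d Token.tick Token.tick Token.tick

lemma exec_copyQ : Exec copyQ (store inp tin rev out q w n d 0)
    (store inp tin (ticks q ++ rev) out q w n d 0) (8 * q + 2) := by
  unfold copyQ
  convert exec_copyCode (Γ := Sym) (k := Stk.q) (tmp := Stk.tmp) (dst := Stk.rev) (by decide)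
    (by decide) (by decide) Token.tick Token.tick Token.tick q
    (store inp tin rev out q w n d 0) rfl rfl using 1
  funext k
  cases k <;> rfl

lemma exec_copyW : Exec copyW (store inp tin rev out q w n d 0)
    (store inp tin (ticks w ++ rev) out q w n d 0) (8 * w + 2) := by
  unfold copyW
  convert exec_copyCode (Γ := Sym) (k := Stk.w) (tmp := Stk.tmp) (dst := Stk.rev) (by decide)
    (by decide) (by decide) Token.tick Token.tick Token.tick w
    (store inp tin rev out q w n d 0) rfl rfl using 1
  funext k
  cases k <;> rfl

lemma exec_copyN : Exec copyN (store inp tin rev out q w n d 0)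
    (store inp tin rev out q w n (n + d) 0) (8 * n + 2) := by
  unfold copyN
  convert exec_copyCode (Γ := Sym) (k := Stk.n) (tmp := Stk.tmp) (dst := Stk.d) (by decide)
    (by decide) (by decide) Token.tick Token.tick Token.tick n
    (store inp tin rev out q w n d 0) rfl rfl using 1
  funext k
  cases k <;> first | rfl | exact ticks_add n d

/-- The program that moves a symbol from the input to its reversal. -/
def moveIn : Code Sym := .move Stk.inp Stk.tin fun o => o.getD (none : Option Bool)

/-- The program that moves a symbol back to the input. -/
def moveBack : Code Sym := .move Stk.tin Stk.inp fun o => o.getD (none : Option Bool)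

/-- The program that moves a symbol from the reversed output to the output. -/
def moveOut : Code Sym := .move Stk.rev Stk.out fun o => o.getD Token.done

lemma exec_moveIn (a : Option Bool) : Exec moveIn (store (a :: inp) tin rev out q w n d 0)
    (store inp (a :: tin) rev out q w n d 0) 1 := by
  unfold moveIn
  convert Exec.move (Γ := Sym) Stk.inp Stk.tin (fun o => o.getD (none : Option Bool)) _ using 1
  funext k
  cases k <;> rfl

lemma exec_moveBack (a : Option Bool) : Exec moveBack (store inp (a :: tin) rev out q w n d 0)
    (store (a :: inp) tin rev out q w n d 0) 1 := by
  unfold moveBack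
  convert Exec.move (Γ := Sym) Stk.tin Stk.inp (fun o => o.getD (none : Option Bool)) _ using 1
  funext k
  cases k <;> rfl

lemma exec_moveOut (a : Token) : Exec moveOut (store inp tin (a :: rev) out q w n d 0)
    (store inp tin rev (a :: out) q w n d 0) 1 := by
  unfold moveOut
  convert Exec.move (Γ := Sym) Stk.rev Stk.out (fun o => o.getD Token.done) _ using 1
  funext k
  cases k <;> rfl

end Steps

end Program

section Program

/-- The description of an edge relative to the current position: the smaller endpoint is
`q + w + src` or `q + src`, the larger one `q + w + dst`, followed by the code of the state. -/
structure Item where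
  far : Bool
  src : ℕ
  dst : ℕ
  data : List Token

/-- The code of the edge described by an item. -/
def Item.word (it : Item) (q w : ℕ) : List Token :=
  encodeNat (q + ((bif it.far then w else 0) + it.src)) ++ encodeNat (q + (w + it.dst)) ++
    it.data ++ [Token.done]

/-- An edge of the given kind. -/
def kindItem (k : Fin 6) (data : List Token) : Item :=
  ⟨kindFar k, kindSrc k, kindDst k, data⟩

/-- The code of a qubit state. -/
def stateCode (s : Expr × Expr) : List Token := s.1.encode ++ s.2.encode

/-- The edges at a cell. -/
def cellItems (diag adj : Bool) : List Item :=
  [kindItem 0 [], kindItem 1 [], kindItem 2 (stateCode (cellState diag adj 0)),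
    kindItem 3 (stateCode (cellState diag adj 1)), kindItem 4 (stateCode (cellState diag adj 2)),
    kindItem 5 (stateCode (cellState diag adj 3))]

/-- The edges at a row end. -/
def endItems : List Item :=
  [kindItem 0 (stateCode (endState 0)), kindItem 1 [], kindItem 2 (stateCode (endState 1)),
    kindItem 3 (stateCode (endState 2))]

/-- The edges at the cell or row end of an input symbol, when `d` more symbols precede the next
cell on the diagonal. -/
def symbolItems (d : ℕ) : Option Bool → List Item
  | none => endItems
  | some b => cellItems (decide (d = 0)) b

/-- The distance to the next cell on the diagonal, after an input symbol; `m` is the length of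
a row. -/
def nextDist (m d : ℕ) (a : Option Bool) : ℕ :=
  if a ≠ none ∧ d = 0 then m else d - 1

/-- The code of all edges at the remaining input symbols. -/
def edgesCode (m w : ℕ) : List (Option Bool) → ℕ → ℕ → List Token
  | [], _, _ => []
  | a :: l, q, d => (symbolItems d a).flatMap (fun it => it.word q w) ++
      edgesCode m w l (q + 4) (nextDist m d a)

/-- The program that writes the edge described by an item. -/
def itemCode (it : Item) : Code Sym :=
  .seq copyQ <| .seq (bif it.far then copyW else .push Stk.rev ([] : List Token)) <|
    .seq (.push Stk.rev (encodeNat it.src)) <| .seq copyQ <| .seq copyW <|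
      .push Stk.rev (encodeNat it.dst ++ it.data ++ [Token.done])

/-- The program that writes the edges described by a list of items. -/
def itemsCode (l : List Item) : Code Sym :=
  l.foldr (fun it P => .seq (itemCode it) P) (.push Stk.rev ([] : List Token))

/-- The factor `8 / 27` of the constant for each row of cells. A row contributes
`(4 / 3) ^ 3 = 64 / 27` for its three cells that stand for edges; the remaining factors are powers
of two. -/
def rowFactor : Expr :=
  .mul (.mul .two (.inv .three)) (.mul (.mul .two (.inv .three)) (.mul .two (.inv .three)))

/-- Whether a row ends here. -/
def isRowEnd : Option (Option Bool) → Bool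
  | some none => true
  | _ => false

/-- Whether the current matrix entry is `1`. -/
def isAdjacent : Option (Option Bool) → Bool
  | some (some true) => true
  | _ => false

/-- The first pass: reverse the input, write the number of vertices, and set up `w` and `n`. -/
def countCode : Code Sym :=
  .seq (.loop Stk.inp
    (.seq (.ite Stk.inp isRowEnd
      (.seq (.push Stk.rev (ticks 4)) (.seq (.push Stk.w (ticks 4)) (.push Stk.n (ticks 1))))
      (.push Stk.rev ([] : List Token)))
    (.seq (.push Stk.rev (ticks 4)) moveIn))) <|
  .seq (.push Stk.rev (encodeNat 4)) (.seq (.push Stk.w (ticks 2)) (.push Stk.n (ticks 1)))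

/-- The processing of one input symbol in the second pass. -/
def symbolCode : Code Sym :=
  .seq
    (.ite Stk.inp isRowEnd (.seq (itemsCode endItems) (.pop Stk.d))
      (.ite Stk.d Option.isNone (.seq (itemsCode (cellItems true false)) copyN)
        (.seq (.ite Stk.inp isAdjacent (itemsCode (cellItems false true))
          (itemsCode (cellItems false false))) (.pop Stk.d))))
    (.seq (.pop Stk.inp) (.push Stk.q (ticks 4)))

/-- The program that writes the constant, using up the counters. -/
def constCode : Code Sym :=
  .seq (.loop Stk.q (.seq (.pop Stk.q) (.push Stk.rev (Token.mul :: Expr.two.encode)))) <|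
  .seq (.loop Stk.w (.pop Stk.w)) <|
  .seq (.loop Stk.n (.seq (.pop Stk.n) (.push Stk.rev (Token.mul :: rowFactor.encode)))) <|
  .seq (.push Stk.rev (Token.inv :: rowFactor.encode)) (.loop Stk.d (.pop Stk.d))

/-- The whole program. -/
def mainCode : Code Sym :=
  .seq countCode <| .seq (.loop Stk.tin moveBack) <| .seq (.loop Stk.inp symbolCode) <|
    .seq (.push Stk.rev [Token.done]) <| .seq constCode (.loop Stk.rev moveOut)

lemma exec_loop_step {k : Stk} {P : Code Sym} {S S' S'' : ∀ k, List (Sym k)} {t t' : ℕ}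
    (h : Exec P S S' t) (h' : Exec (.loop k P) S' S'' t') (hk : S k ≠ []) :
    Exec (.loop k P) S S'' (t + t' + 1) :=
  Exec.loop_cons hk h h'

section Runs

variable (inp tin : List (Option Bool)) (rev out : List Token) (q w n d : ℕ)

lemma exec_itemCode (it : Item) :
    Exec (itemCode it) (store inp tin rev out q w n d 0)
      (store inp tin ((it.word q w).reverse ++ rev) out q w n d 0) (16 * q + 16 * w + 11) := by
  have h2 : Exec (bif it.far then copyW else .push Stk.rev ([] : List Token))
      (store inp tin (ticks q ++ rev) out q w n d 0)
      (store inp tin (ticks (bif it.far then w else 0) ++ (ticks q ++ rev)) out q w n d 0)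
      (8 * w + 2) := by
    cases it.far
    · exact (exec_push_rev inp tin (ticks q ++ rev) out q w n d []).mono (by omega)
    · exact exec_copyW inp tin (ticks q ++ rev) out q w n d
  have h := (exec_copyQ inp tin rev out q w n d).seq <| h2.seq <|
    (exec_push_rev inp tin _ out q w n d (encodeNat it.src)).seq <|
    (exec_copyQ inp tin _ out q w n d).seq <| (exec_copyW inp tin _ out q w n d).seq
    (exec_push_rev inp tin _ out q w n d (encodeNat it.dst ++ it.data ++ [Token.done]))
  refine h.of_eq ?_ (by omega)
  congr 1
  simp only [Item.word, encodeNat_eq, ticks_add, List.reverse_append, reverse_ticks,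
    List.reverse_cons, List.reverse_nil, List.nil_append, List.append_assoc]

lemma exec_itemsCode (l : List Item) :
    Exec (itemsCode l) (store inp tin rev out q w n d 0)
      (store inp tin ((l.flatMap fun it => it.word q w).reverse ++ rev) out q w n d 0)
      (l.length * (16 * q + 16 * w + 11) + 1) := by
  induction l generalizing rev with
  | nil => exact (exec_push_rev inp tin rev out q w n d []).mono (by omega)
  | cons it l ih =>
    have h := (exec_itemCode inp tin rev out q w n d it).seq (ih _)
    refine h.of_eq ?_ ?_
    · congr 1
      simp
    · rw [List.length_cons]
      ring_nf
      exact le_rfl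

lemma length_symbolItems_le (a : Option Bool) : (symbolItems d a).length ≤ 6 := by
  cases a <;> simp [symbolItems, endItems, cellItems]

/-- One input symbol is processed. -/
lemma exec_symbolCode (a : Option Bool) :
    Exec symbolCode (store (a :: inp) tin rev out q w n d 0)
      (store inp tin (((symbolItems d a).flatMap fun it => it.word q w).reverse ++ rev) out
        (q + 4) w n (nextDist n d a) 0) (100 * (q + w + n + 1)) := by
  have tail : ∀ (rev : List Token) (d : ℕ), Exec (.seq (.pop Stk.inp) (.push Stk.q (ticks 4)))
      (store (a :: inp) tin rev out q w n d 0) (store inp tin rev out (q + 4) w n d 0) 2 :=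
    fun rev d => (exec_pop_inp inp tin rev out q w n d a).seq
      (exec_push_q inp tin rev out q w n d 4)
  refine Exec.mono (t := (6 * (16 * q + 16 * w + 11) + 8 * n + 8) + 2) (Exec.seq ?_ (tail _ _))
    (by omega)
  rcases a with _ | b
  · have h := (exec_itemsCode (none :: inp) tin rev out q w n d endItems).seq
      (exec_pop_d _ _ _ _ _ _ _ _)
    refine (Exec.ite_pos rfl h).mono ?_
    simp only [endItems, List.length_cons, List.length_nil]
    omega
  · refine Exec.mono (Exec.ite_neg rfl ?_)
      (show (6 * (16 * q + 16 * w + 11) + 8 * n + 7) + 1 ≤ _ by omega)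
    rcases Nat.eq_zero_or_pos d with rfl | hd
    · have h := (exec_itemsCode (some b :: inp) tin rev out q w n 0 (cellItems true false)).seq
        (exec_copyN _ _ _ _ _ _ _ _)
      exact (Exec.ite_pos rfl h).mono (by
        simp only [cellItems, List.length_cons, List.length_nil]
        omega)
    · obtain ⟨d, rfl⟩ := Nat.exists_eq_succ_of_ne_zero hd.ne'
      have h : Exec (.ite Stk.inp isAdjacent (itemsCode (cellItems false true))
          (itemsCode (cellItems false false))) (store (some b :: inp) tin rev out q w n (d + 1) 0)
          (store (some b :: inp) tin (((symbolItems (d + 1) (some b)).flatMap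
            fun it => it.word q w).reverse ++ rev) out q w n (d + 1) 0)
          (6 * (16 * q + 16 * w + 11) + 2) := by
        cases b
        · exact Exec.ite_neg rfl (exec_itemsCode (some false :: inp) tin rev out q w n (d + 1)
            (cellItems false false))
        · exact Exec.ite_pos rfl (exec_itemsCode (some true :: inp) tin rev out q w n (d + 1)
            (cellItems false true))
      refine (Exec.ite_neg rfl (h.seq (exec_pop_d _ _ _ _ _ _ _ _))).mono (by omega)

/-- The counter of the distance to the next diagonal cell, after the given input. -/
def finalDist (m : ℕ) : List (Option Bool) → ℕ → ℕ
  | [], d => d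
  | a :: l, d => finalDist m l (nextDist m d a)

/-- The second pass. -/
lemma exec_loop_symbolCode (l : List (Option Bool)) (Q : ℕ) (hQ : q + 4 * l.length ≤ Q) :
    Exec (.loop Stk.inp symbolCode) (store l tin rev out q w n d 0)
      (store [] tin ((edgesCode n w l q d).reverse ++ rev) out (q + 4 * l.length) w n
        (finalDist n l d) 0) (l.length * (100 * (Q + w + n + 1) + 1) + 1) := by
  induction l generalizing rev q d with
  | nil => exact (Exec.loop_nil rfl).mono (by omega)
  | cons a l ih =>
    rw [List.length_cons] at hQ
    have h0 : Exec symbolCode _ _ (100 * (Q + w + n + 1)) :=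
      (exec_symbolCode l tin rev out q w n d a).mono (by omega)
    have h := exec_loop_step h0
      (ih _ (q + 4) _ (by omega)) (List.cons_ne_nil _ _)
    refine h.of_eq ?_ ?_
    · congr 1
      · simp [edgesCode]
      · rw [List.length_cons]
        ring
    · rw [List.length_cons]
      ring_nf
      exact le_rfl

/-- The loop of the first pass. -/
lemma exec_loop_count (l : List (Option Bool)) :
    Exec (.loop Stk.inp
    (.seq (.ite Stk.inp isRowEnd
      (.seq (.push Stk.rev (ticks 4)) (.seq (.push Stk.w (ticks 4)) (.push Stk.n (ticks 1))))
      (.push Stk.rev ([] : List Token)))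
    (.seq (.push Stk.rev (ticks 4)) moveIn))) (store l tin rev out q w n d 0)
      (store [] (l.reverse ++ tin) (ticks (4 * l.length + 4 * l.count none) ++ rev) out q
        (w + 4 * l.count none) (n + l.count none) d 0) (7 * l.length + 1) := by
  induction l generalizing tin rev w n with
  | nil => exact (Exec.loop_nil rfl)
  | cons a l ih =>
    rcases a with _ | b
    · have h1 := (exec_push_rev (none :: l) tin rev out q w n d (ticks 4)).seq
        ((exec_push_w (none :: l) tin _ out q w n d 4).seq (exec_push_n _ _ _ _ _ _ _ _ 1))
      have h2 := (exec_push_rev (none :: l) tin ((ticks 4).reverse ++ rev) out q (w + 4) (n + 1) d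
        (ticks 4)).seq (exec_moveIn l tin _ out q (w + 4) (n + 1) d none)
      have h := exec_loop_step ((Exec.ite_pos rfl h1).seq h2)
        (ih (none :: tin) _ (w + 4) (n + 1)) (List.cons_ne_nil _ _)
      refine h.of_eq ?_ (by rw [List.length_cons]; omega)
      congr 1
      · simp
      · simp only [reverse_ticks, List.length_cons, List.count_cons_self, ← List.append_assoc,
          ← ticks_add]
        congr 2
        ring
      · rw [List.count_cons_self]; ring
      · rw [List.count_cons_self]; ring
    · have h1 := exec_push_rev (some b :: l) tin rev out q w n d []
      have h2 := (exec_push_rev (some b :: l) tin rev out q w n d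
        (ticks 4)).seq (exec_moveIn l tin _ out q w n d (some b))
      have h := exec_loop_step ((Exec.ite_neg rfl h1).seq h2)
        (ih (some b :: tin) _ w n) (List.cons_ne_nil _ _)
      have hc : (some b :: l).count none = l.count none := List.count_cons_of_ne (by simp)
      refine h.of_eq ?_ (by rw [List.length_cons]; omega)
      congr 1
      · simp
      · simp only [reverse_ticks, List.length_cons, hc, ← List.append_assoc,
          ← ticks_add]
        congr 2
        ring

lemma exec_countCode (l : List (Option Bool)) :
    Exec countCode (store l [] [] [] 0 0 0 0 0)
      (store [] l.reverse (encodeNat (4 * l.length + 4 * l.count none + 4)).reverse [] 0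
        (4 * l.count none + 2) (l.count none + 1) 0 0) (7 * l.length + 4) := by
  have h := (exec_loop_count [] [] [] 0 0 0 0 l).seq <|
    (exec_push_rev [] _ _ [] 0 _ _ 0 (encodeNat 4)).seq <|
    (exec_push_w [] _ _ [] 0 _ _ 0 2).seq (exec_push_n [] _ _ [] 0 _ _ 0 1)
  refine h.of_eq ?_ (by omega)
  congr 1
  · simp
  · simp [encodeNat_eq, ticks_add, reverse_ticks]
    rw [← ticks_add, ← ticks_add, add_comm]
  · ring
  · ring

lemma exec_loop_moveBack (l : List (Option Bool)) :
    Exec (.loop Stk.tin moveBack) (store inp l rev out q w n d 0)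
      (store (l.reverse ++ inp) [] rev out q w n d 0) (2 * l.length + 1) := by
  induction l generalizing inp with
  | nil => exact Exec.loop_nil rfl
  | cons a l ih =>
    have h := exec_loop_step (exec_moveBack inp l rev out q w n d a) (ih (a :: inp))
      (List.cons_ne_nil _ _)
    refine h.of_eq ?_ (by rw [List.length_cons]; omega)
    congr 1
    simp

lemma exec_loop_moveOut (l : List Token) :
    Exec (.loop Stk.rev moveOut) (store inp tin l out q w n d 0)
      (store inp tin [] (l.reverse ++ out) q w n d 0) (2 * l.length + 1) := by
  induction l generalizing out with
  | nil => exact Exec.loop_nil rfl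
  | cons a l ih =>
    have h := exec_loop_step (exec_moveOut inp tin l out q w n d a) (ih (a :: out))
      (List.cons_ne_nil _ _)
    refine h.of_eq ?_ (by rw [List.length_cons]; omega)
    congr 1
    simp

lemma exec_loop_q (u : List Token) :
    Exec (.loop Stk.q (.seq (.pop Stk.q) (.push Stk.rev u))) (store inp tin rev out q w n d 0)
      (store inp tin ((List.replicate q u).flatten.reverse ++ rev) out 0 w n d 0)
      (3 * q + 1) := by
  induction q generalizing rev with
  | zero => exact Exec.loop_nil rfl
  | succ q ih =>
    have h := exec_loop_step ((exec_pop_q inp tin rev out (q + 1) w n d).seq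
      (exec_push_rev _ _ _ _ _ _ _ _ u)) (ih _) (List.cons_ne_nil _ _)
    refine h.of_eq ?_ (by omega)
    congr 1
    simp [List.replicate_succ]

lemma exec_loop_n (u : List Token) :
    Exec (.loop Stk.n (.seq (.pop Stk.n) (.push Stk.rev u))) (store inp tin rev out q w n d 0)
      (store inp tin ((List.replicate n u).flatten.reverse ++ rev) out q w 0 d 0)
      (3 * n + 1) := by
  induction n generalizing rev with
  | zero => exact Exec.loop_nil rfl
  | succ n ih =>
    have h := exec_loop_step ((exec_pop_n inp tin rev out q w (n + 1) d).seq
      (exec_push_rev _ _ _ _ _ _ _ _ u)) (ih _) (List.cons_ne_nil _ _)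
    refine h.of_eq ?_ (by omega)
    congr 1
    simp [List.replicate_succ]

lemma exec_loop_w :
    Exec (.loop Stk.w (.pop Stk.w)) (store inp tin rev out q w n d 0)
      (store inp tin rev out q 0 n d 0) (2 * w + 1) := by
  induction w with
  | zero => exact Exec.loop_nil rfl
  | succ w ih =>
    exact (exec_loop_step (exec_pop_w inp tin rev out q (w + 1) n d) ih
      (List.cons_ne_nil _ _)).mono (by omega)

lemma exec_loop_d :
    Exec (.loop Stk.d (.pop Stk.d)) (store inp tin rev out q w n d 0)
      (store inp tin rev out q w n 0 0) (2 * d + 1) := by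
  induction d with
  | zero => exact Exec.loop_nil rfl
  | succ d ih =>
    exact (exec_loop_step (exec_pop_d inp tin rev out q w n (d + 1)) ih
      (List.cons_ne_nil _ _)).mono (by omega)

/-- The code of the constant `2 ^ q * (8 / 27) ^ n / (8 / 27)`. -/
def constWord (q n : ℕ) : List Token :=
  (List.replicate q (Token.mul :: Expr.two.encode)).flatten ++
    ((List.replicate n (Token.mul :: rowFactor.encode)).flatten ++
      Token.inv :: rowFactor.encode)

lemma exec_constCode :
    Exec constCode (store inp tin rev out q w n d 0)
      (store inp tin ((constWord q n).reverse ++ rev) out 0 0 0 0 0)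
      (3 * q + 2 * w + 3 * n + 2 * d + 5) := by
  have h := (exec_loop_q inp tin rev out q w n d (Token.mul :: Expr.two.encode)).seq <|
    (exec_loop_w inp tin _ out 0 w n d).seq <|
    (exec_loop_n inp tin _ out 0 0 n d (Token.mul :: rowFactor.encode)).seq <|
    (exec_push_rev inp tin _ out 0 0 0 d (Token.inv :: rowFactor.encode)).seq
    (exec_loop_d inp tin _ out 0 0 0 d)
  refine h.of_eq ?_ (by omega)
  congr 1
  simp [constWord]

end Runs

end Program

section Program

open Function

/-- The output of the program. -/
def programOutput (l : List (Option Bool)) : List Token :=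
  encodeNat (4 * l.length + 4 * l.count none + 4) ++
    edgesCode (l.count none + 1) (4 * l.count none + 2) l 0 0 ++ [Token.done] ++
    constWord (4 * l.length) (l.count none + 1)

lemma length_data_symbolItems_le (d : ℕ) (a : Option Bool) :
    ∀ it ∈ symbolItems d a, it.src + it.dst + it.data.length ≤ 70 := by
  rcases a with _ | b
  · rw [symbolItems]
    decide
  · rw [symbolItems]
    cases b <;> cases decide (d = 0) <;> decide

lemma length_edgesCode_le (m w : ℕ) (l : List (Option Bool)) (q d Q : ℕ)
    (hQ : q + 4 * l.length ≤ Q) :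
    (edgesCode m w l q d).length ≤ l.length * (6 * (2 * Q + 2 * w + 73)) := by
  induction l generalizing q d with
  | nil => simp [edgesCode]
  | cons a l ih =>
    rw [List.length_cons] at hQ
    have h := ih (q + 4) (nextDist m d a) (by omega)
    have h2 : ((symbolItems d a).flatMap fun it => it.word q w).length ≤
        6 * (2 * Q + 2 * w + 73) := by
      rw [List.length_flatMap]
      refine (List.sum_le_card_nsmul _ (2 * Q + 2 * w + 73) ?_).trans ?_
      · intro x hx
        obtain ⟨it, hit, rfl⟩ := List.mem_map.1 hx
        have h3 := length_data_symbolItems_le d a it hit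
        simp only [Item.word, encodeNat, List.length_append, List.length_replicate,
          List.length_cons, List.length_nil]
        cases it.far <;> simp <;> omega
      · rw [List.length_map, smul_eq_mul]
        exact Nat.mul_le_mul_right _ (length_symbolItems_le d a)
    rw [edgesCode, List.length_append, List.length_cons]
    nlinarith

lemma finalDist_le (m : ℕ) (l : List (Option Bool)) (d : ℕ) :
    finalDist m l d ≤ max m d := by
  induction l generalizing d with
  | nil => exact le_max_right _ _
  | cons a l ih =>
    refine (ih _).trans (max_le (le_max_left _ _) ?_)
    unfold nextDist
    split_ifs
    · exact le_max_left _ _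
    · exact (Nat.sub_le _ _).trans (le_max_right _ _)

lemma length_constWord (q n : ℕ) : (constWord q n).length = 4 * q + 33 * n + 33 := by
  simp [constWord, rowFactor, Expr.two, Expr.three, Expr.encode]
  ring

lemma exec_mainCode (l : List (Option Bool)) :
    Exec mainCode (store l [] [] [] 0 0 0 0 0) (store [] [] [] (programOutput l) 0 0 0 0 0)
      (5000 * (l.length + 1) ^ 2) := by
  have h := (exec_countCode l).seq <|
    (exec_loop_moveBack [] _ [] _ _ _ _ l.reverse).seq <|
    (exec_loop_symbolCode [] _ [] 0 _ _ 0 (l.reverse.reverse ++ []) _ le_rfl).seq <|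
    (exec_push_rev [] [] _ [] _ _ _ _ [Token.done]).seq <|
    (exec_constCode [] [] _ [] _ _ _ _).seq (exec_loop_moveOut [] [] [] 0 0 0 0 _)
  refine h.of_eq ?_ ?_
  · congr 1
    simp [programOutput]
  · have h1 : l.count none ≤ l.length := List.count_le_length
    have h2 := length_edgesCode_le (l.count none + 1) (4 * l.count none + 2) l 0 0 _ le_rfl
    have h3 := finalDist_le (l.count none + 1) l 0
    have h4 := length_constWord (4 * l.length) (l.count none + 1)
    rw [max_eq_left (Nat.zero_le _)] at h3
    simp only [List.append_nil, List.reverse_reverse, List.length_append, List.length_reverse,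
      List.length_cons, List.length_nil, encodeNat, List.length_replicate, zero_add] at *
    generalize l.length = N at *
    generalize l.count none = z at *
    generalize (edgesCode _ _ l 0 0).length = E at *
    generalize finalDist _ l 0 = D at *
    nlinarith

lemma store_input (l : List (Option Bool)) :
    store l [] [] [] 0 0 0 0 0 = update (β := fun k => List (Sym k)) (fun _ => []) Stk.inp l := by
  funext k
  cases k <;> rfl

lemma store_output (l : List Token) :
    store [] [] [] l 0 0 0 0 0 = update (β := fun k => List (Sym k)) (fun _ => []) Stk.out l := by
  funext k
  cases k <;> rfl

/-- A function whose encoded values are written by the program is computable in polynomial time. -/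
theorem computable_of_programOutput {α β : Type} (ea : α → List (Option Bool))
    (eb : β → List Token) (f : α → β) (h : ∀ a, eb (f a) = programOutput (ea a)) :
    Nonempty (Turing.TM2ComputableInPolyTime ea eb f) := by
  refine Code.computable_of_exec (Γ := Sym) mainCode (k₀ := Stk.inp) (k₁ := Stk.out) ea eb f
    (5000 * (Polynomial.X + 1) ^ 2) fun a => ?_
  have h' := exec_mainCode (ea a)
  rw [store_input, store_output, ← h a] at h'
  have hp : (5000 * (Polynomial.X + 1) ^ 2 : Polynomial ℕ).eval (ea a).length =
      5000 * ((ea a).length + 1) ^ 2 := by simp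
  exact Exec.mono h' hp.ge

end Program

/-! ### The output of the program -/

section Output

lemma edgesCode_append (m w : ℕ) (l l' : List (Option Bool)) (q d : ℕ) :
    edgesCode m w (l ++ l') q d =
      edgesCode m w l q d ++ edgesCode m w l' (q + 4 * l.length) (finalDist m l d) := by
  induction l generalizing q d with
  | nil => rfl
  | cons a l ih =>
    simp only [List.cons_append, edgesCode, ih, List.append_assoc, finalDist, List.length_cons]
    congr 3
    omega

lemma finalDist_append (m : ℕ) (l l' : List (Option Bool)) (d : ℕ) :
    finalDist m (l ++ l') d = finalDist m l' (finalDist m l d) := by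
  induction l generalizing d with
  | nil => rfl
  | cons a l ih => exact ih _

variable (H : CubicGraph)

open scoped Classical in
/-- The code of a row of the adjacency matrix, up to a column. -/
def rowCode (i : Fin H.n) (l : List (Fin H.n)) : List (Option Bool) :=
  l.map fun j => some (decide (H.graph.Adj i j))

lemma encode_eq : H.encode =
    (List.finRange H.n).flatMap fun i => rowCode H i (List.finRange H.n) ++ [none] := rfl

/-- The distance counter before the entry in column `k` of row `i`. -/
def distAt (n i k : ℕ) : ℕ := if k ≤ i then i - k else n + 2 + i - k

open scoped Classical in
lemma symbolItems_cell (i j : Fin H.n) :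
    (symbolItems (distAt H.n i j) (some (decide (H.graph.Adj i j)))).flatMap
      (fun it => it.word (4 * (i * (H.n + 1) + j)) (4 * H.n + 2)) =
    (cellEdges i j).flatMap (edgeCode H) := by
  have h : decide (distAt H.n i j = 0) = decide (i = j) := by
    rw [decide_eq_decide, distAt, Fin.ext_iff]
    split_ifs <;> omega
  rw [symbolItems, h]
  simp only [cellItems, cellEdges, List.flatMap_cons, List.flatMap_nil, edgeCode, Item.word,
    kindItem, eSrc, eDst, eRow, eCol, eKind, Sum.elim_inl, Sum.elim_inr, stateCode, measuredState]
  rfl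

lemma symbolItems_end (i : Fin H.n) (d : ℕ) :
    (symbolItems d none).flatMap
      (fun it => it.word (4 * (i * (H.n + 1) + H.n)) (4 * H.n + 2)) =
    (endEdges i).flatMap (edgeCode H) := by
  simp only [symbolItems, endItems, endEdges, List.flatMap_cons, List.flatMap_nil, edgeCode,
    Item.word, kindItem, eSrc, eDst, eRow, eCol, eKind, Sum.elim_inl, Sum.elim_inr, stateCode,
    measuredState]
  rfl

lemma edgesCode_rowCode (i : Fin H.n) (k : ℕ) (hk : k ≤ H.n) :
    edgesCode (H.n + 1) (4 * H.n + 2) (rowCode H i ((List.finRange k).map (Fin.castLE hk)))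
        (4 * (i * (H.n + 1))) i =
      (((List.finRange k).map (Fin.castLE hk)).flatMap (cellEdges i)).flatMap (edgeCode H) ∧
    finalDist (H.n + 1) (rowCode H i ((List.finRange k).map (Fin.castLE hk))) i =
      distAt H.n i k := by
  classical
  induction k with
  | zero => simp [rowCode, edgesCode, finalDist, distAt]
  | succ k ih =>
    obtain ⟨ih1, ih2⟩ := ih (by omega)
    have hl : (List.finRange (k + 1)).map (Fin.castLE hk) =
        (List.finRange k).map (Fin.castLE (by omega : k ≤ H.n)) ++ [⟨k, hk⟩] := by
      rw [List.finRange_succ_last, List.map_append, List.map_map]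
      rfl
    have hrow : ∀ l l', rowCode H i (l ++ l') = rowCode H i l ++ rowCode H i l' :=
      fun l l' => List.map_append
    have hlen : (rowCode H i ((List.finRange k).map
        (Fin.castLE (by omega : k ≤ H.n)))).length = k := by simp [rowCode]
    have h1 : rowCode H i [⟨k, hk⟩] = [some (decide (H.graph.Adj i ⟨k, hk⟩))] := rfl
    rw [hl, hrow, edgesCode_append, finalDist_append, ih1, ih2, hlen, h1]
    constructor
    · rw [List.flatMap_append, List.flatMap_append, edgesCode, edgesCode, List.append_nil,
        List.flatMap_singleton, ← symbolItems_cell]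
      congr 4
      simp only [Nat.mul_add]
    · simp only [finalDist, nextDist, distAt]
      split_ifs <;> simp_all <;> omega

lemma edgesCode_row (i : Fin H.n) :
    edgesCode (H.n + 1) (4 * H.n + 2) (rowCode H i (List.finRange H.n) ++ [none])
        (4 * (i * (H.n + 1))) i =
      ((List.finRange H.n).flatMap (cellEdges i) ++ endEdges i).flatMap (edgeCode H) ∧
    finalDist (H.n + 1) (rowCode H i (List.finRange H.n) ++ [none]) i = i + 1 := by
  have hl : (List.finRange H.n).map (Fin.castLE le_rfl) = List.finRange H.n := by
    simp
  have h := edgesCode_rowCode H i H.n le_rfl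
  rw [hl] at h
  rw [edgesCode_append, finalDist_append, h.1, h.2]
  constructor
  · rw [List.flatMap_append, edgesCode, edgesCode, List.append_nil, ← symbolItems_end H i _]
    congr 4
    simp only [rowCode, List.length_map, List.length_finRange]
    simp only [Nat.mul_add]
  · simp only [finalDist, nextDist, distAt]
    split_ifs <;> simp_all <;> omega

lemma edgesCode_rows (k : ℕ) (hk : k ≤ H.n) :
    edgesCode (H.n + 1) (4 * H.n + 2) (((List.finRange k).map (Fin.castLE hk)).flatMap
        fun i => rowCode H i (List.finRange H.n) ++ [none]) 0 0 =
      (((List.finRange k).map (Fin.castLE hk)).flatMap fun i =>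
        (List.finRange H.n).flatMap (cellEdges i) ++ endEdges i).flatMap (edgeCode H) ∧
    finalDist (H.n + 1) (((List.finRange k).map (Fin.castLE hk)).flatMap
        fun i => rowCode H i (List.finRange H.n) ++ [none]) 0 = k := by
  induction k with
  | zero => simp [edgesCode, finalDist]
  | succ k ih =>
    obtain ⟨ih1, ih2⟩ := ih (by omega)
    have hl : (List.finRange (k + 1)).map (Fin.castLE hk) =
        (List.finRange k).map (Fin.castLE (by omega : k ≤ H.n)) ++ [⟨k, hk⟩] := by
      rw [List.finRange_succ_last, List.map_append, List.map_map]
      rfl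
    have h := edgesCode_row H ⟨k, hk⟩
    have hlen : (((List.finRange k).map (Fin.castLE (by omega : k ≤ H.n))).flatMap
        fun i => rowCode H i (List.finRange H.n) ++ [none]).length = k * (H.n + 1) := by
      simp [rowCode, List.length_flatMap, Function.comp_def]
    rw [hl, List.flatMap_append, List.flatMap_append, List.flatMap_append, edgesCode_append,
      finalDist_append, ih1, ih2, hlen, List.flatMap_singleton, List.flatMap_singleton, zero_add]
    exact ⟨by rw [h.1], h.2⟩

lemma edgesCode_encode :
    edgesCode (H.n + 1) (4 * H.n + 2) H.encode 0 0 = (edgeList H.n).flatMap (edgeCode H) := by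
  have h := (edgesCode_rows H H.n le_rfl).1
  have hl : (List.finRange H.n).map (Fin.castLE le_rfl) = List.finRange H.n := by
    simp
  rwa [hl] at h

lemma length_encode : H.encode.length = H.n * (H.n + 1) := by
  simp [encode_eq, rowCode, List.length_flatMap]

lemma count_none_encode : H.encode.count none = H.n := by
  have h : ∀ i, (rowCode H i (List.finRange H.n)).count none = 0 := fun i =>
    List.count_eq_zero_of_not_mem (by simp [rowCode])
  rw [encode_eq, List.count_flatMap]
  simp [Function.comp_def, h]

/-- The constant `2 ^ (4 * n * (n + 1)) * (8 / 27) ^ (n + 1) / (8 / 27)`. -/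
def constExpr (n : ℕ) : Expr :=
  (Expr.mul .two)^[4 * (n * (n + 1))] ((Expr.mul rowFactor)^[n + 1] (.inv rowFactor))

lemma encode_iterate_mul (a b : Expr) (k : ℕ) :
    ((Expr.mul a)^[k] b).encode =
      (List.replicate k (Token.mul :: a.encode)).flatten ++ b.encode := by
  induction k with
  | zero => rfl
  | succ k ih =>
    rw [Function.iterate_succ_apply', Expr.encode, ih, List.replicate_succ]
    simp

lemma encode_constExpr (n : ℕ) : (constExpr n).encode = constWord (4 * (n * (n + 1))) (n + 1) := by
  rw [constExpr, encode_iterate_mul, encode_iterate_mul]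
  rfl

lemma value_iterate_mul (a b : Expr) (k : ℕ) :
    ((Expr.mul a)^[k] b).value = a.value ^ k * b.value := by
  induction k with
  | zero => simp
  | succ k ih =>
    rw [Function.iterate_succ_apply', Expr.value, ih, pow_succ']
    ring

lemma defined_iterate_mul {a b : Expr} (ha : a.Defined) (hb : b.Defined) (k : ℕ) :
    ((Expr.mul a)^[k] b).Defined := by
  induction k with
  | zero => exact hb
  | succ k ih =>
    rw [Function.iterate_succ_apply']
    exact ⟨ha, ih⟩

lemma value_rowFactor : rowFactor.value = 8 / 27 := by
  simp only [rowFactor, Expr.value, Expr.value_two, Expr.value_three]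
  norm_num

lemma rowFactor_defined : rowFactor.Defined := by
  have h : (Expr.mul .two (.inv .three)).Defined :=
    ⟨by simp [Expr.two, Expr.Defined], by simp [Expr.three, Expr.two, Expr.Defined], by
      rw [Expr.value_three]; norm_num⟩
  exact ⟨h, h, h⟩

lemma value_constExpr (n : ℕ) :
    (constExpr n).value = ((16 ^ n ^ 2 * (128 / 27) ^ n : ℝ) : ℂ) := by
  rw [constExpr, value_iterate_mul, value_iterate_mul, Expr.value_two, Expr.value, value_rowFactor,
    show 4 * (n * (n + 1)) = 4 * n ^ 2 + 4 * n by ring, pow_add, pow_mul, pow_mul]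
  push_cast
  rw [show (128 / 27 : ℂ) = 16 * (8 / 27) by norm_num, mul_pow,
    show (2 : ℂ) ^ 4 = 16 by norm_num]
  have h : (8 / 27 : ℂ) * (8 / 27)⁻¹ = 1 := by norm_num
  linear_combination (16 ^ n ^ 2 * 16 ^ n * (8 / 27) ^ n) * h

/-- The constant of the reduction. -/
def reductionConst (n : ℕ) : RealConst where
  expr := constExpr n
  defined := defined_iterate_mul (by simp [Expr.two, Expr.Defined])
    (defined_iterate_mul rowFactor_defined
      (show (Expr.inv rowFactor).Defined from ⟨rowFactor_defined, by
        rw [value_rowFactor]; norm_num⟩) _) _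
  real := by rw [value_constExpr, Complex.ofReal_im]

lemma value_reductionConst (n : ℕ) :
    (reductionConst n).value = 16 ^ n ^ 2 * (128 / 27) ^ n := by
  rw [RealConst.value, reductionConst, value_constExpr, Complex.ofReal_re]

/-- The program writes the code of the instance and of the constant. -/
lemma encodeOutput_reduction :
    encodeOutput (reduction H, reductionConst H.n) = programOutput H.encode := by
  rw [encodeOutput, encode_reduction, programOutput, count_none_encode, edgesCode_encode,
    length_encode, reductionConst, encode_constExpr,
    show numVertices H.n = 4 * (H.n * (H.n + 1)) + 4 * H.n + 4 by rw [numVertices]; ring]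

end Output

/-! ### Marginals as sums of squares -/

section Marginal

lemma sum_mul_sum_eq_normSq {α γ : Type} [Fintype α] [Fintype γ] (N : ℂ) (Φ : α → ℂ)
    (F : α → γ → ℂ) (hF : ∀ a c, conj (F a c) = F a c) :
    ∑ a, conj (Φ a) * ∑ b, (∑ c, (N * F a c) * (N * F b c)) * Φ b =
      N * N * ∑ c, ((Complex.normSq (∑ a, Φ a * F a c) : ℝ) : ℂ) := by
  have h : ∀ c, ((Complex.normSq (∑ a, Φ a * F a c) : ℝ) : ℂ) =
      ∑ a, ∑ b, conj (Φ a) * F a c * (Φ b * F b c) := fun c => by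
    rw [Complex.normSq_eq_conj_mul_self, map_sum, Finset.sum_mul_sum]
    simp only [map_mul, hF]
  simp only [h, Finset.mul_sum, Finset.sum_mul]
  conv_rhs => rw [Finset.sum_comm]
  refine Finset.sum_congr rfl fun a _ => ?_
  conv_rhs => rw [Finset.sum_comm]
  refine Finset.sum_congr rfl fun b _ => Finset.sum_congr rfl fun c _ => ?_
  ring

open scoped Classical in
/-- The overlap of a product state with a marginal of the surface code state is an average of
squared absolute values, one for each assignment of bits to the discarded edges. -/
theorem marginal_eq_sum_normSq {V A C : Type} [Fintype V] [Fintype A] [Fintype C]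
    (G : SimpleGraph V) (ε : A ⊕ C ≃ G.edgeSet) (M : Finset G.edgeSet)
    (hM : ∀ s, ε s ∈ M ↔ s.isLeft) (φ : {e // e ∈ M} → Bool → ℂ) (φ' : A → Bool → ℂ)
    (hφ : ∀ a, φ ⟨ε (.inl a), (hM _).2 rfl⟩ = φ' a) :
    marginal G M φ = ((cycles G).ncard : ℂ)⁻¹ * ∑ c : C → Bool,
      ((Complex.normSq (∑ a : A → Bool, if IsCycle G (Sum.elim a c ∘ ε.symm) then
        ∏ i, φ' i (a i) else 0) : ℝ) : ℂ) := by
  let eM : A ≃ {e // e ∈ M} := Equiv.ofBijective (fun a => ⟨ε (.inl a), (hM _).2 rfl⟩)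
    ⟨fun a b h => by simpa using h, fun ⟨e, he⟩ => by
      obtain ⟨s, rfl⟩ := ε.surjective e
      rcases s with a | c
      · exact ⟨a, rfl⟩
      · simpa using (hM _).1 he⟩
  let eC : C ≃ {e // e ∉ M} := Equiv.ofBijective
    (fun c => ⟨ε (.inr c), fun h => by simpa using (hM _).1 h⟩)
    ⟨fun a b h => by simpa using h, fun ⟨e, he⟩ => by
      obtain ⟨s, rfl⟩ := ε.surjective e
      rcases s with a | c
      · exact absurd ((hM _).2 rfl) he
      · exact ⟨c, rfl⟩⟩
  have hcomb : ∀ (a : {e // e ∈ M} → Bool) (c : {e // e ∉ M} → Bool),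
      combine M a c = Sum.elim (a ∘ eM) (c ∘ eC) ∘ ε.symm := by
    intro a c
    funext e
    obtain ⟨s, rfl⟩ := ε.surjective e
    rcases s with s | s
    · have h : ε (.inl s) ∈ M := (hM _).2 rfl
      simp [combine, h, eM]
      rfl
    · have h : ε (.inr s) ∉ M := fun h => by simpa using (hM _).1 h
      simp [combine, h, eC]
      rfl
  have hprod : ∀ a : {e // e ∈ M} → Bool, productState M φ a = ∏ i, φ' i ((a ∘ eM) i) := by
    intro a
    unfold productState
    refine (Fintype.prod_equiv eM _ _ fun i => ?_).symm
    rw [← hφ]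
    rfl
  set N : ℝ := (Real.sqrt (cycles G).ncard)⁻¹ with hN
  have hN2 : ((N * N : ℝ) : ℂ) = ((cycles G).ncard : ℂ)⁻¹ := by
    rw [hN, ← mul_inv, Real.mul_self_sqrt (Nat.cast_nonneg _)]
    push_cast
    rfl
  let F : (A → Bool) → (C → Bool) → ℂ := fun a c =>
    if IsCycle G (Sum.elim a c ∘ ε.symm) then 1 else 0
  have hψ : ∀ a c, surfaceCodeState G (combine M a c) = N * F (a ∘ eM) (c ∘ eC) := by
    intro a c
    rw [hcomb, surfaceCodeState]
    by_cases hx : IsCycle G (Sum.elim (a ∘ eM) (c ∘ eC) ∘ ε.symm)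
    · have hF1 : F (a ∘ eM) (c ∘ eC) = 1 := if_pos hx
      rw [hF1, mul_one]
      exact if_pos hx
    · have hF0 : F (a ∘ eM) (c ∘ eC) = 0 := if_neg hx
      rw [hF0, mul_zero]
      exact if_neg hx
  have hF : ∀ a c, conj (F a c) = F a c := fun a c => by
    simp only [F]
    split_ifs <;> simp
  let Φ : (A → Bool) → ℂ := fun a => ∏ i, φ' i (a i)
  have hS : ∀ c : C → Bool, (∑ a : A → Bool, if IsCycle G (Sum.elim a c ∘ ε.symm) then
      ∏ i, φ' i (a i) else 0) = ∑ a, Φ a * F a c := fun c => by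
    refine Finset.sum_congr rfl fun a _ => ?_
    simp only [F, Φ]
    split_ifs <;> simp
  have step : marginal G M φ = ∑ a : A → Bool, conj (Φ a) * ∑ b : A → Bool,
      (∑ c : C → Bool, (N * F a c) * (N * F b c)) * Φ b := by
    unfold marginal
    simp only [dotProduct, Matrix.mulVec, reducedDensity, Matrix.of_apply, Pi.star_apply]
    refine (Finset.sum_equiv (eM.arrowCongr (Equiv.refl Bool)) (by simp) fun a _ => ?_).symm
    have ha : (eM.arrowCongr (Equiv.refl Bool)) a ∘ eM = a := by funext i; simp
    rw [hprod, ha]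
    congr 1
    refine Finset.sum_equiv (eM.arrowCongr (Equiv.refl Bool)) (by simp) fun b _ => ?_
    have hb : (eM.arrowCongr (Equiv.refl Bool)) b ∘ eM = b := by funext i; simp
    rw [hprod, hb]
    congr 1
    refine Finset.sum_equiv (eC.arrowCongr (Equiv.refl Bool)) (by simp) fun c _ => ?_
    have hc : (eC.arrowCongr (Equiv.refl Bool)) c ∘ eC = c := by funext i; simp
    rw [hψ, hψ, ha, hb, hc, map_mul, hF, Complex.conj_ofReal]
  rw [step]
  refine (sum_mul_sum_eq_normSq (N : ℂ) Φ F hF).trans ?_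
  rw [← Complex.ofReal_mul, hN2]
  congr 1
  exact Finset.sum_congr rfl fun c _ => by rw [hS]

end Marginal

/-! ### Cycles of the grid graph -/

section Cycles

variable {n : ℕ}

/-- The place of an edge, as a number. -/
def ePos (e : EIdx n) : ℕ := eRow e * (n + 1) + eCol e

lemma ePos_eq_iff {e : EIdx n} {i j : ℕ} (hj : j ≤ n) :
    ePos e = i * (n + 1) + j ↔ eRow e = i ∧ eCol e = j := by
  refine ⟨fun h => ?_, fun ⟨h1, h2⟩ => by rw [ePos, h1, h2]⟩
  have h1 := eCol_le e
  unfold ePos at h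
  have h2 : eRow e = i := by
    have := congrArg (· / (n + 1)) h
    simpa [Nat.add_div_of_dvd_right, Nat.mul_div_cancel, Nat.div_eq_of_lt, Nat.lt_succ_of_le h1,
      Nat.lt_succ_of_le hj] using this
  rw [h2] at h
  exact ⟨h2, by omega⟩

lemma kind_ePos_injective : Function.Injective fun e : EIdx n => (eKind e, ePos e) := by
  intro e f h
  simp only [Prod.mk.injEq] at h
  have h2 := (ePos_eq_iff (eCol_le f)).1 h.2
  exact eIdx_ext h2.1 h2.2 h.1

/-- The bit on the edge of the given kind at the given place, which is `0` if there is no such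
edge. -/
def edgeBit (y : EIdx n → Bool) (s : Fin 6 × ℕ) : Bool :=
  open scoped Classical in decide (∃ e, (eKind e, ePos e) = s ∧ y e = true)

lemma edgeBit_self (y : EIdx n → Bool) (e : EIdx n) : edgeBit y (eKind e, ePos e) = y e := by
  unfold edgeBit
  cases h : y e with
  | true => exact decide_eq_true ⟨e, rfl, h⟩
  | false =>
    refine decide_eq_false fun ⟨f, hf, hy⟩ => ?_
    rw [kind_ePos_injective hf, h] at hy
    simp at hy

lemma edgeBit_eq_false {y : EIdx n → Bool} {s : Fin 6 × ℕ}
    (h : ∀ e : EIdx n, (eKind e, ePos e) ≠ s) :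
    edgeBit y s = false :=
  decide_eq_false fun ⟨e, he, _⟩ => h e he

/-- The number of edges of `y` at a vertex, when the edges at the vertex are listed by kind and
place. Pairs in `S` that do not belong to an edge contribute `0`. -/
lemma card_incident (y : EIdx n → Bool) (v : Fin (numVertices n)) (S : Finset (Fin 6 × ℕ))
    (hS : ∀ e : EIdx n, (eSrc e = v ∨ eDst e = v) ↔ (eKind e, ePos e) ∈ S) :
    Nat.card {e : (gridGraph n).edgeSet // v ∈ e.1 ∧ (y ∘ (edgeEquiv n).symm) e = true} =
      ∑ s ∈ S, (edgeBit y s).toNat := by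
  classical
  have hv : ∀ e : EIdx n, v ∈ eEnds e ↔ (eKind e, ePos e) ∈ S := fun e => by
    rw [← hS, eEnds, Sym2.mem_iff, Fin.ext_iff, Fin.ext_iff, eq_comm, eq_comm (a := (v : ℕ))]
    rfl
  have h1 : Nat.card {e : (gridGraph n).edgeSet // v ∈ e.1 ∧ (y ∘ (edgeEquiv n).symm) e = true} =
      (Finset.univ.filter fun e : EIdx n => (eKind e, ePos e) ∈ S ∧ y e = true).card := by
    rw [← Fintype.card_subtype, ← Nat.card_eq_fintype_card]
    refine Nat.card_congr ((edgeEquiv n).subtypeEquiv fun e => ?_).symm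
    rw [← hv, edgeEquiv_coe]
    simp
  rw [h1, Finset.card_eq_sum_card_fiberwise (f := fun e => (eKind e, ePos e)) (t := S)
    fun e he => (by simpa using he : _ ∧ _).1]
  refine Finset.sum_congr rfl fun s hs => ?_
  rw [Finset.filter_filter]
  by_cases h : ∃ e, (eKind e, ePos e) = s ∧ y e = true
  · have h' : edgeBit y s = true := decide_eq_true h
    rw [h', Bool.toNat_true, Finset.card_eq_one]
    obtain ⟨e, rfl, he⟩ := h
    refine ⟨e, Finset.ext fun f => ?_⟩
    simp only [Finset.mem_filter, Finset.mem_univ, true_and, Finset.mem_singleton]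
    exact ⟨fun hf => kind_ePos_injective hf.2, fun hf => by subst hf; exact ⟨⟨hs, he⟩, rfl⟩⟩
  · have h' : edgeBit y s = false := decide_eq_false h
    rw [h', Bool.toNat_false, Finset.card_eq_zero, Finset.filter_eq_empty_iff]
    exact fun f _ hf => h ⟨f, hf.2, hf.1.2⟩

/-- The edges at a vertex below the top row, by kind and place. -/
lemma incident_iff (p k : ℕ) (hk : k < 4) (e : EIdx n) :
    (eSrc e = 4 * (p + (n + 1)) + k ∨ eDst e = 4 * (p + (n + 1)) + k) ↔
      (eKind e, ePos e) ∈ (![{(0, p), (2, p), (3, p)}, {(1, p), (2, p), (4, p)},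
        {(4, p), (5, p), (0, p + 1)}, {(3, p), (5, p), (1, p + (n + 1))}]
          (⟨k, hk⟩ : Fin 4) : Finset (Fin 6 × ℕ)) := by
  unfold eSrc eDst
  change (4 * ePos e + _ = _ ∨ 4 * ePos e + _ = _) ↔ _
  generalize ePos e = q
  generalize eKind e = κ
  interval_cases k <;> fin_cases κ <;> simp [kindFar, kindSrc, kindDst] <;> omega

/-- The edges at a vertex of the top row, by kind and place. -/
lemma incident_top_iff (p k : ℕ) (hp : p ≤ n) (hk : k < 4) (e : EIdx n) :
    (eSrc e = 4 * p + k ∨ eDst e = 4 * p + k) ↔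
      (eKind e, ePos e) ∈ (![∅, ∅, if p = n then {(0, 0)} else ∅, {(1, p)}]
          (⟨k, hk⟩ : Fin 4) : Finset (Fin 6 × ℕ)) := by
  unfold eSrc eDst
  change (4 * ePos e + _ = _ ∨ 4 * ePos e + _ = _) ↔ _
  generalize ePos e = q
  generalize eKind e = κ
  interval_cases k <;> fin_cases κ <;> split_ifs <;> simp [kindFar, kindSrc, kindDst] <;> omega

lemma even_toNat_iff (a b c : Bool) :
    Even (a.toNat + (b.toNat + c.toNat)) ↔ a = (b ^^ c) := by
  revert a b c
  decide

lemma even_toNat_iff' (a b c : Bool) :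
    Even (b.toNat + (c.toNat + a.toNat)) ↔ a = (b ^^ c) := by
  revert a b c
  decide

/-- The parity conditions at the vertices of a cell or row end. -/
def RowConditions (y : EIdx n → Bool) (i j : ℕ) : Prop :=
  edgeBit y (0, i * (n + 1) + j) =
      (edgeBit y (2, i * (n + 1) + j) ^^ edgeBit y (3, i * (n + 1) + j)) ∧
    edgeBit y (1, i * (n + 1) + j) =
      (edgeBit y (2, i * (n + 1) + j) ^^ edgeBit y (4, i * (n + 1) + j)) ∧
    edgeBit y (0, i * (n + 1) + (j + 1)) =
      (edgeBit y (4, i * (n + 1) + j) ^^ edgeBit y (5, i * (n + 1) + j)) ∧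
    edgeBit y (1, (i + 1) * (n + 1) + j) =
      (edgeBit y (3, i * (n + 1) + j) ^^ edgeBit y (5, i * (n + 1) + j))

/-- The parity conditions at the vertices, row by row. -/
lemma isCycle_iff_edgeBit (y : EIdx n → Bool) :
    IsCycle (gridGraph n) (y ∘ (edgeEquiv n).symm) ↔
      edgeBit y (0, 0) = false ∧ (∀ j < n + 1, edgeBit y (1, j) = false) ∧
        ∀ i < n, ∀ j < n + 1, RowConditions y i j := by
  have hadd : ∀ i j, i * (n + 1) + j + (n + 1) = (i + 1) * (n + 1) + j := fun i j => by ring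
  have hlow : ∀ i < n, ∀ j < n + 1, (∀ k < 4, ∀ v : Fin (numVertices n),
      (v : ℕ) = 4 * (i * (n + 1) + j + (n + 1)) + k → Even (Nat.card {e : (gridGraph n).edgeSet //
        v ∈ e.1 ∧ (y ∘ (edgeEquiv n).symm) e = true})) ↔ RowConditions y i j := by
    intro i hi j hj
    have h1 := fun k (hk : k < 4) (v : Fin (numVertices n))
      (hv : (v : ℕ) = 4 * (i * (n + 1) + j + (n + 1)) + k) =>
      card_incident y v _ fun e => by rw [hv]; exact incident_iff (i * (n + 1) + j) k hk e
    have hb : i * (n + 1) + j + (n + 1) < (n + 1) * (n + 1) := by nlinarith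
    have h2 : (∀ k < 4, ∀ v : Fin (numVertices n),
      (v : ℕ) = 4 * (i * (n + 1) + j + (n + 1)) + k → Even (Nat.card {e : (gridGraph n).edgeSet //
        v ∈ e.1 ∧ (y ∘ (edgeEquiv n).symm) e = true})) ↔
        ∀ k (hk : k < 4), Even (∑ s ∈ (_ : Finset (Fin 6 × ℕ)), (edgeBit y s).toNat) :=
      ⟨fun h k hk => h1 k hk ⟨_, by unfold numVertices; omega⟩ rfl ▸ h k hk _ rfl,
        fun h k hk v hv => (h1 k hk v hv).symm ▸ h k hk⟩
    rw [h2, RowConditions, ← even_toNat_iff, ← even_toNat_iff, ← even_toNat_iff',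
      ← even_toNat_iff', ← hadd]
    refine ⟨fun h => ⟨?_, ?_, ?_, ?_⟩, fun h k hk => ?_⟩
    · simpa using h 0 (by norm_num)
    · simpa using h 1 (by norm_num)
    · simpa [← add_assoc] using h 2 (by norm_num)
    · simpa using h 3 (by norm_num)
    · interval_cases k
      · simpa using h.1
      · simpa using h.2.1
      · simpa [← add_assoc] using h.2.2.1
      · simpa using h.2.2.2
  have heven : ∀ b : Bool, Even b.toNat ↔ b = false := by decide
  have htop : ∀ j < n + 1, (∀ k < 4, ∀ v : Fin (numVertices n),
      (v : ℕ) = 4 * j + k → Even (Nat.card {e : (gridGraph n).edgeSet //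
        v ∈ e.1 ∧ (y ∘ (edgeEquiv n).symm) e = true})) ↔
      (j = n → edgeBit y (0, 0) = false) ∧ edgeBit y (1, j) = false := by
    intro j hj
    have h1 := fun k (hk : k < 4) (v : Fin (numVertices n)) (hv : (v : ℕ) = 4 * j + k) =>
      card_incident y v _ fun e => by rw [hv]; exact incident_top_iff j k (by omega) hk e
    have hb : j < (n + 1) * (n + 1) := by nlinarith
    have h2 : (∀ k < 4, ∀ v : Fin (numVertices n),
      (v : ℕ) = 4 * j + k → Even (Nat.card {e : (gridGraph n).edgeSet //
        v ∈ e.1 ∧ (y ∘ (edgeEquiv n).symm) e = true})) ↔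
        ∀ k (hk : k < 4), Even (∑ s ∈ (_ : Finset (Fin 6 × ℕ)), (edgeBit y s).toNat) :=
      ⟨fun h k hk => h1 k hk ⟨_, by unfold numVertices; omega⟩ rfl ▸ h k hk _ rfl,
        fun h k hk v hv => (h1 k hk v hv).symm ▸ h k hk⟩
    rw [h2, ← heven, ← heven]
    refine ⟨fun h => ⟨fun hj => ?_, ?_⟩, fun h k hk => ?_⟩
    · simpa [hj] using h 2 (by norm_num)
    · simpa using h 3 (by norm_num)
    · interval_cases k
      · simp
      · simp
      · by_cases hj : j = n
        · simpa [hj] using h.1 hj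
        · simp [hj]
      · simpa using h.2
  constructor
  · intro h
    have ht := fun j hj => (htop j hj).1 fun k _ v _ => h v
    exact ⟨(ht n (by omega)).1 rfl, fun j hj => (ht j hj).2,
      fun i hi j hj => (hlow i hi j hj).1 fun k _ v _ => h v⟩
  · rintro ⟨h0, h1, h2⟩ v
    rcases Nat.lt_or_ge ((v : ℕ) / 4) (n + 1) with hv | hv
    · exact (htop _ hv).2 ⟨fun _ => h0, h1 _ hv⟩ (v % 4) (Nat.mod_lt _ (by norm_num)) v (by omega)
    · have hlt : ((v : ℕ) / 4) / (n + 1) < n + 1 := by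
        refine Nat.div_lt_of_lt_mul ?_
        have := v.2
        unfold numVertices at this
        omega
      have hpos : 0 < ((v : ℕ) / 4) / (n + 1) := Nat.div_pos hv (by omega)
      have hmod := Nat.div_add_mod ((v : ℕ) / 4) (n + 1)
      obtain ⟨i, hi⟩ := Nat.exists_eq_succ_of_ne_zero hpos.ne'
      have hj : (v : ℕ) / 4 % (n + 1) < n + 1 := Nat.mod_lt _ (by omega)
      have hij := hadd i ((v : ℕ) / 4 % (n + 1))
      rw [hi, Nat.succ_eq_add_one, mul_comm] at hmod
      rw [hi] at hlt
      exact (hlow i (by omega) _ hj).2 (h2 i (by omega) _ hj) (v % 4)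
        (Nat.mod_lt _ (by norm_num)) v (by omega)

end Cycles

/-! ### Amplitudes of cycles with given discarded bits -/

section Factorization

variable {n : ℕ}

/-- The bit on the edge entering from above in row `i` and column `j`. -/
def upBit (c : CIdx n → Bool) (i j : ℕ) : Bool :=
  if h : i < n ∧ j < n + 1 then c (.inr (⟨i, h.1⟩, ⟨j, h.2⟩)) else false

/-- The bit on the edge entering from the left in row `i` and column `j`. In column `n` this edge is
measured, but in a cycle its bit is determined by the two edges of the boundary path. -/
def leftBit (c : CIdx n → Bool) (i j : ℕ) : Bool :=
  if h : i < n ∧ j < n then c (.inl (⟨i, h.1⟩, ⟨j, h.2⟩)) else (upBit c i j ^^ upBit c (i + 1) j)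

/-- The bits on the pendant edges vanish. -/
def PendantFree (c : CIdx n → Bool) : Prop :=
  (∀ i < n, leftBit c i 0 = false) ∧ ∀ j < n + 1, upBit c 0 j = false

/-- The parity conditions at the four vertices of a cell. -/
abbrev CellCycle (b : Fin 4 → Bool) (h v h' v' : Bool) : Prop :=
  h = (b 0 ^^ b 1) ∧ v = (b 0 ^^ b 2) ∧ h' = (b 2 ^^ b 3) ∧ v' = (b 1 ^^ b 3)

lemma isCycle_iff (a : MIdx n → Bool) (c : CIdx n → Bool) :
    IsCycle (gridGraph n) (Sum.elim a c ∘ (edgeEquiv n).symm) ↔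
      PendantFree c ∧
      (∀ i : Fin n, ∀ k, a (.inr (i, k)) = ![leftBit c i n, upBit c i n, upBit c (i + 1) n] k) ∧
      ∀ p : Fin n × Fin n, CellCycle (fun k => a (.inl (p, k))) (leftBit c p.1 p.2)
        (upBit c p.1 p.2) (leftBit c p.1 (p.2 + 1)) (upBit c (p.1 + 1) p.2) := by
  set y : EIdx n → Bool := Sum.elim a c with hy
  have bit : ∀ (e : EIdx n) (k : Fin 6) (i j : ℕ), eKind e = k → eRow e = i → eCol e = j →
      edgeBit y (k, i * (n + 1) + j) = y e := by
    rintro e _ _ _ rfl rfl rfl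
    exact edgeBit_self y e
  have nobit : ∀ (k : Fin 6) (i j : ℕ), j ≤ n → (∀ e : EIdx n, eKind e = k → eRow e = i →
      eCol e = j → False) → edgeBit y (k, i * (n + 1) + j) = false := by
    intro k i j hj h
    refine edgeBit_eq_false fun e he => ?_
    rw [Prod.mk.injEq, ePos_eq_iff hj] at he
    exact h e he.1 he.2.1 he.2.2
  have hH : ∀ i < n, ∀ j < n, edgeBit y (0, i * (n + 1) + j) = leftBit c i j := by
    intro i hi j hj
    rw [bit (.inr (.inl (⟨i, hi⟩, ⟨j, hj⟩))) 0 i j rfl rfl rfl, leftBit, dif_pos ⟨hi, hj⟩]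
    rfl
  have hHn : ∀ i : Fin n, edgeBit y (0, i * (n + 1) + n) = a (.inr (i, 0)) := fun i =>
    bit (.inl (.inr (i, 0))) 0 i n rfl rfl rfl
  have hV : ∀ i, ∀ j < n + 1, edgeBit y (1, i * (n + 1) + j) = upBit c i j := by
    intro i j hj
    unfold upBit
    split_ifs with h
    · rw [bit (.inr (.inr (⟨i, h.1⟩, ⟨j, hj⟩))) 1 i j rfl rfl rfl]
      rfl
    · exact nobit _ _ _ (by omega) fun e _ h2 _ => h ⟨h2 ▸ eRow_lt e, hj⟩
  have hH0 : edgeBit y (0, n * (n + 1) + 0) = false :=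
    nobit _ _ _ (Nat.zero_le _) fun e _ h2 _ => (eRow_lt e).ne h2
  have hcell : ∀ (p : Fin n × Fin n) (k : Fin 4), edgeBit y (⟨k + 2, by omega⟩,
      p.1 * (n + 1) + p.2) = a (.inl (p, k)) := fun p k =>
    bit (.inl (.inl (p, k))) _ _ _ rfl rfl rfl
  have hend2 : ∀ i : Fin n, edgeBit y (2, i * (n + 1) + n) = a (.inr (i, 1)) := fun i =>
    bit (.inl (.inr (i, 1))) _ _ _ rfl rfl rfl
  have hend3 : ∀ i : Fin n, edgeBit y (3, i * (n + 1) + n) = a (.inr (i, 2)) := fun i =>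
    bit (.inl (.inr (i, 2))) _ _ _ rfl rfl rfl
  have hend45 : ∀ (i : Fin n) (k : Fin 6), 4 ≤ (k : ℕ) →
      edgeBit y (k, i * (n + 1) + n) = false := by
    refine fun i k hk => nobit _ _ _ le_rfl fun e h1 h2 h3 => ?_
    rcases e with (⟨⟨i', j'⟩, k'⟩ | ⟨i', k'⟩) | (⟨i', j'⟩ | ⟨i', j'⟩)
    · exact (j'.2).ne h3
    · fin_cases k' <;> simp [eKind] at h1 <;> omega
    · simp [eKind] at h1
      omega
    · simp [eKind] at h1
      omega
  have hend4 := fun i => hend45 i 4 (by norm_num)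
  have hend5 := fun i => hend45 i 5 (by norm_num)
  -- The edge entering the first column of a row has its other end at a vertex next to the row end
  -- above, which has no further edges: this is the right vertex of that row end.
  have hwrap : ∀ i, edgeBit y (0, i * (n + 1) + (n + 1)) = edgeBit y (0, (i + 1) * (n + 1) + 0) :=
    fun i => by rw [add_zero, add_one_mul]
  have hleft : (edgeBit y (0, 0) = false ∧ ∀ i : Fin n,
      edgeBit y (0, i * (n + 1) + (n + 1)) = false) ↔ ∀ i < n, leftBit c i 0 = false := by
    constructor
    · rintro ⟨h0, h1⟩ i hi
      rw [← hH i hi 0 (by omega)]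
      rcases i with _ | i
      · simpa using h0
      · rw [← hwrap]
        exact h1 ⟨i, by omega⟩
    · intro h
      refine ⟨?_, fun i => ?_⟩
      · rcases Nat.eq_zero_or_pos n with hn | hn
        · simpa [hn] using hH0
        · simpa [h 0 hn] using hH 0 hn 0 hn
      · rw [hwrap]
        rcases Nat.lt_or_ge ((i : ℕ) + 1) n with hi | hi
        · rw [hH _ hi 0 (by omega), h _ hi]
        · have : (i : ℕ) + 1 = n := by omega
          rw [this, hH0]
  have hup : (∀ j < n + 1, edgeBit y (1, j) = false) ↔ ∀ j < n + 1, upBit c 0 j = false :=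
    forall₂_congr fun j hj => by rw [← hV 0 j hj, zero_mul, zero_add]
  have hrowEnd : ∀ i : Fin n, RowConditions y i n ↔
      edgeBit y (0, i * (n + 1) + (n + 1)) = false ∧
      ∀ k, a (.inr (i, k)) = ![leftBit c i n, upBit c i n, upBit c (i + 1) n] k := by
    intro i
    have : leftBit c i n = (upBit c i n ^^ upBit c (i + 1) n) := dif_neg (by omega)
    rw [RowConditions, hHn, hV _ _ (by omega), hV _ _ (by omega), hend2, hend3, hend4, hend5, this]
    simp only [Bool.xor_false, Fin.forall_fin_succ, Matrix.cons_val_zero, Matrix.cons_val_succ,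
      Fin.succ_zero_eq_one, Fin.succ_one_eq_two, Fin.isEmpty.forall_iff, and_true]
    constructor
    · rintro ⟨h1, h2, h3, h4⟩
      exact ⟨h3, h2 ▸ h4 ▸ h1, h2.symm, h4.symm⟩
    · rintro ⟨h3, h1, h2, h4⟩
      exact ⟨by rw [h1]; erw [h2, h4], h2.symm, h3, h4.symm⟩
  have hrowCell : (∀ i : Fin n, ∀ k, a (.inr (i, k)) =
      ![leftBit c i n, upBit c i n, upBit c (i + 1) n] k) → ∀ p : Fin n × Fin n,
      (RowConditions y p.1 p.2 ↔ CellCycle (fun k => a (.inl (p, k))) (leftBit c p.1 p.2)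
        (upBit c p.1 p.2) (leftBit c p.1 (p.2 + 1)) (upBit c (p.1 + 1) p.2)) := by
    intro hE p
    have h' : edgeBit y (0, p.1 * (n + 1) + (p.2 + 1)) = leftBit c p.1 (p.2 + 1) := by
      rcases Nat.lt_or_ge ((p.2 : ℕ) + 1) n with hj | hj
      · exact hH _ p.1.2 _ hj
      · have : (p.2 : ℕ) + 1 = n := by omega
        rw [this, hHn, hE]
        rfl
    rw [RowConditions, hH _ p.1.2 _ p.2.2, h', hV _ _ (by omega), hV _ _ (by omega),
      show edgeBit y (2, _) = _ from hcell p 0, show edgeBit y (3, _) = _ from hcell p 1,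
      show edgeBit y (4, _) = _ from hcell p 2, show edgeBit y (5, _) = _ from hcell p 3]
  rw [isCycle_iff_edgeBit, PendantFree, ← hleft, ← hup]
  constructor
  · rintro ⟨h0, h1, h2⟩
    have hE := fun i : Fin n => (hrowEnd i).1 (h2 i i.2 n (by omega))
    have hE' := fun i => (hE i).2
    exact ⟨⟨⟨h0, fun i => (hE i).1⟩, h1⟩, hE',
      fun p => (hrowCell hE' p).1 (h2 _ p.1.2 _ (by omega))⟩
  · rintro ⟨⟨⟨h0, hw⟩, h1⟩, hE, hC⟩
    refine ⟨h0, h1, fun i hi j hj => ?_⟩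
    rcases Nat.lt_or_ge j n with hjn | hjn
    · exact (hrowCell hE (⟨i, hi⟩, ⟨j, hjn⟩)).2 (hC _)
    · obtain rfl : j = n := by omega
      exact (hrowEnd ⟨i, hi⟩).2 ⟨hw _, hE _⟩

/-- The contribution of a cell, for given bits on the four edges that enter or leave it. -/
def cellSum (f : Fin 4 → Bool → ℂ) (h v h' v' : Bool) : ℂ :=
  ∑ b : Fin 4 → Bool, if CellCycle b h v h' v' then ∏ k, f k (b k) else 0

open scoped Classical in
/-- For given bits on the discarded edges, the sum over all cycles is a product over the cells and
the row ends. -/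
theorem sum_cycles_eq_prod (f : MIdx n → Bool → ℂ) (c : CIdx n → Bool) :
    (∑ a : MIdx n → Bool, if IsCycle (gridGraph n) (Sum.elim a c ∘ (edgeEquiv n).symm) then
      ∏ m, f m (a m) else 0) =
    if PendantFree c then
      (∏ p : Fin n × Fin n, cellSum (fun k => f (.inl (p, k))) (leftBit c p.1 p.2)
        (upBit c p.1 p.2) (leftBit c p.1 (p.2 + 1)) (upBit c (p.1 + 1) p.2)) *
      ∏ i : Fin n, (f (.inr (i, 0)) (leftBit c i n) * f (.inr (i, 1)) (upBit c i n) *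
        f (.inr (i, 2)) (upBit c (i + 1) n))
    else 0 := by
  simp only [isCycle_iff]
  split_ifs with hp
  swap
  · exact Finset.sum_eq_zero fun a _ => if_neg fun h => hp h.1
  simp only [hp, true_and]
  set E : Fin n × Fin 3 → Bool :=
    fun q => ![leftBit c q.1 n, upBit c q.1 n, upBit c (q.1 + 1) n] q.2 with hE
  let e : (Fin n × Fin n → Fin 4 → Bool) × (Fin n × Fin 3 → Bool) ≃ (MIdx n → Bool) :=
    ((Equiv.curry _ _ _).symm.prodCongr (Equiv.refl _)).trans
      (Equiv.sumArrowEquivProdArrow _ _ _).symm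
  have hsum : ∀ g : (MIdx n → Bool) → ℂ, ∑ a, g a = ∑ b : Fin n × Fin n → Fin 4 → Bool,
      ∑ d : Fin n × Fin 3 → Bool, g (Sum.elim (fun q => b q.1 q.2) d) := fun g => by
    rw [← Fintype.sum_prod_type' (f := fun (b : Fin n × Fin n → Fin 4 → Bool) d =>
      g (Sum.elim (fun q => b q.1 q.2) d))]
    refine (Finset.sum_equiv e (by simp) fun x _ => ?_).symm
    exact congrArg g (funext fun m => by rcases m with m | m <;> rfl)
  rw [hsum]
  have hend : ∀ b : Fin n × Fin n → Fin 4 → Bool, (∑ d : Fin n × Fin 3 → Bool,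
      if (∀ i : Fin n, ∀ k, (Sum.elim (fun q => b q.1 q.2) d : MIdx n → Bool) (.inr (i, k)) =
        ![leftBit c i n, upBit c i n, upBit c (i + 1) n] k) ∧
        ∀ p : Fin n × Fin n, CellCycle
          (fun k => (Sum.elim (fun q => b q.1 q.2) d : MIdx n → Bool) (.inl (p, k)))
          (leftBit c p.1 p.2) (upBit c p.1 p.2) (leftBit c p.1 (p.2 + 1)) (upBit c (p.1 + 1) p.2)
      then ∏ m, f m ((Sum.elim (fun q => b q.1 q.2) d : MIdx n → Bool) m) else 0) =
      (∏ p : Fin n × Fin n, if CellCycle (b p) (leftBit c p.1 p.2) (upBit c p.1 p.2)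
        (leftBit c p.1 (p.2 + 1)) (upBit c (p.1 + 1) p.2) then
          ∏ k, f (.inl (p, k)) (b p k) else 0) * ∏ q, f (.inr q) (E q) := by
    intro b
    rw [Finset.sum_eq_single E]
    · rw [Fintype.prod_sum_type, Fintype.prod_prod_type]
      simp only [Sum.elim_inl, Sum.elim_inr]
      by_cases h : ∀ p : Fin n × Fin n, CellCycle (b p) (leftBit c p.1 p.2) (upBit c p.1 p.2)
        (leftBit c p.1 (p.2 + 1)) (upBit c (p.1 + 1) p.2)
      · refine (if_pos ⟨fun i k => rfl, h⟩).trans ?_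
        congr 1
        exact Finset.prod_congr rfl fun p _ => (if_pos (h p)).symm
      · obtain ⟨p, hp⟩ := not_forall.1 h
        refine (if_neg fun h' => h h'.2).trans ?_
        exact (mul_eq_zero_of_left (Finset.prod_eq_zero (Finset.mem_univ p) (if_neg hp)) _).symm
    · intro d _ hd
      refine if_neg fun h => hd (funext fun q => h.1 q.1 q.2)
    · intro h
      exact absurd (Finset.mem_univ _) h
  rw [Finset.sum_congr rfl fun b _ => hend b, ← Finset.sum_mul]
  congr 1
  · simp only [cellSum]
    rw [Finset.prod_univ_sum, Fintype.piFinset_univ]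
  · rw [Fintype.prod_prod_type]
    refine Finset.prod_congr rfl fun i _ => ?_
    rw [Fin.prod_univ_three]
    rfl

end Factorization

/-! ### The number of cycles -/

section CountCycles

variable {n : ℕ}

/-- The parity of the number of bits `1` among the first `j` values of `u`. -/
def prefixXor (u : ℕ → Bool) : ℕ → Bool
  | 0 => false
  | j + 1 => prefixXor u j ^^ u j

lemma prefixXor_false (j : ℕ) : prefixXor (fun _ => false) j = false := by
  induction j with
  | zero => rfl
  | succ j ih => simp [prefixXor, ih]

lemma prefixXor_congr {u u' : ℕ → Bool} {j : ℕ} (h : ∀ k < j, u k = u' k) :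
    prefixXor u j = prefixXor u' j := by
  induction j with
  | zero => rfl
  | succ j ih => rw [prefixXor, prefixXor, ih fun k hk => h k (by omega), h j (by omega)]

/-- The parity of the four bits on the edges that enter or leave a cell is even, for each cell. -/
def CellEven (c : CIdx n → Bool) : Prop :=
  ∀ i < n, ∀ j < n, leftBit c i (j + 1) = (leftBit c i j ^^ (upBit c i j ^^ upBit c (i + 1) j))

/-- Summing the parity conditions along a row expresses the bits entering from the left by those
entering from above. -/
lemma leftBit_eq_of_cellEven {c : CIdx n → Bool} (h0 : PendantFree c) (h : CellEven c) {i j : ℕ}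
    (hi : i < n) (hj : j ≤ n) :
    leftBit c i j = (prefixXor (upBit c i) j ^^ prefixXor (upBit c (i + 1)) j) := by
  induction j with
  | zero => rw [h0.1 i hi]; rfl
  | succ j ih =>
    rw [h i hi j (by omega), ih (by omega), prefixXor, prefixXor]
    generalize prefixXor (upBit c i) j = a, prefixXor (upBit c (i + 1)) j = b, upBit c i j = d,
      upBit c (i + 1) j = e
    revert a b d e
    decide

lemma upBit_of_le (c : CIdx n → Bool) {i : ℕ} (hi : n ≤ i) (j : ℕ) : upBit c i j = false :=
  dif_neg (by omega)

lemma upBit_coe (c : CIdx n → Bool) (i : Fin n) (j : Fin (n + 1)) :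
    upBit c i j = c (.inr (i, j)) := by
  rw [upBit, dif_pos ⟨i.2, j.2⟩]

lemma leftBit_coe (c : CIdx n → Bool) (i j : Fin n) : leftBit c i j = c (.inl (i, j)) := by
  rw [leftBit, dif_pos ⟨i.2, j.2⟩]

lemma leftBit_last (c : CIdx n → Bool) (i : ℕ) :
    leftBit c i n = (upBit c i n ^^ upBit c (i + 1) n) :=
  dif_neg (by omega)

/-- Summing the parity conditions over whole rows, starting at the bottom, determines the bits on
the boundary path. -/
lemma upBit_last_of_cellEven {c : CIdx n → Bool} (h0 : PendantFree c) (h : CellEven c) (i : ℕ) :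
    upBit c i n = prefixXor (upBit c i) n := by
  have hlast : ∀ i, n ≤ i → upBit c i n = prefixXor (upBit c i) n := fun i hi => by
    rw [upBit_of_le c hi, funext (upBit_of_le c hi), prefixXor_false]
  rcases Nat.lt_or_ge n i with hi | hi
  · exact hlast i hi.le
  · induction hi using Nat.decreasingInduction with
    | self => exact hlast n le_rfl
    | of_succ i hi ih =>
      have h1 := leftBit_eq_of_cellEven h0 h hi le_rfl
      rw [leftBit_last, ih] at h1
      exact Bool.xor_left_inj.1 h1

/-- The bits entering from above the rows other than the first, extended by `0`. -/
def freeBit (w : Fin (n - 1) × Fin n → Bool) (i j : ℕ) : Bool :=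
  if h : (1 ≤ i ∧ i < n) ∧ j < n then w (⟨i - 1, by omega⟩, ⟨j, h.2⟩) else false

/-- The assignment with given bits on the edges that enter the cells from above. -/
def ofFreeBits (w : Fin (n - 1) × Fin n → Bool) : CIdx n → Bool
  | .inl (i, j) => prefixXor (freeBit w i) j ^^ prefixXor (freeBit w (i + 1)) j
  | .inr (i, j) => if (j : ℕ) < n then freeBit w i j else prefixXor (freeBit w i) n

lemma freeBit_of_le (w : Fin (n - 1) × Fin n → Bool) {i : ℕ} (hi : n ≤ i) (j : ℕ) :
    freeBit w i j = false :=
  dif_neg (by omega)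

lemma freeBit_zero (w : Fin (n - 1) × Fin n → Bool) (j : ℕ) : freeBit w 0 j = false :=
  dif_neg (by omega)

lemma upBit_ofFreeBits (w : Fin (n - 1) × Fin n → Bool) (i : ℕ) {j : ℕ} (hj : j < n) :
    upBit (ofFreeBits w) i j = freeBit w i j := by
  unfold upBit
  split_ifs with h
  · exact if_pos hj
  · rw [freeBit_of_le w (by omega)]

lemma upBit_ofFreeBits_last (w : Fin (n - 1) × Fin n → Bool) (i : ℕ) :
    upBit (ofFreeBits w) i n = prefixXor (freeBit w i) n := by
  unfold upBit
  split_ifs with h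
  · exact if_neg (lt_irrefl n)
  · rw [funext (freeBit_of_le w (by omega)), prefixXor_false]

lemma leftBit_ofFreeBits (w : Fin (n - 1) × Fin n → Bool) {i j : ℕ} (hi : i < n) (hj : j ≤ n) :
    leftBit (ofFreeBits w) i j =
      (prefixXor (freeBit w i) j ^^ prefixXor (freeBit w (i + 1)) j) := by
  rcases hj.lt_or_eq with h | rfl
  · exact dif_pos ⟨hi, h⟩
  · rw [leftBit_last, upBit_ofFreeBits_last, upBit_ofFreeBits_last]

lemma range_ofFreeBits : Set.range (ofFreeBits (n := n)) = {c | PendantFree c ∧ CellEven c} := by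
  ext c
  constructor
  · rintro ⟨w, rfl⟩
    refine ⟨⟨fun i hi => ?_, fun j hj => ?_⟩, fun i hi j hj => ?_⟩
    · rw [leftBit_ofFreeBits w hi (Nat.zero_le _)]
      rfl
    · rcases Nat.lt_or_ge j n with h | h
      · rw [upBit_ofFreeBits w 0 h, freeBit_zero]
      · obtain rfl : j = n := by omega
        rw [upBit_ofFreeBits_last, funext (freeBit_zero w), prefixXor_false]
    · rw [leftBit_ofFreeBits w hi hj, leftBit_ofFreeBits w hi hj.le, upBit_ofFreeBits w _ hj,
        upBit_ofFreeBits w _ hj, prefixXor, prefixXor]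
      generalize prefixXor (freeBit w i) j = a, prefixXor (freeBit w (i + 1)) j = b,
        freeBit w i j = d, freeBit w (i + 1) j = e
      revert a b d e
      decide
  · rintro ⟨h0, h⟩
    have key : ∀ i, ∀ j < n, freeBit (n := n) (fun p => upBit c (p.1 + 1) p.2) i j =
        upBit c i j := by
      intro i j hj
      unfold freeBit
      split_ifs with hij
      · have : i - 1 + 1 = i := by omega
        simp only [this]
      · rcases Nat.eq_zero_or_pos i with rfl | hi
        · exact (h0.2 j (by omega)).symm
        · exact (upBit_of_le c (by omega) j).symm
    refine ⟨fun p => upBit c (p.1 + 1) p.2, funext fun s => ?_⟩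
    rcases s with ⟨i, j⟩ | ⟨i, j⟩
    · have h1 := leftBit_eq_of_cellEven h0 h i.2 j.2.le
      rw [leftBit_coe] at h1
      refine Eq.trans ?_ h1.symm
      rw [ofFreeBits]
      congr 1 <;> exact prefixXor_congr fun k hk => key _ k (by omega)
    · rw [← upBit_coe c, ofFreeBits]
      split_ifs with hj
      · exact key i j hj
      · have hjn : (j : ℕ) = n := by omega
        rw [hjn, upBit_last_of_cellEven h0 h]
        exact prefixXor_congr fun k hk => key _ k hk

lemma ofFreeBits_injective : Function.Injective (ofFreeBits (n := n)) := by
  intro w w' h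
  funext p
  have h1 := upBit_ofFreeBits w (p.1 + 1) p.2.2
  have h2 := upBit_ofFreeBits w' (p.1 + 1) p.2.2
  have hb : (1 ≤ (p.1 : ℕ) + 1 ∧ (p.1 : ℕ) + 1 < n) ∧ (p.2 : ℕ) < n := by omega
  rw [h, h2, freeBit, freeBit, dif_pos hb, dif_pos hb] at h1
  exact h1.symm

/-- These assignments are those that extend to a cycle, each in `2 ^ n ^ 2` ways. -/
lemma ncard_cellEven :
    {c : CIdx n → Bool | PendantFree c ∧ CellEven c}.ncard = 2 ^ (n * (n - 1)) := by
  rw [← range_ofFreeBits, ← Nat.card_coe_set_eq, Nat.card_range_of_injective ofFreeBits_injective]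
  simp [mul_comm]

lemma cellSum_one (h v h' v' : Bool) :
    cellSum (fun _ _ => 1) h v h' v' = if h' = (h ^^ (v ^^ v')) then 2 else 0 := by
  have : (Finset.univ.filter fun b : Fin 4 → Bool => CellCycle b h v h' v').card =
      if h' = (h ^^ (v ^^ v')) then 2 else 0 := by
    revert h v h' v'
    decide
  unfold cellSum
  simp only [Finset.prod_const_one, Finset.sum_boole, this]
  split_ifs <;> simp

theorem ncard_cycles (n : ℕ) : (cycles (gridGraph n)).ncard = 2 ^ (n ^ 2 + n * (n - 1)) := by
  classical
  have h1 : ((cycles (gridGraph n)).ncard : ℂ) = ∑ c : CIdx n → Bool, ∑ a : MIdx n → Bool,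
      if IsCycle (gridGraph n) (Sum.elim a c ∘ (edgeEquiv n).symm) then
        ∏ m : MIdx n, (fun _ _ => 1 : MIdx n → Bool → ℂ) m (a m) else 0 := by
    let e : (CIdx n → Bool) × (MIdx n → Bool) ≃ ((gridGraph n).edgeSet → Bool) :=
      (Equiv.prodComm _ _).trans ((Equiv.sumArrowEquivProdArrow _ _ _).symm.trans
        ((edgeEquiv n).arrowCongr (Equiv.refl _)))
    rw [Set.ncard_eq_toFinset_card', ← Fintype.sum_prod_type']
    simp only [Finset.prod_const_one, Finset.sum_boole]
    congr 1
    refine (Finset.card_equiv e fun x => ?_).symm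
    simp only [Finset.mem_filter, Finset.mem_univ, true_and, Set.mem_toFinset]
    rfl
  have h2 : ∀ c : CIdx n → Bool, (∏ p : Fin n × Fin n, cellSum (fun _ _ => 1) (leftBit c p.1 p.2)
      (upBit c p.1 p.2) (leftBit c p.1 (p.2 + 1)) (upBit c (p.1 + 1) p.2)) =
      if CellEven c then 2 ^ n ^ 2 else 0 := by
    intro c
    simp only [cellSum_one]
    split_ifs with h
    · rw [Finset.prod_congr rfl fun p _ => if_pos (h p.1 p.1.2 p.2 p.2.2)]
      simp [sq]
    · unfold CellEven at h
      push Not at h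
      obtain ⟨i, hi, j, hj, hne⟩ := h
      exact Finset.prod_eq_zero (Finset.mem_univ ((⟨i, hi⟩, ⟨j, hj⟩) : Fin n × Fin n)) (if_neg hne)
  have h3 : ∀ c : CIdx n → Bool, (∑ a : MIdx n → Bool,
      if IsCycle (gridGraph n) (Sum.elim a c ∘ (edgeEquiv n).symm) then
        ∏ m : MIdx n, (fun _ _ => 1 : MIdx n → Bool → ℂ) m (a m) else 0) =
      if PendantFree c ∧ CellEven c then 2 ^ n ^ 2 else 0 := by
    intro c
    refine (sum_cycles_eq_prod (fun _ _ => 1) c).trans ?_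
    rw [h2]
    simp [ite_and]
  rw [Finset.sum_congr rfl fun c _ => h3 c, ← Finset.sum_filter, Finset.sum_const,
    nsmul_eq_mul] at h1
  have h4 : (Finset.univ.filter fun c : CIdx n → Bool => PendantFree c ∧ CellEven c).card =
      2 ^ (n * (n - 1)) := by
    rw [← ncard_cellEven, Set.ncard_eq_toFinset_card']
    congr 1
    ext c
    simp
  rw [h4] at h1
  have h5 : ((cycles (gridGraph n)).ncard : ℂ) = ((2 ^ (n ^ 2 + n * (n - 1)) : ℕ) : ℂ) := by
    rw [h1]
    push_cast
    ring
  exact_mod_cast h5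

end CountCycles

/-! ### Amplitudes of the cells -/

section Amplitudes

/-- The amplitude of a qubit state at a bit. -/
def stateAmp (s : Expr × Expr) (b : Bool) : ℂ := (bif b then s.2 else s.1).value

/-- The four bits on the edges of a cell are determined up to a global flip. -/
lemma cellSum_eq (f : Fin 4 → Bool → ℂ) (h v h' v' : Bool) :
    cellSum f h v h' v' = if h' = (h ^^ (v ^^ v')) then
      f 0 false * f 1 h * f 2 v * f 3 (h' ^^ v) +
        f 0 true * f 1 (!h) * f 2 (!v) * f 3 (!(h' ^^ v)) else 0 := by
  have : (Finset.univ.filter fun b : Fin 4 → Bool => CellCycle b h v h' v') =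
      if h' = (h ^^ (v ^^ v')) then
        {![false, h, v, (h' ^^ v)], ![true, !h, !v, !(h' ^^ v)]} else ∅ := by
    revert h v h' v'
    decide
  unfold cellSum
  rw [← Finset.sum_filter, this]
  split_ifs
  · rw [Finset.sum_pair fun h => by simpa using congrFun h 0, Fin.prod_univ_four,
      Fin.prod_univ_four]
    rfl
  · rfl

/-- Each of the four amplitudes contains the factor `1 / √2`. -/
lemma normSq_cellSum_phase (f : Fin 4 → Bool → ℂ) (p : Fin 4 → ℂ)
    (hf : ∀ k b, f k b = Expr.invSqrtTwo.value * bif b then p k else 1) (h v h' v' : Bool) :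
    Complex.normSq (cellSum f h v h' v') =
      1 / 16 * Complex.normSq (cellSum (fun k b => bif b then p k else 1) h v h' v') := by
  have h1 : cellSum f h v h' v' = Expr.invSqrtTwo.value ^ 4 *
      cellSum (fun k b => bif b then p k else 1) h v h' v' := by
    simp only [cellSum, hf, Finset.prod_mul_distrib, Finset.prod_const, Finset.card_univ,
      Fintype.card_fin, Finset.mul_sum]
    refine Finset.sum_congr rfl fun b _ => ?_
    split_ifs <;> simp
  rw [h1, map_mul, map_pow, Complex.normSq_eq_norm_sq, Expr.norm_value_invSqrtTwo]
  norm_num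

/-- The bits on the edges that enter and leave a cell for which its amplitude does not vanish: the
two bits are exchanged in a diagonal cell, and they stay the same in any other cell, except that
they may both change from `0` to `1` in a cell that stands for an edge of the cubic graph. -/
abbrev CellAllowed (diag adj h v h' v' : Bool) : Prop :=
  (diag = true ∧ h' = v ∧ v' = h) ∨ (diag = false ∧ ((h' = h ∧ v' = v) ∨
    (adj = true ∧ h = false ∧ v = false ∧ h' = true ∧ v' = true)))

lemma normSq_one_add_omega : Complex.normSq (1 + Expr.omega.value) = 3 := by
  have h : (1 + Expr.omega.value) ^ 2 = 3 * Expr.omega.value := by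
    linear_combination Expr.value_omega_sq
  rw [Complex.normSq_eq_norm_sq, ← norm_pow, h, norm_mul, Expr.norm_value_omega]
  norm_num

lemma normSq_cellSum (diag adj h v h' v' : Bool) :
    Complex.normSq (cellSum (fun k => stateAmp (cellState diag adj k)) h v h' v') =
      if CellAllowed diag adj h v h' v' then
        1 / 4 * (if diag = false ∧ adj = true then 3 / 4 else 1) else 0 := by
  cases diag with
  | true =>
    have hr := Complex.normSq_eq_norm_sq Expr.invSqrtTwo.value
    rw [Expr.norm_value_invSqrtTwo] at hr
    rw [cellSum_eq]
    cases h <;> cases v <;> cases h' <;> cases v' <;>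
      simp [cellState, stateAmp, CellAllowed, Expr.value, Expr.value_zero, hr] <;> norm_num
  | false =>
    cases adj with
    | true =>
      rw [normSq_cellSum_phase _ ![Expr.omega.value - 1, 1 - Expr.omega.value,
        1 - Expr.omega.value, Expr.omega.value] fun k b => by
          fin_cases k <;> cases b <;> simp [stateAmp, cellState, Expr.value, sub_eq_add_neg],
        cellSum_eq]
      have hw := Expr.value_omega_sq
      have hz := normSq_one_add_omega
      generalize Expr.omega.value = w at hw hz
      -- Up to sign, each sum of two terms is either `1 + w` or `0`.
      have key : ∀ z, z = 1 + w → 16⁻¹ * Complex.normSq z = 4⁻¹ * (3 / 4) := by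
        rintro z rfl
        rw [hz]
        norm_num
      cases h <;> cases v <;> cases h' <;> cases v' <;> simp [CellAllowed]
      · exact key _ (by linear_combination (w ^ 2 - 2 * w) * hw)
      · exact key _ (by linear_combination (w - 2) * hw)
      · exact key _ (by linear_combination -2 * hw)
      · linear_combination (1 - w) * hw
      · linear_combination (1 - w) * hw
      · exact key _ (by linear_combination -2 * hw)
      · linear_combination (w - 1) * hw
      · rw [← Complex.normSq_neg]
        exact key _ (by linear_combination -2 * hw)
    | false =>
      rw [normSq_cellSum_phase _ (fun _ => Expr.imag.value) fun k b => by
          cases b <;> simp [stateAmp, cellState, Expr.value], cellSum_eq]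
      have hw := Expr.value_imag_sq
      generalize Expr.imag.value = w at hw
      -- Up to sign, each sum of two terms is either `2` or `0`.
      have key : ∀ z, z = 2 → 16⁻¹ * Complex.normSq z = 4⁻¹ := by
        rintro z rfl
        norm_num
      cases h <;> cases v <;> cases h' <;> cases v' <;> simp [CellAllowed]
      · exact key _ (by linear_combination (w ^ 2 - 1) * hw)
      · linear_combination w * hw
      · rw [← Complex.normSq_neg]
        exact key _ (by linear_combination -2 * hw)
      · linear_combination w * hw
      · linear_combination w * hw
      · rw [← Complex.normSq_neg]
        exact key _ (by linear_combination -2 * hw)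
      · linear_combination w * hw
      · rw [← Complex.normSq_neg]
        exact key _ (by linear_combination -2 * hw)

lemma normSq_stateAmp_endState (b v v' : Bool) :
    Complex.normSq (stateAmp (endState 0) b * stateAmp (endState 1) v *
      stateAmp (endState 2) v') = if b = true then 1 / 4 else 0 := by
  have hr := Complex.normSq_eq_norm_sq Expr.invSqrtTwo.value
  rw [Expr.norm_value_invSqrtTwo] at hr
  cases b <;> cases v <;> cases v' <;>
    simp [endState, stateAmp, Expr.value, Expr.value_zero, hr] <;> norm_num

variable (H : CubicGraph)

open scoped Classical in
/-- The bits on the discarded edges for which the amplitude does not vanish. -/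
def Consistent (c : CIdx H.n → Bool) : Prop :=
  PendantFree c ∧ (∀ i : Fin H.n, leftBit c i H.n = true) ∧
    ∀ p : Fin H.n × Fin H.n, CellAllowed (decide (p.1 = p.2)) (decide (H.graph.Adj p.1 p.2))
      (leftBit c p.1 p.2) (upBit c p.1 p.2) (leftBit c p.1 (p.2 + 1)) (upBit c (p.1 + 1) p.2)

open scoped Classical in
lemma card_neighborFinset (v : Fin H.n) :
    (Finset.univ.filter fun w => H.graph.Adj v w).card = 3 := by
  rw [← H.regular v, Set.ncard_eq_toFinset_card']
  congr 1
  ext w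
  simp

open scoped Classical in
lemma prod_adj : (∏ p : Fin H.n × Fin H.n,
    if decide (p.1 = p.2) = false ∧ decide (H.graph.Adj p.1 p.2) = true then (3 / 4 : ℝ) else 1) =
    (27 / 64) ^ H.n := by
  rw [Fintype.prod_prod_type]
  have : ∀ v : Fin H.n, (∏ w : Fin H.n,
      if decide (v = w) = false ∧ decide (H.graph.Adj v w) = true then (3 / 4 : ℝ) else 1) =
      27 / 64 := by
    intro v
    rw [← Finset.prod_filter, Finset.prod_const]
    have h : (Finset.univ.filter fun w =>
        decide (v = w) = false ∧ decide (H.graph.Adj v w) = true) =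
        Finset.univ.filter fun w => H.graph.Adj v w :=
      Finset.filter_congr fun w _ => by
        simp only [decide_eq_false_iff_not, decide_eq_true_eq, and_iff_right_iff_imp]
        exact fun h => h.ne
    rw [h, card_neighborFinset]
    norm_num
  rw [Finset.prod_congr rfl fun v _ => this v, Finset.prod_const, Finset.card_univ,
    Fintype.card_fin]

open scoped Classical in
lemma normSq_sum_cycles (c : CIdx H.n → Bool) :
    Complex.normSq (∑ a : MIdx H.n → Bool,
      if IsCycle (gridGraph H.n) (Sum.elim a c ∘ (edgeEquiv H.n).symm) then
        ∏ m, stateAmp (measuredState H m) (a m) else 0) =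
      if Consistent H c then (1 / 4) ^ H.n ^ 2 * (27 / 64) ^ H.n * (1 / 4) ^ H.n else 0 := by
  rw [sum_cycles_eq_prod (fun m => stateAmp (measuredState H m)) c]
  by_cases hp : PendantFree c
  swap
  · rw [if_neg hp, if_neg fun h => hp h.1, map_zero]
  rw [if_pos hp, map_mul, map_prod, map_prod]
  have h1 := fun p : Fin H.n × Fin H.n => normSq_cellSum (decide (p.1 = p.2))
    (decide (H.graph.Adj p.1 p.2)) (leftBit c p.1 p.2) (upBit c p.1 p.2)
    (leftBit c p.1 (p.2 + 1)) (upBit c (p.1 + 1) p.2)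
  have h2 := fun i : Fin H.n => normSq_stateAmp_endState (leftBit c i H.n) (upBit c i H.n)
    (upBit c (i + 1) H.n)
  refine (congrArg₂ (· * ·) (Finset.prod_congr rfl fun p _ => h1 p)
    (Finset.prod_congr rfl fun i _ => h2 i)).trans ?_
  by_cases hc : Consistent H c
  · rw [if_pos hc, Finset.prod_congr rfl fun p _ => if_pos (hc.2.2 p),
      Finset.prod_congr rfl fun i _ => if_pos (hc.2.1 i), Finset.prod_mul_distrib, prod_adj]
    simp [sq]
  · rw [if_neg hc]
    by_cases hl : ∀ i : Fin H.n, leftBit c i H.n = true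
    · have : ¬ ∀ p : Fin H.n × Fin H.n, CellAllowed (decide (p.1 = p.2))
        (decide (H.graph.Adj p.1 p.2)) (leftBit c p.1 p.2) (upBit c p.1 p.2)
        (leftBit c p.1 (p.2 + 1)) (upBit c (p.1 + 1) p.2) := fun h => hc ⟨hp, hl, h⟩
      obtain ⟨p, hp⟩ := not_forall.1 this
      exact mul_eq_zero_of_left (Finset.prod_eq_zero (Finset.mem_univ p) (if_neg hp)) _
    · obtain ⟨i, hi⟩ := not_forall.1 hl
      exact mul_eq_zero_of_right _ (Finset.prod_eq_zero (Finset.mem_univ i) (if_neg hi))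

/-- The overlap of the instance counts the consistent bits on the discarded edges. -/
theorem overlap_reduction : (reduction H).overlap =
    ((2 ^ (H.n ^ 2 + H.n * (H.n - 1)) : ℕ) : ℂ)⁻¹ *
      ({c | Consistent H c}.ncard *
        ((1 / 4) ^ H.n ^ 2 * (27 / 64) ^ H.n * (1 / 4) ^ H.n : ℝ)) := by
  classical
  have h := marginal_eq_sum_normSq (gridGraph H.n) (edgeEquiv H.n) (measured H.n)
    (fun s => by rcases s with m | c <;> simp [mem_measured])
    (fun j b => ((reduction H).amp j b).value) (fun m => stateAmp (measuredState H m))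
    (fun m => by
      funext b
      simp only [reduction, stateAmp, edgeState, Equiv.symm_apply_apply, Sum.elim_inl])
  rw [ncard_cycles] at h
  refine h.trans ?_
  congr 1
  have h2 : ∀ c : CIdx H.n → Bool, _ := fun c => congrArg Complex.ofReal (normSq_sum_cycles H c)
  trans ∑ c : CIdx H.n → Bool, ((if Consistent H c then
    (1 / 4) ^ H.n ^ 2 * (27 / 64) ^ H.n * (1 / 4) ^ H.n else 0 : ℝ) : ℂ)
  · refine Finset.sum_equiv (Equiv.refl _) (by simp) fun c _ => ?_
    rw [← h2]
    refine congrArg (fun z => ((Complex.normSq z : ℝ) : ℂ)) ?_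
    refine Finset.sum_equiv (Equiv.refl _) (by simp) fun a _ => ?_
    rfl
  · rw [← Complex.ofReal_sum, ← Finset.sum_filter, Finset.sum_const, Set.ncard_eq_toFinset_card']
    simp

end Amplitudes

/-! ### Consistent bits and perfect matchings -/

section Matchings

variable {H : CubicGraph} {c : CIdx H.n → Bool}

lemma Consistent.cell (hc : Consistent H c) {i j : ℕ} (hi : i < H.n) (hj : j < H.n) (hij : i ≠ j) :
    (leftBit c i (j + 1) = leftBit c i j ∧ upBit c (i + 1) j = upBit c i j) ∨
      (H.graph.Adj ⟨i, hi⟩ ⟨j, hj⟩ ∧ leftBit c i j = false ∧ upBit c i j = false ∧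
        leftBit c i (j + 1) = true ∧ upBit c (i + 1) j = true) := by
  rcases hc.2.2 (⟨i, hi⟩, ⟨j, hj⟩) with h | h
  · simp [hij] at h
  · simpa using h.2

lemma Consistent.diag (hc : Consistent H c) {i : ℕ} (hi : i < H.n) :
    leftBit c i (i + 1) = upBit c i i ∧ upBit c (i + 1) i = leftBit c i i := by
  rcases hc.2.2 (⟨i, hi⟩, ⟨i, hi⟩) with h | h
  · exact h.2
  · simp at h

lemma Consistent.upBit_last (hc : Consistent H c) {i : ℕ} (hi : i ≤ H.n) :
    upBit c i H.n = decide (Odd i) := by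
  induction i with
  | zero => simpa using hc.1.2 H.n (by omega)
  | succ i ih =>
    have h := hc.2.1 ⟨i, hi⟩
    rw [leftBit_last, ih (by omega)] at h
    simp only [Nat.odd_add_one, decide_not]
    revert h
    cases decide (Odd i) <;> cases upBit c (i + 1) H.n <;> simp

/-- Below the diagonal all bits vanish: a bit `1` would be passed on to the pendant edge at the
bottom. -/
lemma Consistent.upBit_eq_false (hc : Consistent H c) {k t : ℕ} (hk : k < H.n) (ht : k < t) :
    upBit c t k = false := by
  rcases Nat.lt_or_ge H.n t with h | h
  · exact upBit_of_le c h.le k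
  · induction h using Nat.decreasingInduction with
    | self => exact upBit_of_le c le_rfl k
    | of_succ t h ih =>
      have ih := ih (by omega)
      rcases hc.cell h hk ht.ne' with h' | h'
      · rw [← h'.2, ih]
      · exact h'.2.2.1

lemma Consistent.leftBit_eq_false (hc : Consistent H c) {k t : ℕ} (hk : k < H.n) (ht : t ≤ k) :
    leftBit c k t = false := by
  induction ht using Nat.decreasingInduction with
  | self => rw [← (hc.diag hk).2, hc.upBit_eq_false hk (by omega)]
  | of_succ t h ih =>
    rcases hc.cell hk (h.trans hk) h.ne' with h' | h'
    · rw [← h'.1, ih]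
    · exact h'.2.1

/-- The bit on line `k` before it meets line `t`. Line `k` runs down column `k` to the diagonal and
from there to the right along row `k`. -/
def lineBit (c : CIdx H.n → Bool) (k t : ℕ) : Bool :=
  if t ≤ k then upBit c t k else leftBit c k t

/-- Two lines only change their bits together, and only if they stand for adjacent vertices. -/
lemma Consistent.lineBit_step (hc : Consistent H c) {i j : ℕ} (hi : i < H.n) (hj : j < H.n)
    (hij : i ≠ j) :
    (lineBit c i (j + 1) = lineBit c i j ∧ lineBit c j (i + 1) = lineBit c j i) ∨
      (H.graph.Adj ⟨i, hi⟩ ⟨j, hj⟩ ∧ lineBit c i j = false ∧ lineBit c j i = false ∧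
        lineBit c i (j + 1) = true ∧ lineBit c j (i + 1) = true) := by
  have key : ∀ {i j : ℕ} (hi : i < H.n) (hj : j < H.n), i < j →
      (lineBit c i (j + 1) = lineBit c i j ∧ lineBit c j (i + 1) = lineBit c j i) ∨
      (H.graph.Adj ⟨i, hi⟩ ⟨j, hj⟩ ∧ lineBit c i j = false ∧ lineBit c j i = false ∧
        lineBit c i (j + 1) = true ∧ lineBit c j (i + 1) = true) := by
    intro i j hi hj hij
    unfold lineBit
    rw [if_neg (by omega), if_neg (by omega), if_pos (by omega), if_pos (by omega)]
    exact hc.cell hi hj hij.ne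
  rcases hij.lt_or_gt with h | h
  · exact key hi hj h
  · rcases key hj hi h with h' | ⟨h1, h2, h3, h4, h5⟩
    · exact Or.inl h'.symm
    · exact Or.inr ⟨h1.symm, h3, h2, h5, h4⟩

lemma Consistent.lineBit_self (hc : Consistent H c) {k : ℕ} (hk : k < H.n) :
    lineBit c k (k + 1) = lineBit c k k := by
  unfold lineBit
  rw [if_neg (by omega), if_pos le_rfl]
  exact (hc.diag hk).1

lemma Consistent.lineBit_zero (hc : Consistent H c) {k : ℕ} (hk : k < H.n) :
    lineBit c k 0 = false :=
  (if_pos (Nat.zero_le _)).trans (hc.1.2 k (by omega))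

lemma Consistent.lineBit_last (hc : Consistent H c) {k : ℕ} (hk : k < H.n) :
    lineBit c k H.n = true :=
  (if_neg (by omega)).trans (hc.2.1 ⟨k, hk⟩)

lemma Consistent.lineBit_succ (hc : Consistent H c) {k t : ℕ} (hk : k < H.n) (ht : t < H.n)
    (h : lineBit c k t = true) : lineBit c k (t + 1) = true := by
  rcases eq_or_ne k t with rfl | hkt
  · rw [hc.lineBit_self hk, h]
  · rcases hc.lineBit_step hk ht hkt with h' | h'
    · rw [h'.1, h]
    · exact h'.2.2.2.1

lemma Consistent.lineBit_mono (hc : Consistent H c) {k t t' : ℕ} (hk : k < H.n) (htt : t ≤ t')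
    (ht : t' ≤ H.n) (h : lineBit c k t = true) : lineBit c k t' = true := by
  induction t', htt using Nat.le_induction with
  | base => exact h
  | succ t' _ ih => exact hc.lineBit_succ hk (by omega) (ih (by omega))

/-- The bit on line `k` changes exactly once, where it meets the line of the partner of `k`. -/
lemma Consistent.exists_partner (hc : Consistent H c) (k : Fin H.n) :
    ∃ m : Fin H.n, ∀ t ≤ H.n, lineBit c k t = decide ((m : ℕ) < t) := by
  have hex : ∃ t, lineBit c k t = true := ⟨_, hc.lineBit_last k.2⟩
  have hle : Nat.find hex ≤ H.n := Nat.find_min' hex (hc.lineBit_last k.2)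
  have hpos : Nat.find hex ≠ 0 := fun h => by
    have := Nat.find_spec hex
    rw [h, hc.lineBit_zero k.2] at this
    simp at this
  refine ⟨⟨Nat.find hex - 1, by omega⟩, fun t ht => ?_⟩
  by_cases h : Nat.find hex ≤ t
  · rw [hc.lineBit_mono k.2 h ht (Nat.find_spec hex), eq_comm, decide_eq_true_iff]
    simp only
    omega
  · have := Nat.find_min hex (not_le.1 h)
    rw [Bool.not_eq_true] at this
    rw [this, eq_comm, decide_eq_false_iff_not]
    simp only
    omega

/-- Perfect matchings as fixed-point-free involutions. -/
def matchings (H : CubicGraph) : Set (Fin H.n → Fin H.n) :=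
  {m | ∀ k, H.graph.Adj k (m k) ∧ m (m k) = k}

/-- The bits on the discarded edges that belong to a perfect matching: line `k` carries the bit `1`
after it has met the line of the partner of `k`, and in the last column the bits alternate. -/
def matchingBits (m : Fin H.n → Fin H.n) : CIdx H.n → Bool
  | .inl (i, j) => decide (i < j ∧ m i < j)
  | .inr (i, j) => if h : (j : ℕ) < H.n then decide ((i : ℕ) ≤ j ∧ m ⟨j, h⟩ < i)
    else decide (Odd (i : ℕ))

/-- The handshake lemma: a cubic graph has an even number of vertices. Hence the bits alternating in
the last column end with `0` below the last row. -/
lemma even_n (H : CubicGraph) : Even H.n := by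
  classical
  have h := H.graph.even_card_odd_degree_vertices
  have h3 : ∀ v, H.graph.degree v = 3 := fun v => by
    rw [← H.regular v, ← SimpleGraph.card_neighborSet_eq_degree, ← Nat.card_coe_set_eq,
      Nat.card_eq_fintype_card]
  have hu : (Finset.univ.filter fun v => Odd (H.graph.degree v)) = Finset.univ :=
    Finset.filter_true_of_mem fun v _ => by rw [h3]; decide
  rw [hu] at h
  simpa using h

lemma upBit_matchingBits (m : Fin H.n → Fin H.n) (i : ℕ) (j : Fin H.n) :
    upBit (matchingBits m) i j = decide (i ≤ j ∧ (m j : ℕ) < i) := by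
  rcases Nat.lt_or_ge i H.n with hi | hi
  · have h := upBit_coe (matchingBits m) ⟨i, hi⟩ j.castSucc
    refine h.trans ?_
    exact dif_pos (c := (j.castSucc : ℕ) < H.n) j.2
  · rw [upBit_of_le _ hi, eq_comm, decide_eq_false_iff_not]
    omega

lemma upBit_matchingBits_last (m : Fin H.n → Fin H.n) {i : ℕ} (hi : i ≤ H.n) :
    upBit (matchingBits m) i H.n = decide (Odd i) := by
  rcases hi.lt_or_eq with hi | rfl
  · have h := upBit_coe (matchingBits m) ⟨i, hi⟩ (Fin.last _)
    refine h.trans ?_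
    rw [matchingBits, dif_neg (by simp)]
  · rw [upBit_of_le _ le_rfl, eq_comm, decide_eq_false_iff_not, Nat.not_odd_iff_even]
    exact even_n H

lemma leftBit_matchingBits (m : Fin H.n → Fin H.n) (i : Fin H.n) {j : ℕ} (hj : j ≤ H.n) :
    leftBit (matchingBits m) i j = decide ((i : ℕ) < j ∧ (m i : ℕ) < j) := by
  rcases hj.lt_or_eq with hj | rfl
  · exact leftBit_coe (matchingBits m) i ⟨j, hj⟩
  · have hi : (i : ℕ) < H.n ∧ (m i : ℕ) < H.n := ⟨i.2, (m i).2⟩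
    rw [leftBit_last, upBit_matchingBits_last m i.2.le, upBit_matchingBits_last m i.2,
      decide_eq_true hi]
    simp only [Nat.odd_add_one, decide_not]
    cases decide (Odd (i : ℕ)) <;> rfl

lemma consistent_matchingBits {m : Fin H.n → Fin H.n} (hm : m ∈ matchings H) :
    Consistent H (matchingBits m) := by
  refine ⟨⟨fun i hi => ?_, fun j hj => ?_⟩, fun i => ?_, fun ⟨i, j⟩ => ?_⟩
  · rw [leftBit_matchingBits m ⟨i, hi⟩ (Nat.zero_le _)]
    simp
  · rcases Nat.lt_or_ge j H.n with h | h
    · rw [upBit_matchingBits m 0 ⟨j, h⟩]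
      simp
    · obtain rfl : j = H.n := by omega
      rw [upBit_matchingBits_last m (Nat.zero_le _)]
      rfl
  · rw [leftBit_matchingBits m i le_rfl]
    simp
  · dsimp only
    rw [leftBit_matchingBits m i j.2.le, leftBit_matchingBits m i j.2, upBit_matchingBits,
      upBit_matchingBits]
    have hne : ∀ k, m k ≠ k := fun k => (hm k).1.ne'
    rcases lt_trichotomy i j with hij | rfl | hij
    · have h1 : (i : ℕ) < j := hij
      refine Or.inr ⟨decide_eq_false hij.ne, ?_⟩
      by_cases h : m i = j
      · have h' : m j = i := by rw [← h, (hm i).2]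
        refine Or.inr ⟨by classical exact decide_eq_true (h ▸ (hm i).1), ?_⟩
        rw [h, h']
        simp
        omega
      · have h' : m j ≠ i := fun h' => h (by rw [← h', (hm j).2])
        rw [Ne, Fin.ext_iff] at h'
        rw [Fin.ext_iff] at h
        refine Or.inl ⟨?_, ?_⟩ <;> rw [decide_eq_decide] <;> omega
    · have h := hne i
      rw [Ne, Fin.ext_iff] at h
      refine Or.inl ⟨decide_eq_true rfl, ?_, ?_⟩ <;> rw [decide_eq_decide] <;> omega
    · have h1 : (j : ℕ) < i := hij
      refine Or.inr ⟨decide_eq_false hij.ne', Or.inl ⟨?_, ?_⟩⟩ <;>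
        rw [decide_eq_decide] <;> omega

lemma lineBit_matchingBits (m : Fin H.n → Fin H.n) (k : Fin H.n) {t : ℕ} (ht : t ≤ H.n) :
    lineBit (matchingBits m) k t = decide ((m k : ℕ) < t) := by
  unfold lineBit
  split_ifs with h
  · rw [upBit_matchingBits, decide_eq_decide]
    exact and_iff_right h
  · rw [leftBit_matchingBits m k ht, decide_eq_decide]
    exact and_iff_right (not_le.1 h)

lemma matchingBits_injective : Function.Injective (matchingBits (H := H)) := by
  intro m m' h
  funext k
  have key : ∀ t ≤ H.n, ((m k : ℕ) < t ↔ (m' k : ℕ) < t) := fun t ht => by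
    rw [← decide_eq_decide, ← lineBit_matchingBits m k ht, h, lineBit_matchingBits m' k ht]
  have h1 := key (m k + 1) (m k).2
  have h2 := key (m' k + 1) (m' k).2
  exact Fin.ext (by omega)

lemma Consistent.exists_matching (hc : Consistent H c) :
    ∃ m ∈ matchings H, matchingBits m = c := by
  choose m hm using hc.exists_partner
  have hm1 : ∀ k : Fin H.n, lineBit c k (m k) = false := fun k => by
    rw [hm k _ (m k).2.le]
    simp
  have hm2 : ∀ k : Fin H.n, lineBit c k (m k + 1) = true := fun k => by
    rw [hm k _ (m k).2]
    simp
  have hne : ∀ k : Fin H.n, (k : ℕ) ≠ m k := fun k h => by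
    have h1 := hm1 k
    have h2 := hm2 k
    rw [← h] at h1 h2
    rw [hc.lineBit_self k.2, h1] at h2
    simp at h2
  have hstep : ∀ k, H.graph.Adj k (m k) ∧ lineBit c (m k) k = false ∧
      lineBit c (m k) (k + 1) = true := fun k => by
    rcases hc.lineBit_step k.2 (m k).2 (hne k) with h | h
    · have := h.1
      rw [hm1, hm2] at this
      simp at this
    · exact ⟨h.1, h.2.2.1, h.2.2.2.2⟩
  refine ⟨m, fun k => ⟨(hstep k).1, ?_⟩, funext fun s => ?_⟩
  · have h1 := (hstep k).2.1
    have h2 := (hstep k).2.2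
    rw [hm (m k) _ k.2.le, decide_eq_false_iff_not] at h1
    rw [hm (m k) _ k.2, decide_eq_true_iff] at h2
    exact Fin.ext (by omega)
  · rcases s with ⟨i, j⟩ | ⟨i, j⟩
    · rw [← leftBit_coe c, matchingBits]
      by_cases hij : i < j
      · have h := hm i j j.2.le
        rw [lineBit, if_neg (not_le.2 (Fin.lt_def.1 hij))] at h
        rw [h, decide_eq_decide]
        exact and_iff_right hij
      · rw [hc.leftBit_eq_false i.2 (not_lt.1 hij), decide_eq_false_iff_not]
        exact fun h => hij h.1
    · rw [← upBit_coe c, matchingBits]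
      split_ifs with hj
      · by_cases hij : (i : ℕ) ≤ j
        · have h := hm ⟨j, hj⟩ i i.2.le
          rw [lineBit, if_pos hij] at h
          refine Eq.trans ?_ h.symm
          rw [decide_eq_decide]
          exact and_iff_right hij
        · rw [hc.upBit_eq_false hj (not_le.1 hij), decide_eq_false_iff_not]
          exact fun h => hij h.1
      · have hjn : (j : ℕ) = H.n := by omega
        rw [hjn, hc.upBit_last i.2.le]

lemma ncard_consistent (H : CubicGraph) : {c | Consistent H c}.ncard = (matchings H).ncard := by
  rw [← Set.ncard_image_of_injective _ (matchingBits_injective (H := H))]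
  congr 1
  ext c
  constructor
  · exact fun hc => Consistent.exists_matching hc
  · rintro ⟨m, hm, rfl⟩
    exact consistent_matchingBits hm

open scoped Classical in
lemma perfMatch_eq (H : CubicGraph) : H.perfMatch = (matchings H).ncard := by
  refine (Set.ncard_congr (fun m hm => ({
    verts := Set.univ
    Adj := fun a b => m a = b
    adj_sub := fun {a b} h => h ▸ (hm a).1
    edge_vert := fun _ => Set.mem_univ _
    symm := ⟨fun a b h => h ▸ (hm a).2⟩ } : H.graph.Subgraph)) ?_ ?_ ?_).symm
  · exact fun m hm => ⟨fun v _ => ⟨m v, rfl, fun w hw => Eq.symm hw⟩, fun v => Set.mem_univ v⟩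
  · intro m m' hm hm' h
    funext k
    have := congrFun (congrFun (congrArg SimpleGraph.Subgraph.Adj h) k) (m k)
    exact Eq.symm ((eq_iff_iff.1 this).1 rfl)
  · intro P hP
    choose m hm hu using fun v => hP.1 (hP.2 v)
    have hinv : ∀ k, m (m k) = k := fun k => (hu (m k) k (hm k).symm).symm
    refine ⟨m, fun k => ⟨P.adj_sub (hm k), hinv k⟩, ?_⟩
    ext a b
    · simp [hP.2 a]
    · exact ⟨fun h => h ▸ hm a, fun h => (hu a b h).symm⟩

end Matchings

/-! ### The value of the instance -/

/-- The constant collects the number of cycles, a factor `4` for each cell and for each row end, and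
a factor `4 / 3` for each of the three neighbours of each vertex. -/
theorem perfMatch_eq_mul_overlap (H : CubicGraph) :
    (H.perfMatch : ℂ) = ((reductionConst H.n).value : ℂ) * (reduction H).overlap := by
  have hpow : H.n ^ 2 + H.n * (H.n - 1) + H.n = 2 * H.n ^ 2 := by
    rcases H.n with _ | m
    · rfl
    · rw [Nat.add_sub_cancel]
      ring
  have h1 : (2 : ℂ) ^ (H.n ^ 2 + H.n * (H.n - 1)) * 2 ^ H.n = 4 ^ H.n ^ 2 := by
    rw [← pow_add, hpow, pow_mul]
    norm_num
  have h2 : (16 : ℂ) ^ H.n ^ 2 * (1 / 4) ^ H.n ^ 2 = 4 ^ H.n ^ 2 := by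
    rw [← mul_pow]
    norm_num
  have h3 : (128 / 27 : ℂ) ^ H.n * ((27 / 64) ^ H.n * (1 / 4) ^ H.n) * 2 ^ H.n = 1 := by
    rw [← mul_pow, ← mul_pow, ← mul_pow]
    norm_num
  rw [overlap_reduction, ncard_consistent, ← perfMatch_eq, value_reductionConst]
  push_cast
  rw [eq_comm, ← mul_assoc, ← div_eq_mul_inv, div_mul_eq_mul_div,
    div_eq_iff (pow_ne_zero _ two_ne_zero)]
  have h4 : (2 : ℂ) ^ H.n ≠ 0 := pow_ne_zero _ two_ne_zero
  refine mul_right_cancel₀ h4 ?_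
  linear_combination (H.perfMatch : ℂ) * (4 ^ H.n ^ 2 * h3 - h1 +
    (128 / 27 : ℂ) ^ H.n * ((27 / 64) ^ H.n * (1 / 4) ^ H.n) * 2 ^ H.n * h2)

end SurfaceCode

end

theorem mainTheorem4 :
    ∃ f : SurfaceCode.CubicGraph → SurfaceCode.SCMInstance × SurfaceCode.RealConst,
      Nonempty (Turing.TM2ComputableInPolyTime
        SurfaceCode.CubicGraph.encode SurfaceCode.encodeOutput f) ∧
      (∃ p : Polynomial ℕ, ∀ H : SurfaceCode.CubicGraph,
        (f H).1.numV + (f H).1.numE ≤ p.eval H.n) ∧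
      ∀ H : SurfaceCode.CubicGraph,
        (H.perfMatch : ℂ) = ((f H).2.value : ℂ) * (f H).1.overlap := by
  refine ⟨fun H => (SurfaceCode.reduction H, SurfaceCode.reductionConst H.n),
    SurfaceCode.computable_of_programOutput _ _ _ SurfaceCode.encodeOutput_reduction,
    ⟨4 * ((.X + 1) * (.X + 1)) + .X * (6 * .X + 4), fun H => ?_⟩,
    SurfaceCode.perfMatch_eq_mul_overlap⟩
  change SurfaceCode.numVertices H.n + (SurfaceCode.edgeList H.n).length ≤ _
  rw [SurfaceCode.length_edgeList]
  simp
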